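/- **Setting.** Let $(M,g)$ be a non-empty smooth 3-dimensional Lorentzian manifold, signature $(+,+,-)$. Let $(V,\eta)$ be the model space with basis $e_0,e_1,e_2$ and $\eta_{02}=\eta_{20}=-1$, $\eta_{11}=\tfrac12$, all other products zero. A *moving null frame* is a triple of smooth vector fields $(e_0,e_1,e_2)=(\ell,m,n)$ on an open set with $g(e_a,e_b)=\eta_{ab}$. Relative to such a frame let $R^{(p)}=(R_{abcd},\dots,R_{abcd;e_1\dots e_p})\in\mathcal R^p=\bigotimes^4V^*\oplus\dots\oplus\bigotimes^{4+p}V^*$ be the components of the Riemann tensor and its first $p$ covariant derivatives, and let $\hat R^{(p)}$ be the $O(\eta)$-equivariant lift of $R^{(p)}$ to the bundle of orthonormal frames. * $(M,g)$ is *fully regular* if for every $p$ the rank $r_p$ of $\hat R^{(p)}$ is constant; $q$ is then the smallest integer $\ge 0$ with $r_{q-1}=r_q$, where $r_{-1}=0$. * A *$p$-th order normalizing cross-section* is a submanifold $S\subset\mathcal R^p$ such that some subgroup $G_p\subset O(\eta)$ fixes $S$ pointwise; $X\in O(\eta)$ and $X(S)\cap S\ne\emptyset$ imply $X\in G_p$;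 and $M$ is covered by moving null frames in which $R^{(p)}$ takes values in $S$. $(M,g)$ is *curvature regular* if one exists for every $p$. Then $s_p=\dim G_p$, and $t_p$ is the rank of $R^{(p)}$ in such frames. * $(M,g)$ is *$\mathrm{CH}_0$* if it is curvature regular and $t_0=0$. It has *$k$-th order pseudo-stabilization* ($k\ge1$) if it is curvature regular and $s_k=s_{k-1}>s_q$. * Write $R_{ab}=R^c{}_{acb}$, $R=R^a{}_a$, $S_{ab}=R_{ab}-\tfrac13Rg_{ab}$, and $\Psi_0=S_{00}$, $\Psi_1=S_{01}$, $\Psi_2=S_{02}$, $\Psi_3=S_{12}$, $\Psi_4=S_{22}$. The curvature is of *type DZ* if at every point the quartic $\Psi_0+4\Psi_1z+6\Psi_2z^2+4\Psi_3z^3+\Psi_4z^4$ has two double roots that are non-real and complex conjugate (this does not depend on the frame). * The spin coefficients are defined by $\Gamma_{ab}=g(e_a,\nabla e_b)$ and $\Gamma_{01}=\kappa\omega^0+\sigma\omega^1+\tau\omega^2$, $\Gamma_{02}=2(\epsilon\omega^0+\alpha\omega^1+\gamma\omega^2)$, $\Gamma_{12}=\pi\omega^0+\lambda\omega^1+\nu\omega^2$,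 where $\omega^a$ is the dual coframe. **Proposition.** Let $(M,g)$ be fully regular, of type DZ at all points, and $\mathrm{CH}_0$. 1. $(M,g)$ does not have $k$-th order pseudo-stabilization for any $k\ge1$. 2. If $s_1=s_0$, then in every moving null frame in which $\Psi_1=\Psi_3=0$ and $\Psi_0=\Psi_4=3\Psi_2\neq0$ one has $$\epsilon=\gamma=\sigma-\lambda=0,\qquad \kappa-\pi=-(\tau-\nu)=2\alpha,\qquad 4\alpha^2=\Psi_2-\tfrac{R}{12},$$ and $\alpha$, as well as all components $R_{abcd}$ and $R_{abcd;e}$, are locally constant. -/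

import Mathlib

open scoped Manifold ContDiff Topology Matrix

noncomputable section

namespace Lorentz3

/-! ### The model inner product space `(V, η)`, in a null basis `(ℓ, m, n)` -/

/-- `η(ℓ, n) = -1`, `η(m, m) = 1/2`, all other products zero. -/
def eta : Matrix (Fin 3) (Fin 3) ℝ := !![0, 0, -1; 0, 1 / 2, 0; -1, 0, 0]

/-- The inverse matrix `η^{ab}`. -/
def etaInv : Matrix (Fin 3) (Fin 3) ℝ := !![0, 0, -1; 0, 2, 0; -1, 0, 0]

theorem eta_mul_etaInv : eta * etaInv = 1 := by
  ext i j
  fin_cases i <;> fin_cases j <;>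
    simp [eta, etaInv, Matrix.mul_apply, Fin.sum_univ_three]

/-- The group `O(η)`. -/
def orthGroup : Subgroup (GL (Fin 3) ℝ) where
  carrier := {X | (X : Matrix (Fin 3) (Fin 3) ℝ)ᵀ * eta * (X : Matrix (Fin 3) (Fin 3) ℝ) = eta}
  one_mem' := by simp
  mul_mem' := by
    intro X Y hX hY
    simp only [Set.mem_ofPred_eq] at hX hY ⊢
    calc ((X * Y : GL (Fin 3) ℝ) : Matrix (Fin 3) (Fin 3) ℝ)ᵀ * eta *
          ((X * Y : GL (Fin 3) ℝ) : Matrix (Fin 3) (Fin 3) ℝ)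
        = (Y : Matrix (Fin 3) (Fin 3) ℝ)ᵀ * ((X : Matrix (Fin 3) (Fin 3) ℝ)ᵀ * eta *
          (X : Matrix (Fin 3) (Fin 3) ℝ)) * (Y : Matrix (Fin 3) (Fin 3) ℝ) := by
          simp only [Units.val_mul, Matrix.transpose_mul, Matrix.mul_assoc]
      _ = eta := by rw [hX, hY]
  inv_mem' := by
    intro X hX
    simp only [Set.mem_ofPred_eq] at hX ⊢
    have h1 : (X : Matrix (Fin 3) (Fin 3) ℝ) * ((X⁻¹ : GL (Fin 3) ℝ) : Matrix _ _ ℝ) = 1 := by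
      rw [← Units.val_mul, mul_inv_cancel, Units.val_one]
    have h2 : ((X⁻¹ : GL (Fin 3) ℝ) : Matrix (Fin 3) (Fin 3) ℝ)ᵀ *
        (X : Matrix (Fin 3) (Fin 3) ℝ)ᵀ = 1 := by
      rw [← Matrix.transpose_mul, h1, Matrix.transpose_one]
    calc ((X⁻¹ : GL (Fin 3) ℝ) : Matrix (Fin 3) (Fin 3) ℝ)ᵀ * eta *
          ((X⁻¹ : GL (Fin 3) ℝ) : Matrix (Fin 3) (Fin 3) ℝ)
        = ((X⁻¹ : GL (Fin 3) ℝ) : Matrix (Fin 3) (Fin 3) ℝ)ᵀ *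
          ((X : Matrix (Fin 3) (Fin 3) ℝ)ᵀ * eta * (X : Matrix (Fin 3) (Fin 3) ℝ)) *
          ((X⁻¹ : GL (Fin 3) ℝ) : Matrix (Fin 3) (Fin 3) ℝ) := by rw [hX]
      _ = (((X⁻¹ : GL (Fin 3) ℝ) : Matrix (Fin 3) (Fin 3) ℝ)ᵀ *
          (X : Matrix (Fin 3) (Fin 3) ℝ)ᵀ) * eta *
          ((X : Matrix (Fin 3) (Fin 3) ℝ) *
            ((X⁻¹ : GL (Fin 3) ℝ) : Matrix (Fin 3) (Fin 3) ℝ)) := by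
          simp only [Matrix.mul_assoc]
      _ = eta := by rw [h1, h2, Matrix.one_mul, Matrix.mul_one]

/-- The Lie algebra of a closed subgroup `G` of `GL₃(ℝ)`: the generators of the one-parameter
subgroups that lie in `G` (for closed `G` these already form a linear subspace). -/
def lieAlg (G : Subgroup (GL (Fin 3) ℝ)) : Submodule ℝ (Matrix (Fin 3) (Fin 3) ℝ) :=
  Submodule.span ℝ {A | ∀ t : ℝ, ∃ X ∈ G,
    (X : Matrix (Fin 3) (Fin 3) ℝ) = NormedSpace.exp (t • A)}

/-- The dimension of a closed subgroup `G` of `GL₃(ℝ)`. -/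
def groupDim (G : Subgroup (GL (Fin 3) ℝ)) : ℕ := Module.finrank ℝ (lieAlg G)

/-- Component arrays of covariant tensors of rank `k` on `V`. -/
abbrev Tensor (k : ℕ) : Type := (Fin k → Fin 3) → ℝ

/-- The space `⊗⁴V* ⊕ ⋯ ⊕ ⊗⁴⁺ᵖV*`. -/
abbrev CurvSpace (p : ℕ) : Type := (j : Fin (p + 1)) → Tensor (4 + (j : ℕ))

/-- The action of `GL₃(ℝ)` on covariant tensors: `(X · T)(v₁, …) = T(X⁻¹v₁, …)`. -/
def tensorAct {k : ℕ} (X : GL (Fin 3) ℝ) (T : Tensor k) : Tensor k := fun a =>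
  ∑ b : Fin k → Fin 3, (∏ i, ((X⁻¹ : GL (Fin 3) ℝ) : Matrix (Fin 3) (Fin 3) ℝ) (b i) (a i)) * T b

/-- The diagonal action on `⊗⁴V* ⊕ ⋯ ⊕ ⊗⁴⁺ᵖV*`. -/
def act {p : ℕ} (X : GL (Fin 3) ℝ) (T : CurvSpace p) : CurvSpace p := fun j => tensorAct X (T j)

/-- The infinitesimal action `(A · T)_{a₁…a_k} = - ∑ᵢ A^b_{aᵢ} T_{a₁…b…a_k}`. -/
def tensorInfAct {k : ℕ} (A : Matrix (Fin 3) (Fin 3) ℝ) (T : Tensor k) : Tensor k := fun a =>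
  -∑ i, ∑ b, A b (a i) * T (Function.update a i b)

/-- The diagonal infinitesimal action on `⊗⁴V* ⊕ ⋯ ⊕ ⊗⁴⁺ᵖV*`. -/
def infAct {p : ℕ} (A : Matrix (Fin 3) (Fin 3) ℝ) (T : CurvSpace p) : CurvSpace p :=
  fun j => tensorInfAct A (T j)

/-- Embedded smooth submanifolds of a normed space, through slice charts. -/
def IsSubmanifold {E : Type*} [NormedAddCommGroup E] [NormedSpace ℝ E] (S : Set E) : Prop :=
  ∃ d : ℕ, ∀ s ∈ S, ∃ φ : OpenPartialHomeomorph E E, s ∈ φ.source ∧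
    ContDiffOn ℝ ∞ φ φ.source ∧ ContDiffOn ℝ ∞ φ.symm φ.target ∧
    ∃ F : Submodule ℝ E, Module.finrank ℝ F = d ∧ φ '' (S ∩ φ.source) = (F : Set E) ∩ φ.target

/-! ### Lorentzian metrics, moving null frames and their curvature components -/

section Manifold

variable {M : Type*} [TopologicalSpace M] [ChartedSpace (EuclideanSpace ℝ (Fin 3)) M]
  [IsManifold (𝓡 3) ∞ M]

variable (M) in
/-- A smooth Lorentzian metric (signature `(+,+,-)`) on a smooth 3-manifold: a smooth symmetric
bilinear form such that every tangent space is isometric to `(V, η)`. -/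
structure LorentzMetric where
  inner (x : M) : TangentSpace (𝓡 3) x →L[ℝ] TangentSpace (𝓡 3) x →L[ℝ] ℝ
  symm (x : M) (v w : TangentSpace (𝓡 3) x) : inner x v w = inner x w v
  signature (x : M) : ∃ b : Module.Basis (Fin 3) ℝ (TangentSpace (𝓡 3) x),
    ∀ i j, inner x (b i) (b j) = eta i j
  contMDiff : ContMDiff (𝓡 3)
    ((𝓡 3).prod 𝓘(ℝ, EuclideanSpace ℝ (Fin 3) →L[ℝ] EuclideanSpace ℝ (Fin 3) →L[ℝ] ℝ)) ∞
    (fun x ↦ Bundle.TotalSpace.mk'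
      (EuclideanSpace ℝ (Fin 3) →L[ℝ] EuclideanSpace ℝ (Fin 3) →L[ℝ] ℝ)
      (E := fun x : M => TangentSpace (𝓡 3) x →L[ℝ] TangentSpace (𝓡 3) x →L[ℝ] ℝ) x (inner x))

/-- A moving `η`-frame `(e₀, e₁, e₂) = (ℓ, m, n)` on an open set `dom` (values outside `dom`
are irrelevant). It is the dual datum of an `η`-orthogonal moving coframe. -/
structure NullFrame (g : LorentzMetric M) where
  dom : Set M
  isOpen_dom : IsOpen dom
  e (a : Fin 3) (x : M) : TangentSpace (𝓡 3) x
  contMDiffOn (a : Fin 3) : ContMDiffOn (𝓡 3) (𝓡 3).tangent ∞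
    (fun x ↦ (⟨x, e a x⟩ : TangentBundle (𝓡 3) M)) dom
  inner_eq : ∀ x ∈ dom, ∀ a b, g.inner x (e a x) (e b x) = eta a b

namespace NullFrame

variable {g : LorentzMetric M} (F : NullFrame g)

/-- The derivative of a function along `e_a`; `D`, `δ`, `Δ` are the cases `a = 0, 1, 2`. -/
def deriv (a : Fin 3) (f : M → ℝ) (x : M) : ℝ := mfderiv (𝓡 3) 𝓘(ℝ, ℝ) f x (F.e a x)

/-- `g([e_a, e_b], e_c)`. -/
def bracketLow (a b c : Fin 3) (x : M) : ℝ :=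
  g.inner x (VectorField.mlieBracket (𝓡 3) (F.e a) (F.e b) x) (F.e c x)

/-- The components `c` in `[e_a, e_b] = ∑ f, (bracket a b f) e_f`. -/
def bracket (a b f : Fin 3) (x : M) : ℝ := ∑ h, etaInv f h * F.bracketLow a b h x

/-- `g(∇_{e_a} e_b, e_c)` for the Levi-Civita connection, by the Koszul formula (the inner products
`g(e_a, e_b)` are constant). -/
def connLow (a b c : Fin 3) (x : M) : ℝ :=
  (F.bracketLow a b c x - F.bracketLow a c b x - F.bracketLow b c a x) / 2

/-- The components in `∇_{e_a} e_b = ∑ c, (conn c a b) e_c`. -/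
def conn (c a b : Fin 3) (x : M) : ℝ := ∑ d, etaInv c d * F.connLow a b d x

/-- The Riemann tensor `R^a_{bcd}`: `R(e_c, e_d) e_b = ∑ a, (riemUp a b c d) e_a`, where
`R(X, Y) = ∇_X ∇_Y - ∇_Y ∇_X - ∇_{[X, Y]}`. -/
def riemUp (a b c d : Fin 3) (x : M) : ℝ :=
  F.deriv c (F.conn a d b) x - F.deriv d (F.conn a c b) x
    + ∑ f, (F.conn f d b x * F.conn a c f x - F.conn f c b x * F.conn a d f x
      - F.bracket c d f x * F.conn a f b x)

/-- `R_{abcd} = η_{af} R^f_{bcd}`, as an array. -/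
def riem (x : M) : Tensor 4 := fun i => ∑ f, eta (i 0) f * F.riemUp f (i 1) (i 2) (i 3) x

/-- The covariant derivative of a covariant tensor field, in frame components; the last index is
the differentiation index:
`T_{a₁…a_k;e} = e_e(T_{a₁…a_k}) - ∑ᵢ ∑_b Γ^b_{e aᵢ} T_{a₁…b…a_k}`. -/
def covDer {k : ℕ} (T : M → Tensor k) (x : M) : Tensor (k + 1) := fun i =>
  F.deriv (i (Fin.last k)) (fun y => T y (Fin.init i)) x
    - ∑ j : Fin k, ∑ b, F.conn b (i (Fin.last k)) (i j.castSucc) x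
        * T x (Function.update (Fin.init i : Fin k → Fin 3) j b)

/-- `R_{abcd;e₁…e_p}`. -/
def riemDer : (p : ℕ) → M → Tensor (4 + p)
  | 0 => F.riem
  | p + 1 => F.covDer (riemDer p)

/-- `R^{(p)} = (R_{abcd}, …, R_{abcd;e₁…e_p})`. -/
def curv (p : ℕ) (x : M) : CurvSpace p := fun j => F.riemDer (j : ℕ) x

/-- The image of the differential at `x` of `R^{(p)}` (relative to the moving frame). -/
def horizontalRange (p : ℕ) (x : M) : Submodule ℝ (CurvSpace p) :=
  LinearMap.range (mfderiv (𝓡 3) 𝓘(ℝ, CurvSpace p) (F.curv p) x).toLinearMap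

/-- The rank, at the point of the orthonormal frame bundle given by the frame at `x`, of the
`O(η)`-equivariant lift of the curvature and its first `p` covariant derivatives. The tangent space
of the bundle is spanned by the image of the section `F` and the vertical directions, on which the
differential of the lift is the infinitesimal action of `𝔬(η)`. -/
def liftedRank (p : ℕ) (x : M) : ℕ :=
  Module.finrank ℝ ↥(F.horizontalRange p x ⊔
    Submodule.span ℝ {T | ∃ A ∈ lieAlg orthGroup, T = infAct A (F.curv p x)})

/-! Ricci components, curvature scalars and spin coefficients -/

/-- `R_{ab} = R^c_{acb}`. -/
def ricci (a b : Fin 3) (x : M) : ℝ := ∑ c, F.riemUp c a c b x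

/-- `R = R^a_a`. -/
def scal (x : M) : ℝ := ∑ a, ∑ b, etaInv a b * F.ricci a b x

/-- The trace-free Ricci tensor `S_{ab} = R_{ab} - (R/3) g_{ab}`. -/
def ricciTF (a b : Fin 3) (x : M) : ℝ := F.ricci a b x - F.scal x / 3 * eta a b

def Psi0 (x : M) : ℝ := F.ricciTF 0 0 x
def Psi1 (x : M) : ℝ := F.ricciTF 0 1 x
def Psi2 (x : M) : ℝ := F.ricciTF 0 2 x
def Psi3 (x : M) : ℝ := F.ricciTF 1 2 x
def Psi4 (x : M) : ℝ := F.ricciTF 2 2 x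

/-! The spin coefficients are the components of the connection forms `Γ_{ab} = g(e_a, ∇ e_b)`:
`Γ₀₁ = κ ω⁰ + σ ω¹ + τ ω²`, `Γ₀₂ = 2(ε ω⁰ + α ω¹ + γ ω²)`, `Γ₁₂ = π ω⁰ + λ ω¹ + ν ω²`. -/

def spKappa (x : M) : ℝ := F.connLow 0 1 0 x
def spSigma (x : M) : ℝ := F.connLow 1 1 0 x
def spTau (x : M) : ℝ := F.connLow 2 1 0 x
def spEpsilon (x : M) : ℝ := F.connLow 0 2 0 x / 2
def spAlpha (x : M) : ℝ := F.connLow 1 2 0 x / 2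
def spGamma (x : M) : ℝ := F.connLow 2 2 0 x / 2
def spPi (x : M) : ℝ := F.connLow 0 2 1 x
def spLambda (x : M) : ℝ := F.connLow 1 2 1 x
def spNu (x : M) : ℝ := F.connLow 2 2 1 x

/-- The root configuration of type DZ at `x`: the quartic
`Ψ₀ + 4Ψ₁z + 6Ψ₂z² + 4Ψ₃z³ + Ψ₄z⁴` is non-zero and has two double roots `w`, `w̄` that are
complex conjugate and not real. -/
def IsDZAt (x : M) : Prop :=
  F.Psi4 x ≠ 0 ∧ ∃ w : ℂ, w.im ≠ 0 ∧ ∀ z : ℂ,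
    (F.Psi0 x : ℂ) + 4 * F.Psi1 x * z + 6 * F.Psi2 x * z ^ 2 + 4 * F.Psi3 x * z ^ 3
      + F.Psi4 x * z ^ 4 = F.Psi4 x * (z - w) ^ 2 * (z - (starRingEnd ℂ) w) ^ 2

/-- The frame puts curvature of type DZ into canonical form on its whole domain:
`Ψ₁ = Ψ₃ = 0`, `Ψ₀ = Ψ₄ = 3Ψ₂ ≠ 0`. -/
def IsCanonicalDZ : Prop := ∀ x ∈ F.dom,
  F.Psi1 x = 0 ∧ F.Psi3 x = 0 ∧ F.Psi0 x = 3 * F.Psi2 x ∧ F.Psi4 x = 3 * F.Psi2 x ∧ F.Psi2 x ≠ 0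

/-- The frame is adapted to `S`: `R^{(p)}` takes values in `S`. -/
def IsAdapted {p : ℕ} (S : Set (CurvSpace p)) : Prop := ∀ x ∈ F.dom, F.curv p x ∈ S

end NullFrame

/-- Curvature of Petrov type DZ at all points. The root configuration does not depend on the null
frame that is used to read it off. -/
def TypeDZ (g : LorentzMetric M) : Prop := ∀ F : NullFrame g, ∀ x ∈ F.dom, F.IsDZAt x

/-- The lift of `R^{(p)}` to the bundle of orthonormal frames has constant rank `r`. -/
def HasRank (g : LorentzMetric M) (p r : ℕ) : Prop :=
  ∀ F : NullFrame g, ∀ x ∈ F.dom, F.liftedRank p x = r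

/-- Full regularity: the ranks `r_p` are constant, for all `p`. -/
def FullyRegular (g : LorentzMetric M) : Prop := ∀ p, ∃ r, HasRank g p r

/-- `q` is the smallest non-negative integer with `r_{q-1} = r_q`, where `r_{-1} = 0`. -/
def IsStabilizationIndex (g : LorentzMetric M) (q : ℕ) : Prop :=
  ∃ r : ℕ → ℕ, (∀ p, HasRank g p (r p)) ∧
    IsLeast {k : ℕ | (if k = 0 then 0 else r (k - 1)) = r k} q

/-- `S` is a `p`-th order normalizing cross-section for `(M, g)`, with group `G = G_p`. -/
structure IsNormalizingCrossSection (g : LorentzMetric M) (p : ℕ) (S : Set (CurvSpace p))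
    (G : Subgroup (GL (Fin 3) ℝ)) : Prop where
  submanifold : IsSubmanifold S
  le_orthGroup : G ≤ orthGroup
  fixes : ∀ X ∈ G, ∀ T ∈ S, act X T = T
  maximal : ∀ X ∈ orthGroup, (act X '' S ∩ S).Nonempty → X ∈ G
  cover : ∀ x : M, ∃ F : NullFrame g, x ∈ F.dom ∧ F.IsAdapted S

/-- Curvature regularity. -/
def CurvatureRegular (g : LorentzMetric M) : Prop :=
  ∀ p, ∃ S G, IsNormalizingCrossSection g p S G

/-- The `p`-th order degree of frame freedom `s_p = dim G_p` equals `s`, relative to some choice of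
normalizing cross-section. -/
def HasFrameFreedom (g : LorentzMetric M) (p s : ℕ) : Prop :=
  ∃ S G, IsNormalizingCrossSection g p S G ∧ groupDim G = s

/-- The `p`-th order horizontal rank `t_p = rank R^{(p)}` (in adapted moving frames) equals `t`,
relative to some choice of normalizing cross-section. -/
def HasHorizontalRank (g : LorentzMetric M) (p t : ℕ) : Prop :=
  ∃ S G, IsNormalizingCrossSection g p S G ∧
    ∀ F : NullFrame g, F.IsAdapted S → ∀ x ∈ F.dom,
      Module.finrank ℝ (F.horizontalRange p x) = t

/-- Curvature homogeneity of order `k`: curvature regular with `t_k = 0`. -/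
def CurvatureHomogeneous (g : LorentzMetric M) (k : ℕ) : Prop :=
  CurvatureRegular g ∧ HasHorizontalRank g k 0

/-- Pseudo-stabilization of order `k ≥ 1`: curvature regular with `s_k = s_{k-1} > s_q`. -/
def PseudoStable (g : LorentzMetric M) (k : ℕ) : Prop :=
  CurvatureRegular g ∧ 1 ≤ k ∧ ∃ (s : ℕ → ℕ) (q : ℕ), (∀ p, HasFrameFreedom g p (s p)) ∧
    IsStabilizationIndex g q ∧ s k = s (k - 1) ∧ s q < s k

end Manifold

end Lorentz3

end

/-! In a canonical frame put u = e₀ + e₂, a timelike field. The Schouten tensor then reads P = 3Ψ₂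
u♭⊗u♭ + (2Ψ₂ + R/12) η. In dimension three the Riemann tensor is the Kulkarni–Nomizu product of the
metric with P (`riem_eq_ofSchouten`), so its stabilizer in 𝔬(η) is the line of rotations about u,
spanned by `isoGen` (`eq_smul_isoGen`). Curvature homogeneity makes the curvature components locally
constant in some frame around each point. They are then locally constant in every canonical frame,
because Ψ₂ and R are invariants (`canonicalSchouten_inj`). For constant components, ∇Riem is the
infinitesimal action of the connection matrices, and it involves the connection only through ∇u
(`riemDer_one_canonical`).

Suppose that ∇Riem is also invariant under `isoGen`. The second Bianchi identity makes u geodesic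
and divergence-free, and the invariance removes its shear. What remains is ∇u = 2α · `isoGen`
(`connLow_of_isotropy`). The identity Ric(u,u) = div(∇_u u) - u(div u) - tr((∇u)²) then gives 4α² =
Ψ₂ - R/12 (`alpha_sq_of_relations`). The right side is locally constant, hence so is α by
continuity, and with it ∇Riem (`eventually_curv_one`).

The group of a cross-section enters in two ways. Fixing the curvature, it is conjugate to a group
whose generators are multiples of `isoGen`, so its dimension is at most one (`groupDim_le_one`). By
maximality, it contains everything in O(η) that fixes a value of R^{(p)} lying in the cross-section
(`groupDim_pos`). Hence s₀ > 0, and s₁ = s₀ forces the invariance of ∇Riem (`isoGen_riemDer_one`),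
which settles the second claim. For the first, s_k > s_q with k ≥ 1 forces the same invariance. Riem
and (Riem, ∇Riem) are then locally constant with the same stabilizer, so r₀ = r₁ and q ≤ 1. But then
s_q ≥ 1 ≥ s_k, a contradiction (`not_pseudoStable`).

The tensor calculus behind this (Bianchi identities, behaviour under change of frame) is carried out
in a commutative algebra with three derivations, `FrameAlgebra`, and is read off at points of M
through `frameAlgebra`. -/

noncomputable section

namespace Lorentz3

/-! ### Lie brackets of vector fields as commutators of derivations. -/

section VectorFields

variable {M : Type*} [TopologicalSpace M] [ChartedSpace (EuclideanSpace ℝ (Fin 3)) M]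

/-- The derivative of a function along a vector field. -/
def dirDeriv (V : (x : M) → TangentSpace (𝓡 3) x) (f : M → ℝ) (x : M) : ℝ :=
  mfderiv (𝓡 3) 𝓘(ℝ, ℝ) f x (V x)

/-- A vector field read in the preferred chart at `x`. -/
def chartField (x : M) (V : (x : M) → TangentSpace (𝓡 3) x) (z : EuclideanSpace ℝ (Fin 3)) :
    EuclideanSpace ℝ (Fin 3) :=
  VectorField.mpullbackWithin 𝓘(ℝ, EuclideanSpace ℝ (Fin 3)) (𝓡 3)
        (extChartAt (𝓡 3) x).symm V (Set.range (𝓡 3)) z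

variable [IsManifold (𝓡 3) ∞ M]

/-- Smoothness of a vector field on a set. -/
abbrev SmoothField (V : (x : M) → TangentSpace (𝓡 3) x) (U : Set M) : Prop :=
  ContMDiffOn (𝓡 3) (𝓡 3).tangent ∞ (fun x ↦ (⟨x, V x⟩ : TangentBundle (𝓡 3) M)) U

theorem contMDiffOn_dirDeriv {U : Set M} (hU : IsOpen U) {f : M → ℝ}
    (hf : ContMDiffOn (𝓡 3) 𝓘(ℝ, ℝ) ∞ f U) {V : (x : M) → TangentSpace (𝓡 3) x}
    (hV : SmoothField V U) : ContMDiffOn (𝓡 3) 𝓘(ℝ, ℝ) ∞ (dirDeriv V f) U := by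
  have : IsManifold (𝓡 3) 1 M := IsManifold.of_le (n := ∞) (by norm_cast)
  have h1 := hf.contMDiffOn_tangentMapWithin (m := ∞) (by norm_cast) hU.uniqueMDiffOn
  have h2 := h1.comp hV (fun x hx => hx)
  have h3 := (contMDiff_snd_tangentBundle_modelSpace (n := ∞) ℝ 𝓘(ℝ, ℝ)).comp_contMDiffOn h2
  refine h3.congr fun x hx => ?_
  simp only [Function.comp, tangentMapWithin]
  rw [mfderivWithin_of_isOpen hU hx]
  rfl

theorem dirDeriv_eq_fderiv_chart {x : M} {f : M → ℝ} {V : (x : M) → TangentSpace (𝓡 3) x}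
    {z : EuclideanSpace ℝ (Fin 3)} (hz : z ∈ (extChartAt (𝓡 3) x).target)
    (hf : MDifferentiableAt (𝓡 3) 𝓘(ℝ, ℝ) f ((extChartAt (𝓡 3) x).symm z)) :
    dirDeriv V f ((extChartAt (𝓡 3) x).symm z) =
      fderiv ℝ (f ∘ (extChartAt (𝓡 3) x).symm) z (chartField x V z) := by
  have : IsManifold (𝓡 3) 1 M := IsManifold.of_le (n := ∞) (by norm_cast)
  have hinv := isInvertible_mfderivWithin_extChartAt_symm (I := 𝓡 3) hz
  have hd := mdifferentiableWithinAt_extChartAt_symm (I := 𝓡 3) hz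
  have hr : Set.range (𝓡 3) = Set.univ := ModelWithCorners.range_eq_univ _
  have h0 : mfderivWithin 𝓘(ℝ, EuclideanSpace ℝ (Fin 3)) (𝓡 3) (extChartAt (𝓡 3) x).symm
      (Set.range (𝓡 3)) z = mfderiv 𝓘(ℝ, EuclideanSpace ℝ (Fin 3)) (𝓡 3)
      (extChartAt (𝓡 3) x).symm z := by
    rw [hr, mfderivWithin_univ]
  have h1 := hinv.self_apply_inverse (V ((extChartAt (𝓡 3) x).symm z))
  rw [hr] at hd
  rw [mdifferentiableWithinAt_univ] at hd
  have h2 := mfderiv_comp z hf hd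
  have h3 := DFunLike.congr_fun h2 (chartField x V z)
  rw [mfderiv_eq_fderiv] at h3
  refine Eq.trans ?_ h3.symm
  refine congrArg (mfderiv (𝓡 3) 𝓘(ℝ, ℝ) f ((extChartAt (𝓡 3) x).symm z)) ?_
  rw [← h0]
  exact h1.symm

theorem chartField_mlieBracket (x : M) (V W : (x : M) → TangentSpace (𝓡 3) x) :
    chartField x (VectorField.mlieBracket (𝓡 3) V W) (extChartAt (𝓡 3) x x) =
      fderiv ℝ (chartField x W) (extChartAt (𝓡 3) x x) (chartField x V (extChartAt (𝓡 3) x x))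
      - fderiv ℝ (chartField x V) (extChartAt (𝓡 3) x x)
        (chartField x W (extChartAt (𝓡 3) x x)) := by
  have : IsManifold (𝓡 3) 1 M := IsManifold.of_le (n := ∞) (by norm_cast)
  have hr : Set.range (𝓡 3) = Set.univ := ModelWithCorners.range_eq_univ _
  have h4 : VectorField.mlieBracket (𝓡 3) V W x = (mfderiv (𝓡 3) 𝓘(ℝ, EuclideanSpace ℝ (Fin 3))
      (extChartAt (𝓡 3) x) x).inverse (id (VectorField.lieBracket ℝ (chartField x V)
        (chartField x W) (extChartAt (𝓡 3) x x) : EuclideanSpace ℝ (Fin 3))) := by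
    have hs : (extChartAt (𝓡 3) x).symm ⁻¹' Set.univ ∩ Set.range (𝓡 3) = Set.univ := by
      rw [hr]; simp
    rw [← VectorField.mlieBracketWithin_univ, VectorField.mlieBracketWithin_apply, hs,
      ← VectorField.lieBracketWithin_univ]
    rfl
  -- The pullback evaluates the bracket at the image of `extChartAt x x` under the inverse chart,
  -- which equals `x` only propositionally; hence a variable `y`.
  have h5 : ∀ y, y = x → (mfderiv (𝓡 3) 𝓘(ℝ, EuclideanSpace ℝ (Fin 3)) (extChartAt (𝓡 3) x) y)
      (VectorField.mlieBracket (𝓡 3) V W y) = VectorField.lieBracket ℝ (chartField x V)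
        (chartField x W) (extChartAt (𝓡 3) x x) := by
    rintro y rfl
    rw [h4]
    exact (isInvertible_mfderiv_extChartAt (mem_extChartAt_source y)).self_apply_inverse _
  refine Eq.trans ?_ (h5 _ (extChartAt_to_inv (I := 𝓡 3) x))
  have h6 := mfderiv_extChartAt_comp_mfderivWithin_extChartAt_symm (I := 𝓡 3)
    (mem_extChartAt_target x)
  have h7 := mfderivWithin_extChartAt_symm_comp_mfderiv_extChartAt (I := 𝓡 3)
    (mem_extChartAt_target x)
  exact DFunLike.congr_fun (ContinuousLinearMap.inverse_eq h7 h6) _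

/-- In a chart both iterated derivatives contain the second derivative of `f` on the two fields. By
symmetry it cancels, leaving the bracket of the coefficient maps. This supplies the commutator axiom
of `FrameAlgebra`. -/
theorem dirDeriv_mlieBracket {U : Set M} (hU : IsOpen U) {f : M → ℝ}
    (hf : ContMDiffOn (𝓡 3) 𝓘(ℝ, ℝ) ∞ f U) {V W : (x : M) → TangentSpace (𝓡 3) x}
    (hV : SmoothField V U) (hW : SmoothField W U) {x : M} (hx : x ∈ U) :
    dirDeriv (VectorField.mlieBracket (𝓡 3) V W) f x =
      dirDeriv V (dirDeriv W f) x - dirDeriv W (dirDeriv V f) x := by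
  have : IsManifold (𝓡 3) 1 M := IsManifold.of_le (n := ∞) (by norm_cast)
  have : IsManifold (𝓡 3) 2 M := IsManifold.of_le (n := ∞) (by norm_cast)
  have hr : Set.range (𝓡 3) = Set.univ := ModelWithCorners.range_eq_univ _
  set φ := extChartAt (𝓡 3) x with hφ
  set f' := f ∘ φ.symm with hf'
  have hxz : φ.symm (φ x) = x := extChartAt_to_inv x
  have hzt : φ x ∈ φ.target := mem_extChartAt_target x
  have hto : IsOpen φ.target := isOpen_extChartAt_target x
  have hO : ∀ᶠ z in 𝓝 (φ x), z ∈ φ.target ∧ φ.symm z ∈ U := by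
    refine Filter.Eventually.and (hto.mem_nhds hzt) ?_
    refine (continuousAt_extChartAt_symm x).preimage_mem_nhds ?_
    change U ∈ 𝓝 (φ.symm (φ x))
    rw [hxz]; exact hU.mem_nhds hx
  have hmd : ∀ {h : M → ℝ}, ContMDiffOn (𝓡 3) 𝓘(ℝ, ℝ) ∞ h U → ∀ y ∈ U,
      MDifferentiableAt (𝓡 3) 𝓘(ℝ, ℝ) h y := fun hh y hy =>
    (hh.contMDiffAt (hU.mem_nhds hy)).mdifferentiableAt (by norm_cast)
  have key : ∀ {X Y : (x : M) → TangentSpace (𝓡 3) x}, SmoothField X U →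
      dirDeriv Y (dirDeriv X f) x =
      fderiv ℝ (fun z => fderiv ℝ f' z (chartField x X z)) (φ x) (chartField x Y (φ x)) := by
    intro X Y hX
    have h1 := dirDeriv_eq_fderiv_chart (x := x) (V := Y) hzt (f := dirDeriv X f)
      (by rw [← hφ, hxz]; exact hmd (contMDiffOn_dirDeriv hU hf hX) x hx)
    rw [← hφ, hxz] at h1
    rw [h1]
    congr 1
    apply Filter.EventuallyEq.fderiv_eq
    filter_upwards [hO] with z hz
    exact dirDeriv_eq_fderiv_chart hz.1 (hmd hf _ hz.2)
  have hdiff : ∀ {X : (x : M) → TangentSpace (𝓡 3) x}, SmoothField X U →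
      DifferentiableAt ℝ (chartField x X) (φ x) := by
    intro X hX
    have h1 : MDifferentiableWithinAt (𝓡 3) (𝓡 3).tangent
        (fun x ↦ (⟨x, X x⟩ : TangentBundle (𝓡 3) M)) Set.univ x :=
      ((hX.contMDiffAt (hU.mem_nhds hx)).mdifferentiableAt (by norm_cast)).mdifferentiableWithinAt
    have h2 : DifferentiableWithinAt ℝ (chartField x X)
      ((extChartAt (𝓡 3) x).symm ⁻¹' Set.univ ∩ Set.range (𝓡 3)) (φ x) :=
      h1.differentiableWithinAt_mpullbackWithin_vectorField
    rwa [hr, Set.preimage_univ, Set.univ_inter, differentiableWithinAt_univ] at h2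
  have hf2 : ContDiffAt ℝ ∞ f' (φ x) := by
    have h1 : ContMDiffAt (𝓡 3) 𝓘(ℝ, ℝ) ∞ f x := hf.contMDiffAt (hU.mem_nhds hx)
    have h2 := (contMDiffAt_iff.1 h1).2
    rw [hr, contDiffWithinAt_univ] at h2
    exact h2
  have hfd : DifferentiableAt ℝ (fderiv ℝ f') (φ x) :=
    (hf2.fderiv_right (m := 1) (by norm_cast)).differentiableAt (by norm_num)
  have hsymm : IsSymmSndFDerivAt ℝ f' (φ x) := hf2.isSymmSndFDerivAt (by
    rw [minSmoothness_of_isRCLikeNormedField]; exact WithTop.coe_le_coe.2 (le_top : (2 : ℕ∞) ≤ ⊤))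
  rw [key hW, key hV]
  have h3 := dirDeriv_eq_fderiv_chart (x := x) (V := VectorField.mlieBracket (𝓡 3) V W) hzt
      (f := f) (by rw [← hφ, hxz]; exact hmd hf x hx)
  rw [← hφ, hxz] at h3
  have e1 : fderiv ℝ (fun z => fderiv ℝ f' z (chartField x W z)) (φ x) (chartField x V (φ x)) =
      fderiv ℝ f' (φ x) (fderiv ℝ (chartField x W) (φ x) (chartField x V (φ x)))
      + fderiv ℝ (fderiv ℝ f') (φ x) (chartField x V (φ x)) (chartField x W (φ x)) := by
    rw [fderiv_clm_apply hfd (hdiff hW)]; rfl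
  have e2 : fderiv ℝ (fun z => fderiv ℝ f' z (chartField x V z)) (φ x) (chartField x W (φ x)) =
      fderiv ℝ f' (φ x) (fderiv ℝ (chartField x V) (φ x) (chartField x W (φ x)))
      + fderiv ℝ (fderiv ℝ f') (φ x) (chartField x W (φ x)) (chartField x V (φ x)) := by
    rw [fderiv_clm_apply hfd (hdiff hV)]; rfl
  rw [h3, e1, e2, chartField_mlieBracket, map_sub, hsymm.eq (chartField x V (φ x))]
  ring

end VectorFields

/-! ### Levi-Civita calculus over an abstract algebra of functions. -/

/-- An algebra of functions with three independent derivations, whose commutators have the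
coefficients `B a b f = ∑ h, etaInv f h * bl a b h`. -/
structure FrameAlgebra (𝒜 : Type*) [CommRing 𝒜] [Algebra ℝ 𝒜] where
  d : Fin 3 → Derivation ℝ 𝒜 𝒜
  bl : Fin 3 → Fin 3 → Fin 3 → 𝒜
  comm : ∀ a b f, d a (d b f) - d b (d a f) =
    ∑ k, (∑ h, algebraMap ℝ 𝒜 (etaInv k h) * bl a b h) * d k f
  indep : ∀ c : Fin 3 → 𝒜, (∀ f, ∑ k, c k * d k f = 0) → c = 0

namespace FrameAlgebra

variable {𝒜 : Type*} [CommRing 𝒜] [Algebra ℝ 𝒜]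

theorem two_mul_half : 2 * algebraMap ℝ 𝒜 (1 / 2) = 1 := by
  rw [← map_ofNat (algebraMap ℝ 𝒜) 2, ← map_mul]; norm_num

theorem eq_zero_of_two_mul_eq_zero {a : 𝒜} (h : 2 * a = 0) : a = 0 := by
  linear_combination algebraMap ℝ 𝒜 (1 / 2) * h - a * two_mul_half (𝒜 := 𝒜)

/-- The inner product on column vectors. -/
def metric (X Y : Fin 3 → 𝒜) : 𝒜 := ∑ a, ∑ b, algebraMap ℝ 𝒜 (eta a b) * (X a * Y b)

theorem metric_eq (X Y : Fin 3 → 𝒜) :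
    metric X Y = algebraMap ℝ 𝒜 (1 / 2) * (X 1 * Y 1) - X 0 * Y 2 - X 2 * Y 0 := by
  simp [metric, Fin.sum_univ_three, eta]
  ring

theorem metric_comm (X Y : Fin 3 → 𝒜) : metric X Y = metric Y X := by
  simp only [metric_eq]; ring

theorem metric_add_left (X Y Z : Fin 3 → 𝒜) :
    metric (X + Y) Z = metric X Z + metric Y Z := by
  simp only [metric_eq, Pi.add_apply]; ring

theorem metric_sub_left (X Y Z : Fin 3 → 𝒜) :
    metric (X - Y) Z = metric X Z - metric Y Z := by
  simp only [metric_eq, Pi.sub_apply]; ring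

theorem metric_smul_left (f : 𝒜) (X Z : Fin 3 → 𝒜) :
    metric (f • X) Z = f * metric X Z := by
  simp only [metric_eq, Pi.smul_apply, smul_eq_mul]; ring

theorem metric_sum_left {ι : Type*} (s : Finset ι) (X : ι → Fin 3 → 𝒜) (Z : Fin 3 → 𝒜) :
    metric (∑ i ∈ s, X i) Z = ∑ i ∈ s, metric (X i) Z := by
  classical
  induction s using Finset.induction_on with
  | empty => simp [metric]
  | insert i s hi ih => rw [Finset.sum_insert hi, Finset.sum_insert hi, metric_add_left, ih]

theorem metric_add_right (X Y Z : Fin 3 → 𝒜) :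
    metric Z (X + Y) = metric Z X + metric Z Y := by
  simp only [metric_eq, Pi.add_apply]; ring

theorem metric_smul_right (f : 𝒜) (X Z : Fin 3 → 𝒜) :
    metric Z (f • X) = f * metric Z X := by
  simp only [metric_eq, Pi.smul_apply, smul_eq_mul]; ring

theorem metric_single_single (a b : Fin 3) :
    metric (Pi.single a 1 : Fin 3 → 𝒜) (Pi.single b 1) = algebraMap ℝ 𝒜 (eta a b) := by
  rw [metric_eq]
  fin_cases a <;> fin_cases b <;> simp [eta]

variable (E : FrameAlgebra 𝒜)

/-- The commutator coefficients. -/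
def B (a b k : Fin 3) : 𝒜 := ∑ h, algebraMap ℝ 𝒜 (etaInv k h) * E.bl a b h

/-- `g(∇_{e_a} e_b, e_c)`. -/
def connLow (a b c : Fin 3) : 𝒜 :=
  algebraMap ℝ 𝒜 (1 / 2) * (E.bl a b c - E.bl a c b - E.bl b c a)

/-- The components in `∇_{e_a} e_b = ∑ c, (conn c a b) e_c`. -/
def conn (c a b : Fin 3) : 𝒜 := ∑ d, algebraMap ℝ 𝒜 (etaInv c d) * E.connLow a b d

theorem comm' (a b : Fin 3) (f : 𝒜) :
    E.d a (E.d b f) - E.d b (E.d a f) = ∑ k, E.B a b k * E.d k f := E.comm a b f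

theorem B_zero (a b : Fin 3) : E.B a b 0 = -E.bl a b 2 := by
  simp [B, Fin.sum_univ_three, etaInv]

theorem B_one (a b : Fin 3) : E.B a b 1 = 2 * E.bl a b 1 := by
  simp [B, Fin.sum_univ_three, etaInv, map_ofNat]

theorem B_two (a b : Fin 3) : E.B a b 2 = -E.bl a b 0 := by
  simp [B, Fin.sum_univ_three, etaInv]

theorem conn_zero (a b : Fin 3) : E.conn 0 a b = -E.connLow a b 2 := by
  simp [conn, Fin.sum_univ_three, etaInv]

theorem conn_one (a b : Fin 3) : E.conn 1 a b = 2 * E.connLow a b 1 := by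
  simp [conn, Fin.sum_univ_three, etaInv, map_ofNat]

theorem conn_two (a b : Fin 3) : E.conn 2 a b = -E.connLow a b 0 := by
  simp [conn, Fin.sum_univ_three, etaInv]

/-- The commutator of derivations is antisymmetric, and independence of the derivations passes this
to the coefficients. -/
theorem B_antisymm (a b k : Fin 3) : E.B a b k = -E.B b a k := by
  have h := E.indep (fun k => E.B a b k + E.B b a k) (fun f => by
    simp only [add_mul, Finset.sum_add_distrib, ← E.comm']; ring)
  exact eq_neg_of_add_eq_zero_left (congrFun h k)

theorem bl_antisymm (a b c : Fin 3) : E.bl a b c = -E.bl b a c := by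
  fin_cases c
  · have := E.B_antisymm a b 2
    simp only [B_two] at this
    exact neg_inj.1 this
  · have := E.B_antisymm a b 1
    simp only [B_one] at this
    have h2 : 2 * (E.bl a b 1 + E.bl b a 1) = 0 := by linear_combination this
    exact eq_neg_of_add_eq_zero_left (eq_zero_of_two_mul_eq_zero h2)
  · have := E.B_antisymm a b 0
    simp only [B_zero] at this
    exact neg_inj.1 this

theorem connLow_antisymm (a b c : Fin 3) : E.connLow a b c = -E.connLow a c b := by
  unfold connLow
  rw [E.bl_antisymm b c a]
  ring

theorem connLow_sub (a b c : Fin 3) : E.connLow a b c - E.connLow b a c = E.bl a b c := by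
  unfold connLow
  rw [E.bl_antisymm b a c]
  linear_combination E.bl a b c * two_mul_half (𝒜 := 𝒜)

theorem conn_sub (c a b : Fin 3) : E.conn c a b - E.conn c b a = E.B a b c := by
  simp only [conn, B, ← Finset.sum_sub_distrib, ← mul_sub, E.connLow_sub]

/-! ### Vector fields, given by their components -/

/-- The derivation along a vector field. -/
def dir (X : Fin 3 → 𝒜) : Derivation ℝ 𝒜 𝒜 := ∑ a, X a • E.d a

theorem dir_apply (X : Fin 3 → 𝒜) (f : 𝒜) : E.dir X f = ∑ a, X a * E.d a f := by
  simp [dir, Fin.sum_univ_three]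

theorem dir_add (X Y : Fin 3 → 𝒜) (f : 𝒜) : E.dir (X + Y) f = E.dir X f + E.dir Y f := by
  simp [dir_apply, Fin.sum_univ_three]; ring

theorem dir_smul (h : 𝒜) (X : Fin 3 → 𝒜) (f : 𝒜) : E.dir (h • X) f = h * E.dir X f := by
  simp [dir_apply, Fin.sum_univ_three]; ring

theorem dir_single (a : Fin 3) (f : 𝒜) : E.dir (Pi.single a 1) f = E.d a f := by
  rw [dir_apply, Finset.sum_eq_single a] <;> simp +contextual

theorem dir_ext {X Y : Fin 3 → 𝒜} (h : ∀ f, E.dir X f = E.dir Y f) : X = Y := by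
  have := E.indep (X - Y) (fun f => by
    have := h f
    simp only [dir_apply] at this
    simp only [Pi.sub_apply, sub_mul, Finset.sum_sub_distrib, this, sub_self])
  exact sub_eq_zero.1 this

/-- The Lie bracket of vector fields. -/
def br (X Y : Fin 3 → 𝒜) : Fin 3 → 𝒜 := fun c =>
  E.dir X (Y c) - E.dir Y (X c) + ∑ a, ∑ b, X a * Y b * E.B a b c

theorem dir_br (X Y : Fin 3 → 𝒜) (f : 𝒜) :
    E.dir (E.br X Y) f = E.dir X (E.dir Y f) - E.dir Y (E.dir X f) := by
  have h (a b : Fin 3) := E.comm' a b f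
  have key : ∑ a, ∑ b, X a * Y b * (E.d a (E.d b f) - E.d b (E.d a f)) =
      ∑ a, ∑ b, X a * Y b * (∑ k, E.B a b k * E.d k f) := by simp only [h]
  simp only [dir_apply, br, Fin.sum_univ_three, map_add, Derivation.leibniz, smul_eq_mul] at key ⊢
  linear_combination -key

/-- The Levi-Civita connection. -/
def nabla (X Y : Fin 3 → 𝒜) : Fin 3 → 𝒜 := fun c =>
  E.dir X (Y c) + ∑ a, ∑ b, X a * Y b * E.conn c a b

theorem nabla_add_left (X Y Z : Fin 3 → 𝒜) :
    E.nabla (X + Y) Z = E.nabla X Z + E.nabla Y Z := by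
  funext c
  simp only [nabla, dir_add, Pi.add_apply, Fin.sum_univ_three]; ring

theorem nabla_smul_left (f : 𝒜) (X Z : Fin 3 → 𝒜) :
    E.nabla (f • X) Z = f • E.nabla X Z := by
  funext c
  simp only [nabla, dir_smul, Pi.smul_apply, smul_eq_mul, Fin.sum_univ_three]; ring

theorem nabla_add_right (X Y Z : Fin 3 → 𝒜) :
    E.nabla X (Y + Z) = E.nabla X Y + E.nabla X Z := by
  funext c
  simp only [nabla, map_add, Pi.add_apply, Fin.sum_univ_three]; ring

theorem nabla_smul_right (f : 𝒜) (X Z : Fin 3 → 𝒜) :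
    E.nabla X (f • Z) = E.dir X f • Z + f • E.nabla X Z := by
  funext c
  simp only [nabla, Derivation.leibniz, Pi.smul_apply, Pi.add_apply, smul_eq_mul,
    Fin.sum_univ_three]; ring

/-- The connection as an additive map in its second argument. -/
def nablaHom (X : Fin 3 → 𝒜) : (Fin 3 → 𝒜) →+ (Fin 3 → 𝒜) :=
  AddMonoidHom.mk' (E.nabla X) (E.nabla_add_right X)

theorem nabla_sub_right (X Y Z : Fin 3 → 𝒜) :
    E.nabla X (Y - Z) = E.nabla X Y - E.nabla X Z := map_sub (E.nablaHom X) Y Z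

theorem nabla_sum_right {ι : Type*} (X : Fin 3 → 𝒜) (s : Finset ι) (Y : ι → Fin 3 → 𝒜) :
    E.nabla X (∑ i ∈ s, Y i) = ∑ i ∈ s, E.nabla X (Y i) := map_sum (E.nablaHom X) Y s

/-- The connection as an additive map in its first argument. -/
def nablaHomLeft (Y : Fin 3 → 𝒜) : (Fin 3 → 𝒜) →+ (Fin 3 → 𝒜) :=
  AddMonoidHom.mk' (fun X => E.nabla X Y) (fun X X' => E.nabla_add_left X X' Y)

theorem nabla_sub_left (X Y Z : Fin 3 → 𝒜) :
    E.nabla (X - Y) Z = E.nabla X Z - E.nabla Y Z := map_sub (E.nablaHomLeft Z) X Y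

theorem nabla_sum_left {ι : Type*} (s : Finset ι) (X : ι → Fin 3 → 𝒜) (Y : Fin 3 → 𝒜) :
    E.nabla (∑ i ∈ s, X i) Y = ∑ i ∈ s, E.nabla (X i) Y := map_sum (E.nablaHomLeft Y) X s

theorem nabla_sub_nabla (X Y : Fin 3 → 𝒜) : E.nabla X Y - E.nabla Y X = E.br X Y := by
  funext c
  have : ∑ a, ∑ b, X a * Y b * (E.conn c a b - E.conn c b a) =
    ∑ a, ∑ b, X a * Y b * E.B a b c := by simp only [E.conn_sub]
  simp only [nabla, br, Pi.sub_apply, Fin.sum_univ_three] at this ⊢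
  linear_combination this

/-- Compatibility with the metric amounts to antisymmetry of the lowered connection coefficients in
their last two indices, since η is constant. -/
theorem dir_metric (Z X Y : Fin 3 → 𝒜) :
    E.dir Z (metric X Y) = metric (E.nabla Z X) Y + metric X (E.nabla Z Y) := by
  have key : ∑ a, ∑ b, ∑ c, Z a * X b * Y c * (E.connLow a b c + E.connLow a c b) = 0 := by
    refine Finset.sum_eq_zero fun a _ => Finset.sum_eq_zero fun b _ =>
      Finset.sum_eq_zero fun c _ => ?_
    rw [E.connLow_antisymm a b c]; ring
  -- Raising the index 1 costs a factor 2 and pairing with η₁₁ a factor 1/2; `ring` does not know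
  -- that the image of 1/2 cancels 2 in `𝒜`.
  have h2 := congrArg (fun c => (Y 1 * ∑ a, ∑ b, Z a * X b * E.connLow a b 1
    + X 1 * ∑ a, ∑ b, Z a * Y b * E.connLow a b 1) * c) (two_mul_half (𝒜 := 𝒜))
  simp only [metric_eq, nabla, map_sub, Derivation.leibniz, smul_eq_mul,
    Derivation.map_algebraMap, conn_zero, conn_one, conn_two, Fin.sum_univ_three] at key h2 ⊢
  linear_combination -key - h2

end FrameAlgebra

namespace FrameAlgebra

variable {𝒜 : Type*} [CommRing 𝒜] [Algebra ℝ 𝒜] (E : FrameAlgebra 𝒜)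

theorem br_add_left (X Y Z : Fin 3 → 𝒜) : E.br (X + Y) Z = E.br X Z + E.br Y Z := by
  simp only [← E.nabla_sub_nabla, nabla_add_left, nabla_add_right]; abel

theorem br_swap (X Y : Fin 3 → 𝒜) : E.br X Y = -E.br Y X := by
  simp only [← E.nabla_sub_nabla]; abel

theorem br_smul_left (f : 𝒜) (X Y : Fin 3 → 𝒜) :
    E.br (f • X) Y = f • E.br X Y - E.dir Y f • X := by
  simp only [← E.nabla_sub_nabla, nabla_smul_left, nabla_smul_right, smul_sub]; abel

/-- A field is determined by its derivation, and commutators of derivations satisfy the Jacobi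
identity formally. -/
theorem br_jacobi (X Y Z : Fin 3 → 𝒜) :
    E.br X (E.br Y Z) + E.br Y (E.br Z X) + E.br Z (E.br X Y) = 0 := by
  refine E.dir_ext fun f => ?_
  have h0 : E.dir 0 f = 0 := by simp [dir_apply]
  simp only [dir_add, dir_br, map_sub, h0]
  ring

/-! ### Curvature -/

/-- The curvature operator `R(X, Y) Z`. -/
def curvOp (X Y Z : Fin 3 → 𝒜) : Fin 3 → 𝒜 :=
  E.nabla X (E.nabla Y Z) - E.nabla Y (E.nabla X Z) - E.nabla (E.br X Y) Z

theorem curvOp_swap (X Y Z : Fin 3 → 𝒜) : E.curvOp X Y Z = -E.curvOp Y X Z := by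
  have : E.nabla (E.br X Y) Z = -E.nabla (E.br Y X) Z := by
    rw [E.br_swap X Y]; exact map_neg (E.nablaHomLeft Z) _
  simp only [curvOp, this]; abel

theorem curvOp_add_left (X X' Y Z : Fin 3 → 𝒜) :
    E.curvOp (X + X') Y Z = E.curvOp X Y Z + E.curvOp X' Y Z := by
  simp only [curvOp, nabla_add_left, nabla_add_right, br_add_left]; abel

theorem curvOp_smul_left (f : 𝒜) (X Y Z : Fin 3 → 𝒜) :
    E.curvOp (f • X) Y Z = f • E.curvOp X Y Z := by
  simp only [curvOp, nabla_smul_left, nabla_smul_right, br_smul_left, nabla_sub_left, smul_sub]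
  abel

theorem curvOp_add_mid (X Y Y' Z : Fin 3 → 𝒜) :
    E.curvOp X (Y + Y') Z = E.curvOp X Y Z + E.curvOp X Y' Z := by
  rw [curvOp_swap, curvOp_add_left, E.curvOp_swap X Y, E.curvOp_swap X Y']; abel

theorem curvOp_smul_mid (f : 𝒜) (X Y Z : Fin 3 → 𝒜) :
    E.curvOp X (f • Y) Z = f • E.curvOp X Y Z := by
  rw [curvOp_swap, curvOp_smul_left, E.curvOp_swap X Y, smul_neg]

theorem curvOp_sub_left (X X' Y Z : Fin 3 → 𝒜) :
    E.curvOp (X - X') Y Z = E.curvOp X Y Z - E.curvOp X' Y Z := by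
  rw [eq_sub_iff_add_eq, ← curvOp_add_left, sub_add_cancel]

theorem curvOp_add_right (X Y Z Z' : Fin 3 → 𝒜) :
    E.curvOp X Y (Z + Z') = E.curvOp X Y Z + E.curvOp X Y Z' := by
  simp only [curvOp, nabla_add_right]; abel

theorem curvOp_smul_right (f : 𝒜) (X Y Z : Fin 3 → 𝒜) :
    E.curvOp X Y (f • Z) = f • E.curvOp X Y Z := by
  simp only [curvOp, nabla_smul_right, nabla_add_right, dir_br, smul_sub, sub_smul]
  abel

/-- Expand XY - YX - [X, Y] = 0 on the function g(Z, W) by metric compatibility: the mixed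
first-order terms cancel. -/
theorem metric_curvOp (X Y Z W : Fin 3 → 𝒜) :
    metric (E.curvOp X Y Z) W = -metric (E.curvOp X Y W) Z := by
  have h := E.dir_br X Y (metric Z W)
  simp only [dir_metric, map_add] at h
  simp only [curvOp, metric_sub_left]
  rw [metric_comm (E.nabla X (E.nabla Y W)) Z, metric_comm (E.nabla Y (E.nabla X W)) Z,
    metric_comm (E.nabla (E.br X Y) W) Z]
  linear_combination -h

theorem curvOp_cyclic (X Y Z : Fin 3 → 𝒜) :
    E.curvOp X Y Z + E.curvOp Y Z X + E.curvOp Z X Y = 0 := by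
  rw [← E.br_jacobi X Y Z]
  simp only [curvOp]
  rw [← E.nabla_sub_nabla X (E.br Y Z), ← E.nabla_sub_nabla Y (E.br Z X),
    ← E.nabla_sub_nabla Z (E.br X Y)]
  have (X Y Z : Fin 3 → 𝒜) : E.nabla X (E.br Y Z) = E.nabla X (E.nabla Y Z)
    - E.nabla X (E.nabla Z Y) := by rw [← E.nabla_sub_nabla, nabla_sub_right]
  rw [this X, this Y, this Z]
  abel

/-- The covariant derivative of the curvature operator. -/
def curvDerOp (V X Y Z : Fin 3 → 𝒜) : Fin 3 → 𝒜 :=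
  E.nabla V (E.curvOp X Y Z) - E.curvOp (E.nabla V X) Y Z - E.curvOp X (E.nabla V Y) Z
    - E.curvOp X Y (E.nabla V Z)

/-- Second Bianchi identity. Vanishing torsion turns the corrections in the first two curvature
slots into brackets. What remains is the Jacobi identity for the operators ∇_V, ∇_X, ∇_Y together
with the one for the fields. -/
theorem curvDerOp_cyclic (V X Y Z : Fin 3 → 𝒜) :
    E.curvDerOp V X Y Z + E.curvDerOp X Y V Z + E.curvDerOp Y V X Z = 0 := by
  have h1 (X Y V : Fin 3 → 𝒜) : E.curvOp (E.nabla X Y) V Z =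
      E.curvOp (E.br X Y) V Z - E.curvOp V (E.nabla Y X) Z := by
    rw [← E.nabla_sub_nabla, curvOp_sub_left, E.curvOp_swap V]; abel
  have h2 : E.nabla (E.br V (E.br X Y)) Z + E.nabla (E.br X (E.br Y V)) Z +
      E.nabla (E.br Y (E.br V X)) Z = 0 := by
    rw [← nabla_add_left, ← nabla_add_left, E.br_jacobi]
    exact map_zero (E.nablaHomLeft Z)
  have h3 (V W : Fin 3 → 𝒜) : E.nabla (E.br V W) Z = -E.nabla (E.br W V) Z := by
    rw [E.br_swap V W]; exact map_neg (E.nablaHomLeft Z) _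
  rw [h3 V, h3 X, h3 Y] at h2
  simp only [curvDerOp, h1]
  simp only [curvOp, nabla_sub_right]
  have h4 : E.nabla (E.br (E.br X Y) V) Z = - E.nabla (E.br (E.br Y V) X) Z
    - E.nabla (E.br (E.br V X) Y) Z := by
    rw [← sub_eq_zero]
    rw [← neg_eq_zero, ← h2]; abel
  rw [h4]
  abel

/-! ### Components in a frame -/

/-- The components `R^a_{bcd}`. -/
def riemUp (a b c d : Fin 3) : 𝒜 :=
  E.d c (E.conn a d b) - E.d d (E.conn a c b)
    + ∑ f, (E.conn f d b * E.conn a c f - E.conn f c b * E.conn a d f - E.B c d f * E.conn a f b)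

/-- The components `R_{abcd}`. -/
def riem (i : Fin 4 → Fin 3) : 𝒜 :=
  ∑ f, algebraMap ℝ 𝒜 (eta (i 0) f) * E.riemUp f (i 1) (i 2) (i 3)

/-- The components of the covariant derivative. -/
def covDer {k : ℕ} (T : (Fin k → Fin 3) → 𝒜) (i : Fin (k + 1) → Fin 3) : 𝒜 :=
  E.d (i (Fin.last k)) (T (Fin.init i))
    - ∑ j : Fin k, ∑ b, E.conn b (i (Fin.last k)) (i j.castSucc)
        * T (Function.update (Fin.init i : Fin k → Fin 3) j b)

/-- `P` expresses the frame of `E'` in the frame of `E`. -/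
structure IsFrameChange (E E' : FrameAlgebra 𝒜) (P : Fin 3 → Fin 3 → 𝒜) : Prop where
  d_eq : ∀ a f, E'.d a f = E.dir (P a) f
  metric_eq : ∀ a b, metric (P a) (P b) = algebraMap ℝ 𝒜 (eta a b)

theorem isFrameChange_refl : IsFrameChange E E (fun a => Pi.single a 1) where
  d_eq a f := (E.dir_single a f).symm
  metric_eq := metric_single_single

namespace IsFrameChange

variable {E} {E' : FrameAlgebra 𝒜} {P : Fin 3 → Fin 3 → 𝒜} (h : IsFrameChange E E' P)
include h

/-- The Gram matrix of the new frame is η, so the frame matrix is invertible over `𝒜` and pairing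
with the frame loses nothing. -/
theorem ext_metric {X Y : Fin 3 → 𝒜} (hXY : ∀ d, metric X (P d) = metric Y (P d)) : X = Y := by
  let H : Matrix (Fin 3) (Fin 3) 𝒜 := eta.map (algebraMap ℝ 𝒜)
  let K : Matrix (Fin 3) (Fin 3) 𝒜 := etaInv.map (algebraMap ℝ 𝒜)
  have hHK : H * K = 1 := by
    rw [← Matrix.map_mul, eta_mul_etaInv]; simp
  have hKH : K * H = 1 := mul_eq_one_comm.1 hHK
  let Q : Matrix (Fin 3) (Fin 3) 𝒜 := Matrix.of P
  have hm (X Y : Fin 3 → 𝒜) : metric X Y = Y ⬝ᵥ (H *ᵥ X) := by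
    simp only [FrameAlgebra.metric_eq]
    simp [H, dotProduct, Matrix.mulVec, Fin.sum_univ_three, eta]
    ring
  have hQ : Q * (H * Qᵀ * K) = 1 := by
    have : Q * H * Qᵀ = H := by
      ext a b
      rw [Matrix.mul_assoc]
      have := h.metric_eq b a
      rw [hm] at this
      have hs : eta b a = eta a b := by fin_cases a <;> fin_cases b <;> simp [eta]
      rw [hs] at this
      exact this
    rw [Matrix.mul_assoc, ← Matrix.mul_assoc, ← Matrix.mul_assoc, this, hHK]
  have hQ' := mul_eq_one_comm.1 hQ
  have h1 : Q *ᵥ (H *ᵥ X) = Q *ᵥ (H *ᵥ Y) := by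
    funext d
    have := hXY d
    rw [hm, hm] at this
    exact this
  have h2 := congrArg (fun v => K *ᵥ ((H * Qᵀ * K) *ᵥ v)) h1
  simpa [Matrix.mulVec_mulVec, ← Matrix.mul_assoc, hQ', hKH] using h2

theorem sum_B (a b : Fin 3) : ∑ k, E'.B a b k • P k = E.br (P a) (P b) := by
  refine E.dir_ext fun f => ?_
  rw [E.dir_br, ← h.d_eq, ← h.d_eq, ← h.d_eq, ← h.d_eq, E'.comm']
  simp only [Fin.sum_univ_three, dir_add, dir_smul, h.d_eq]

theorem bl_eq (a b c : Fin 3) : E'.bl a b c = metric (E.br (P a) (P b)) (P c) := by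
  rw [← h.sum_B, metric_sum_left]
  simp only [metric_smul_left, h.metric_eq, Fin.sum_univ_three, B_zero, B_one, B_two]
  have h2 := two_mul_half (𝒜 := 𝒜)
  rw [one_div] at h2
  fin_cases c <;> simp [eta]
  linear_combination -E'.bl a b 1 * h2

/-- Uniqueness of the Levi-Civita connection: the Koszul expression computed in the new frame agrees
with ∇ of the old frame, because ∇ is torsion-free and metric. This is what makes curvature
independent of the frame. -/
theorem connLow_eq (a b c : Fin 3) :
    E'.connLow a b c = metric (E.nabla (P a) (P b)) (P c) := by
  have h1 (a b c : Fin 3) : metric (E.nabla (P a) (P b)) (P c) +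
      metric (E.nabla (P a) (P c)) (P b) = 0 := by
    have := E.dir_metric (P a) (P b) (P c)
    rw [h.metric_eq, Derivation.map_algebraMap, metric_comm (P b)] at this
    exact this.symm
  simp only [connLow, h.bl_eq, ← E.nabla_sub_nabla, metric_sub_left]
  linear_combination algebraMap ℝ 𝒜 (1 / 2) * (-h1 a b c - h1 b a c + h1 c a b)
    + metric (E.nabla (P a) (P b)) (P c) * two_mul_half (𝒜 := 𝒜)

theorem nabla_eq (a b : Fin 3) : E.nabla (P a) (P b) = ∑ c, E'.conn c a b • P c := by
  refine h.ext_metric fun d => ?_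
  rw [← h.connLow_eq, metric_sum_left]
  simp only [metric_smul_left, h.metric_eq, Fin.sum_univ_three, conn_zero, conn_one, conn_two]
  have h2 := two_mul_half (𝒜 := 𝒜)
  rw [one_div] at h2
  fin_cases d <;> simp [eta]
  linear_combination -E'.connLow a b 1 * h2

theorem curvOp_eq (b c d : Fin 3) :
    E.curvOp (P c) (P d) (P b) = ∑ a, E'.riemUp a b c d • P a := by
  simp only [curvOp, ← h.sum_B, h.nabla_eq, nabla_sum_right, nabla_sum_left, nabla_smul_left,
    nabla_smul_right, riemUp, h.d_eq]
  funext e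
  simp only [Fin.sum_univ_three, Pi.add_apply, Pi.sub_apply, Pi.smul_apply, smul_eq_mul]
  ring

theorem riem_eq (i : Fin 4 → Fin 3) :
    E'.riem i = metric (E.curvOp (P (i 2)) (P (i 3)) (P (i 1))) (P (i 0)) := by
  rw [h.curvOp_eq, metric_sum_left, riem]
  refine Finset.sum_congr rfl fun f _ => ?_
  have hs (a b : Fin 3) : eta b a = eta a b := by fin_cases a <;> fin_cases b <;> simp [eta]
  rw [metric_smul_left, h.metric_eq, hs, mul_comm]

end IsFrameChange

/-! ### Tensors as multilinear maps -/

theorem fin_four_ne : (0 : Fin 4) ≠ 1 ∧ (0 : Fin 4) ≠ 2 ∧ (0 : Fin 4) ≠ 3 ∧ (1 : Fin 4) ≠ 2 ∧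
    (1 : Fin 4) ≠ 3 ∧ (2 : Fin 4) ≠ 3 := by decide

theorem fin_four_cases (m : Fin 4) : m = 0 ∨ m = 1 ∨ m = 2 ∨ m = 3 := by
  revert m; decide

/-- The Riemann tensor. -/
def riemMul : MultilinearMap 𝒜 (fun _ : Fin 4 => Fin 3 → 𝒜) 𝒜 :=
  MultilinearMap.mk' (fun X => metric (E.curvOp (X 2) (X 3) (X 1)) (X 0))
    (fun X m x y => by
      obtain ⟨h01, h02, h03, h12, h13, h23⟩ := fin_four_ne
      obtain rfl | rfl | rfl | rfl := fin_four_cases m <;>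
        simp [-Fin.isValue, h01, h02, h03, h12, h13, h23, h01.symm, h02.symm, h03.symm, h12.symm,
          h13.symm, h23.symm, curvOp_add_left, curvOp_add_mid, curvOp_add_right, metric_add_left,
          metric_add_right])
    (fun X m f x => by
      obtain ⟨h01, h02, h03, h12, h13, h23⟩ := fin_four_ne
      obtain rfl | rfl | rfl | rfl := fin_four_cases m <;>
        simp [-Fin.isValue, h01, h02, h03, h12, h13, h23, h01.symm, h02.symm, h03.symm, h12.symm,
          h13.symm, h23.symm, curvOp_smul_left, curvOp_smul_mid, curvOp_smul_right,
          metric_smul_left, metric_smul_right])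

/-- The covariant derivative of a tensor along a vector field. -/
def covMul {k : ℕ} (T : MultilinearMap 𝒜 (fun _ : Fin k => Fin 3 → 𝒜) 𝒜) (V : Fin 3 → 𝒜) :
    MultilinearMap 𝒜 (fun _ : Fin k => Fin 3 → 𝒜) 𝒜 :=
  MultilinearMap.mk' (fun X => E.dir V (T X) - ∑ j, T (Function.update X j (E.nabla V (X j))))
  (fun X m x y => by
    have key (j : Fin k) : T (Function.update (Function.update X m (x + y)) j
        (E.nabla V (Function.update X m (x + y) j))) =
        T (Function.update (Function.update X m x) j (E.nabla V (Function.update X m x j))) +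
        T (Function.update (Function.update X m y) j (E.nabla V (Function.update X m y j))) := by
      by_cases hj : j = m
      · subst hj
        simp [nabla_add_right]
      · simp only [Function.update_of_ne hj]
        rw [Function.update_comm (Ne.symm hj), Function.update_comm (Ne.symm hj),
          Function.update_comm (Ne.symm hj), T.map_update_add]
    simp only [key, T.map_update_add, map_add, Finset.sum_add_distrib]
    ring)
  (fun X m f x => by
    -- Only the slot `j = m` contributes a Leibniz term, and it cancels the derivative of `f` coming
    -- from `E.dir V`.
    have key (j : Fin k) : T (Function.update (Function.update X m (f • x)) j
        (E.nabla V (Function.update X m (f • x) j))) =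
        f * T (Function.update (Function.update X m x) j (E.nabla V (Function.update X m x j))) +
        if j = m then E.dir V f * T (Function.update X m x) else 0 := by
      by_cases hj : j = m
      · subst hj
        simp [nabla_smul_right, add_comm]
      · simp only [Function.update_of_ne hj]
        rw [Function.update_comm (Ne.symm hj), Function.update_comm (Ne.symm hj),
          T.map_update_smul]
        simp [hj]
    simp only [key, T.map_update_smul, Finset.sum_add_distrib, smul_eq_mul, Derivation.leibniz,
      ← Finset.mul_sum, Finset.sum_ite_eq', Finset.mem_univ, if_true]
    ring)

theorem covMul_apply {k : ℕ} (T : MultilinearMap 𝒜 (fun _ : Fin k => Fin 3 → 𝒜) 𝒜)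
    (V : Fin 3 → 𝒜) (X : Fin k → Fin 3 → 𝒜) :
    E.covMul T V X = E.dir V (T X) - ∑ j, T (Function.update X j (E.nabla V (X j))) := rfl

theorem multilinear_expand {k : ℕ} (T : MultilinearMap 𝒜 (fun _ : Fin k => Fin 3 → 𝒜) 𝒜)
    (X : Fin k → Fin 3 → 𝒜) :
    T X = ∑ b : Fin k → Fin 3, (∏ j, X j (b j)) * T (fun j => Pi.single (b j) 1) := by
  have h1 : X = fun j => ∑ a, X j a • (Pi.single a 1 : Fin 3 → 𝒜) := by
    funext j
    exact pi_eq_sum_univ' (X j)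
  conv_lhs => rw [h1, T.map_sum]
  refine Finset.sum_congr rfl fun b _ => ?_
  rw [T.map_smul_univ, smul_eq_mul]

theorem covMul_add {k : ℕ} (T : MultilinearMap 𝒜 (fun _ : Fin k => Fin 3 → 𝒜) 𝒜)
    (V W : Fin 3 → 𝒜) (X : Fin k → Fin 3 → 𝒜) :
    E.covMul T (V + W) X = E.covMul T V X + E.covMul T W X := by
  simp only [covMul_apply, dir_add, nabla_add_left, T.map_update_add,
    Finset.sum_add_distrib]
  ring

theorem covMul_smul {k : ℕ} (T : MultilinearMap 𝒜 (fun _ : Fin k => Fin 3 → 𝒜) 𝒜)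
    (f : 𝒜) (V : Fin 3 → 𝒜) (X : Fin k → Fin 3 → 𝒜) :
    E.covMul T (f • V) X = f * E.covMul T V X := by
  simp only [covMul_apply, dir_smul, nabla_smul_left, T.map_update_smul,
    ← Finset.mul_sum, smul_eq_mul]
  ring

theorem covMul_expand {k : ℕ} (T : MultilinearMap 𝒜 (fun _ : Fin k => Fin 3 → 𝒜) 𝒜)
    (V : Fin 3 → 𝒜) (X : Fin k → Fin 3 → 𝒜) :
    E.covMul T V X = ∑ a, V a * E.covMul T (Pi.single a 1) X := by
  conv_lhs => rw [pi_eq_sum_univ' V]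
  simp only [Fin.sum_univ_three, covMul_add, covMul_smul]

namespace IsFrameChange

variable {E} {E' : FrameAlgebra 𝒜} {P : Fin 3 → Fin 3 → 𝒜} (h : IsFrameChange E E' P)
include h

theorem riem_eq_riemMul (i : Fin 4 → Fin 3) : E'.riem i = E.riemMul (fun j => P (i j)) :=
  h.riem_eq i

/-- The component formula in any frame computes one and the same multilinear object `covMul`; the
transformation law of ∇Riem follows by multilinearity. -/
theorem covDer_eq {k : ℕ} {T : MultilinearMap 𝒜 (fun _ : Fin k => Fin 3 → 𝒜) 𝒜}
    {T' : (Fin k → Fin 3) → 𝒜} (hT : ∀ i, T' i = T (fun j => P (i j)))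
    (i : Fin (k + 1) → Fin 3) :
    E'.covDer T' i = E.covMul T (P (i (Fin.last k))) (fun j => P (i j.castSucc)) := by
  simp only [covDer, covMul_apply, h.d_eq, hT, h.nabla_eq]
  congr 1
  refine Finset.sum_congr rfl fun j _ => ?_
  rw [T.map_update_sum]
  refine Finset.sum_congr rfl fun b _ => ?_
  rw [T.map_update_smul, smul_eq_mul]
  congr 2
  funext l
  by_cases hl : l = j
  · subst hl; simp
  · simp [Function.update_of_ne hl, Fin.init]

/-- The Riemann tensor transforms as a tensor. -/
theorem riem_transform (i : Fin 4 → Fin 3) :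
    E'.riem i = ∑ b : Fin 4 → Fin 3, (∏ j, P (i j) (b j)) * E.riem b := by
  rw [h.riem_eq_riemMul, multilinear_expand]
  refine Finset.sum_congr rfl fun b _ => ?_
  rw [E.isFrameChange_refl.riem_eq_riemMul]

/-- The covariant derivative of the Riemann tensor transforms as a tensor. -/
theorem covDer_riem_transform (i : Fin 5 → Fin 3) :
    E'.covDer E'.riem i = ∑ b : Fin 5 → Fin 3, (∏ j, P (i j) (b j)) * E.covDer E.riem b := by
  rw [h.covDer_eq h.riem_eq_riemMul, covMul_expand]
  have h2 := E.isFrameChange_refl.covDer_eq E.isFrameChange_refl.riem_eq_riemMul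
  rw [← (Fin.snocEquiv (fun _ : Fin 5 => Fin 3)).sum_comp, Fintype.sum_prod_type]
  refine Finset.sum_congr rfl fun a _ => ?_
  rw [multilinear_expand, Finset.mul_sum]
  refine Finset.sum_congr rfl fun b _ => ?_
  have hp := Fin.prod_univ_castSucc
    (fun j : Fin 5 => P (i j) ((Fin.snoc b a : Fin 5 → Fin 3) j))
  simp only [Fin.snoc_castSucc, Fin.snoc_last] at hp
  simp only [h2, Fin.snocEquiv, Equiv.coe_fn_mk, Fin.snoc_castSucc, Fin.snoc_last]
  rw [hp]
  ring

end IsFrameChange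

end FrameAlgebra

/-! ### Smooth functions on an open set as a frame algebra. -/

section Bridge

variable {M : Type*} [TopologicalSpace M] [ChartedSpace (EuclideanSpace ℝ (Fin 3)) M]

/-! ### Rules for derivatives along vector fields -/

theorem dirDeriv_congr {V : (x : M) → TangentSpace (𝓡 3) x} {f h : M → ℝ} {x : M}
    (hfh : f =ᶠ[𝓝 x] h) : dirDeriv V f x = dirDeriv V h x := by
  unfold dirDeriv
  rw [hfh.mfderiv_eq]
  rfl

theorem dirDeriv_of_eventually_const {V : (x : M) → TangentSpace (𝓡 3) x} {f : M → ℝ} {x : M}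
    {c : ℝ} (hf : ∀ᶠ y in 𝓝 x, f y = c) : dirDeriv V f x = 0 := by
  have h : f =ᶠ[𝓝 x] fun _ => c := hf
  rw [dirDeriv_congr h]
  unfold dirDeriv
  rw [mfderiv_const]
  rfl

theorem dirDeriv_add {V : (x : M) → TangentSpace (𝓡 3) x} {f h : M → ℝ} {x : M}
    (hf : MDifferentiableAt (𝓡 3) 𝓘(ℝ, ℝ) f x) (hh : MDifferentiableAt (𝓡 3) 𝓘(ℝ, ℝ) h x) :
    dirDeriv V (f + h) x = dirDeriv V f x + dirDeriv V h x := by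
  unfold dirDeriv
  exact DFunLike.congr_fun (mfderiv_add hf hh) (V x)

theorem dirDeriv_mul {V : (x : M) → TangentSpace (𝓡 3) x} {f h : M → ℝ} {x : M}
    (hf : MDifferentiableAt (𝓡 3) 𝓘(ℝ, ℝ) f x) (hh : MDifferentiableAt (𝓡 3) 𝓘(ℝ, ℝ) h x) :
    dirDeriv V (f * h) x = f x * dirDeriv V h x + h x * dirDeriv V f x := by
  unfold dirDeriv
  have := (hf.hasMFDerivAt.mul hh.hasMFDerivAt).mfderiv
  exact DFunLike.congr_fun this (V x)

theorem dirDeriv_field_sum {V : (x : M) → TangentSpace (𝓡 3) x} {f : M → ℝ} {x : M}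
    {W : Fin 3 → (x : M) → TangentSpace (𝓡 3) x} {c : Fin 3 → ℝ}
    (hV : V x = ∑ k, c k • W k x) : dirDeriv V f x = ∑ k, c k * dirDeriv (W k) f x := by
  unfold dirDeriv
  rw [hV, map_sum]
  refine Finset.sum_congr rfl fun k _ => ?_
  rw [map_smul]
  rfl

/-! ### The algebra of smooth functions on an open set -/

open Classical in
/-- Extension by zero. -/
def extendZero (U : Set M) (f : U → ℝ) (x : M) : ℝ := if h : x ∈ U then f ⟨x, h⟩ else 0

theorem extendZero_apply {U : Set M} (f : U → ℝ) {x : M} (hx : x ∈ U) :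
    extendZero U f x = f ⟨x, hx⟩ := by simp [extendZero, hx]

/-- The smooth functions on `U`. -/
def smoothFun (U : Set M) : Subalgebra ℝ (U → ℝ) where
  carrier := {f | ContMDiffOn (𝓡 3) 𝓘(ℝ, ℝ) ∞ (extendZero U f) U}
  mul_mem' {f h} hf hh := (ContMDiffOn.mul hf hh).congr fun x hx => by
    simp [extendZero_apply _ hx]
  add_mem' {f h} hf hh := (ContMDiffOn.add hf hh).congr fun x hx => by
    simp [extendZero_apply _ hx]
  algebraMap_mem' r := (contMDiffOn_const (c := r)).congr fun x hx => by
    simp [extendZero_apply _ hx]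

theorem mem_smoothFun {U : Set M} {f : M → ℝ} (hf : ContMDiffOn (𝓡 3) 𝓘(ℝ, ℝ) ∞ f U) :
    (fun x : U => f x) ∈ smoothFun U :=
  hf.congr fun x hx => by simp [extendZero_apply _ hx]

/-- Restriction of a smooth function. -/
def toSmooth {U : Set M} {f : M → ℝ} (hf : ContMDiffOn (𝓡 3) 𝓘(ℝ, ℝ) ∞ f U) : smoothFun U :=
  ⟨fun x => f x, mem_smoothFun hf⟩

/-- Derivatives at points of the open set do not see the artificial zero values outside. -/
theorem eventually_extendZero {U : Set M} (hU : IsOpen U) {f : M → ℝ} {h : U → ℝ}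
    (hfh : ∀ x : U, h x = f x) {x : M} (hx : x ∈ U) : extendZero U h =ᶠ[𝓝 x] f := by
  filter_upwards [hU.mem_nhds hx] with y hy
  rw [extendZero_apply _ hy, hfh]

theorem mdifferentiableAt_of_smoothOn {U : Set M} (hU : IsOpen U) {f : M → ℝ}
    (hf : ContMDiffOn (𝓡 3) 𝓘(ℝ, ℝ) ∞ f U) {x : M} (hx : x ∈ U) :
    MDifferentiableAt (𝓡 3) 𝓘(ℝ, ℝ) f x :=
  (hf.contMDiffAt (hU.mem_nhds hx)).mdifferentiableAt (by norm_cast)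

variable [IsManifold (𝓡 3) ∞ M]

/-- The derivation of `smoothFun U` given by a smooth vector field. -/
def fieldDerivation {U : Set M} (hU : IsOpen U) {V : (x : M) → TangentSpace (𝓡 3) x}
    (hV : SmoothField V U) : Derivation ℝ (smoothFun U) (smoothFun U) :=
  Derivation.mk'
    { toFun := fun f => toSmooth (contMDiffOn_dirDeriv hU f.2 hV)
      map_add' := fun f h => by
        apply Subtype.ext
        funext x
        refine Eq.trans ?_ (dirDeriv_add (V := V) (mdifferentiableAt_of_smoothOn hU f.2 x.2)
          (mdifferentiableAt_of_smoothOn hU h.2 x.2))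
        refine dirDeriv_congr (eventually_extendZero hU (fun y => ?_) x.2)
        simp [extendZero_apply _ y.2]
      map_smul' := fun r f => by
        apply Subtype.ext
        funext x
        have h1 := dirDeriv_mul (V := V) (mdifferentiableAt_of_smoothOn hU
          (contMDiffOn_const (c := r)) x.2) (mdifferentiableAt_of_smoothOn hU f.2 x.2)
        have h2 : dirDeriv V (fun _ => r) (x : M) = 0 :=
          dirDeriv_of_eventually_const (c := r) (by simp)
        rw [h2, mul_zero, add_zero] at h1
        refine Eq.trans ?_ h1
        refine dirDeriv_congr (eventually_extendZero hU (fun y => ?_) x.2)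
        simp [extendZero_apply _ y.2] }
    (fun f h => by
      apply Subtype.ext
      funext x
      refine Eq.trans ?_ ((dirDeriv_mul (V := V) (mdifferentiableAt_of_smoothOn hU f.2 x.2)
          (mdifferentiableAt_of_smoothOn hU h.2 x.2)).trans ?_)
      · refine dirDeriv_congr (eventually_extendZero hU (fun y => ?_) x.2)
        simp [extendZero_apply _ y.2]
      · simp [extendZero_apply _ x.2, toSmooth])

theorem fieldDerivation_apply {U : Set M} (hU : IsOpen U) {V : (x : M) → TangentSpace (𝓡 3) x}
    (hV : SmoothField V U) (f : smoothFun U) (x : U) :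
    (fieldDerivation hU hV f : U → ℝ) x = dirDeriv V (extendZero U f) x := rfl

namespace NullFrame

variable {g : LorentzMetric M} (F : NullFrame g)

theorem smoothField (a : Fin 3) : SmoothField (F.e a) F.dom := F.contMDiffOn a

theorem deriv_eq (a : Fin 3) : F.deriv a = dirDeriv (F.e a) := rfl

theorem contMDiffOn_inner {U : Set M} {V W : (x : M) → TangentSpace (𝓡 3) x}
    (hV : SmoothField V U) (hW : SmoothField W U) :
    ContMDiffOn (𝓡 3) 𝓘(ℝ, ℝ) ∞ (fun x => g.inner x (V x) (W x)) U := by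
  have h := ContMDiffOn.clm_bundle_apply₂ (F₁ := EuclideanSpace ℝ (Fin 3))
    (F₂ := EuclideanSpace ℝ (Fin 3)) (F₃ := ℝ) (E₁ := fun x : M => TangentSpace (𝓡 3) x)
    (E₂ := fun x : M => TangentSpace (𝓡 3) x) (E₃ := Bundle.Trivial M ℝ)
    (b := fun x : M => x) (g.contMDiff.contMDiffOn (s := U)) hV hW
  intro x hx
  exact Bundle.contMDiffWithinAt_section.1 (h x hx)

theorem smoothField_mlieBracket {U : Set M} (hU : IsOpen U)
    {V W : (x : M) → TangentSpace (𝓡 3) x} (hV : SmoothField V U) (hW : SmoothField W U) :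
    SmoothField (VectorField.mlieBracket (𝓡 3) V W) U := by
  have : IsManifold (𝓡 3) (((⊤ : ℕ∞) : WithTop ℕ∞) + 1) M := by simpa using ‹_›
  have : IsManifold (𝓡 3) (minSmoothness ℝ 2) M := by
    rw [minSmoothness_of_isRCLikeNormedField]
    exact IsManifold.of_le (n := ∞) (WithTop.coe_le_coe.2 (le_top : (2 : ℕ∞) ≤ ⊤))
  intro x hx
  exact (ContMDiffAt.mlieBracket_vectorField (n := ⊤) (m := ⊤)
    (hV.contMDiffAt (hU.mem_nhds hx)) (hW.contMDiffAt (hU.mem_nhds hx)) (by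
      rw [minSmoothness_of_isRCLikeNormedField]; simp)).contMDiffWithinAt

theorem contMDiffOn_bracketLow (a b c : Fin 3) :
    ContMDiffOn (𝓡 3) 𝓘(ℝ, ℝ) ∞ (F.bracketLow a b c) F.dom :=
  contMDiffOn_inner (smoothField_mlieBracket F.isOpen_dom (F.smoothField a) (F.smoothField b))
    (F.smoothField c)

theorem linearIndependent {x : M} (hx : x ∈ F.dom) : LinearIndependent ℝ (fun a => F.e a x) := by
  rw [Fintype.linearIndependent_iff]
  intro c hc
  have h (d : Fin 3) : ∑ k, c k * eta k d = 0 := by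
    have := congrArg (fun v => g.inner x v (F.e d x)) hc
    simpa [F.inner_eq x hx] using this
  have h0 := h 0
  have h1 := h 1
  have h2 := h 2
  simp [Fin.sum_univ_three, eta] at h0 h1 h2
  intro k
  fin_cases k <;> simp [h0, h1, h2]

theorem eq_sum {x : M} (hx : x ∈ F.dom) (v : TangentSpace (𝓡 3) x) :
    v = ∑ k, (∑ h, etaInv k h * g.inner x v (F.e h x)) • F.e k x := by
  have hcard : Fintype.card (Fin 3) = Module.finrank ℝ (TangentSpace (𝓡 3) x) := by
    change _ = Module.finrank ℝ (EuclideanSpace ℝ (Fin 3))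
    simp
  let b := basisOfLinearIndependentOfCardEqFinrank (F.linearIndependent hx) hcard
  have hb (k : Fin 3) : b k = F.e k x := by simp [b]
  have hv := b.sum_repr v
  simp only [hb] at hv
  have hin (h : Fin 3) : g.inner x v (F.e h x) = ∑ k, b.repr v k * eta k h := by
    conv_lhs => rw [← hv]
    simp [F.inner_eq x hx]
  conv_lhs => rw [← hv]
  refine Finset.sum_congr rfl fun k _ => ?_
  congr 1
  simp only [hin]
  fin_cases k <;> simp [Fin.sum_univ_three, eta, etaInv]
  ring

theorem mlieBracket_eq_sum {x : M} (hx : x ∈ F.dom) (a b : Fin 3) :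
    VectorField.mlieBracket (𝓡 3) (F.e a) (F.e b) x = ∑ k, F.bracket a b k x • F.e k x :=
  F.eq_sum hx _

/-- An open set on which the frame derivations can be separated by functions: it lies in the
domain of the frame and in the domain of a chart. -/
structure IsFrameDomain (U : Set M) : Prop where
  isOpen : IsOpen U
  subset_dom : U ⊆ F.dom
  subset_chart : ∃ x₀ : M, U ⊆ (chartAt (EuclideanSpace ℝ (Fin 3)) x₀).source

theorem exists_isFrameDomain {x : M} {s : Set M} (hs : s ∈ 𝓝 x) (hsub : s ⊆ F.dom) :
    ∃ U ⊆ s, x ∈ U ∧ F.IsFrameDomain U := by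
  refine ⟨interior s ∩ (chartAt (EuclideanSpace ℝ (Fin 3)) x).source,
    fun y hy => interior_subset hy.1, ⟨mem_interior_iff_mem_nhds.2 hs, mem_chart_source _ x⟩,
    ⟨isOpen_interior.inter (chartAt _ x).open_source, fun y hy => hsub (interior_subset hy.1),
      ⟨x, Set.inter_subset_right⟩⟩⟩

variable {F} {U : Set M}

/-- The three coordinates of a chart that covers `U` already separate tangent vectors; this is why a
frame domain has to lie inside a chart domain. -/
theorem eq_zero_of_dirDeriv_eq_zero (hU : F.IsFrameDomain U) (c : Fin 3 → ℝ) {x : M}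
    (hx : x ∈ U) (hc : ∀ f : M → ℝ, ContMDiffOn (𝓡 3) 𝓘(ℝ, ℝ) ∞ f U →
      ∑ k, c k * dirDeriv (F.e k) f x = 0) : c = 0 := by
  have : IsManifold (𝓡 3) 1 M := IsManifold.of_le (n := ∞) (by norm_cast)
  obtain ⟨x₀, hx₀⟩ := hU.subset_chart
  have hφ : ContMDiffOn (𝓡 3) 𝓘(ℝ, EuclideanSpace ℝ (Fin 3)) ∞ (extChartAt (𝓡 3) x₀) U :=
    contMDiffOn_extChartAt.mono hx₀
  have hφx : MDifferentiableAt (𝓡 3) 𝓘(ℝ, EuclideanSpace ℝ (Fin 3)) (extChartAt (𝓡 3) x₀) x :=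
    (hφ.contMDiffAt (hU.isOpen.mem_nhds hx)).mdifferentiableAt (by norm_cast)
  have hinv := isInvertible_mfderiv_extChartAt (I := 𝓡 3) (x := x₀) (y := x)
    (by rw [extChartAt_source]; exact hx₀ hx)
  set L := mfderiv (𝓡 3) 𝓘(ℝ, EuclideanSpace ℝ (Fin 3)) (extChartAt (𝓡 3) x₀) x with hL
  have hv : ∑ k, c k • F.e k x = 0 := by
    apply hinv.injective
    rw [map_zero]
    refine PiLp.ext fun i => ?_
    have hp : ContMDiffOn (𝓡 3) 𝓘(ℝ, ℝ) ∞ (fun y => extChartAt (𝓡 3) x₀ y i) U :=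
      ((EuclideanSpace.proj i : EuclideanSpace ℝ (Fin 3) →L[ℝ] ℝ).contMDiff
        (n := ∞)).comp_contMDiffOn hφ
    have h1 := hc _ hp
    have h2 (k : Fin 3) : dirDeriv (F.e k) (fun y => extChartAt (𝓡 3) x₀ y i) x =
        (EuclideanSpace.proj i : EuclideanSpace ℝ (Fin 3) →L[ℝ] ℝ) (L (F.e k x)) := by
      have h3 := mfderiv_comp x (I' := 𝓘(ℝ, EuclideanSpace ℝ (Fin 3))) (I'' := 𝓘(ℝ, ℝ))
        (g := (EuclideanSpace.proj i : EuclideanSpace ℝ (Fin 3) →L[ℝ] ℝ))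
        (ContinuousLinearMap.mdifferentiableAt _) hφx
      rw [ContinuousLinearMap.mfderiv_eq] at h3
      exact DFunLike.congr_fun h3 (F.e k x)
    simp only [h2] at h1
    refine Eq.trans ?_ h1
    have h4 : L (∑ k, c k • F.e k x) = ∑ k, c k • L (F.e k x) := by simp only [map_sum, map_smul]
    rw [h4]
    exact (map_sum (EuclideanSpace.proj i : EuclideanSpace ℝ (Fin 3) →L[ℝ] ℝ)
      (fun k => c k • (L (F.e k x) : EuclideanSpace ℝ (Fin 3))) Finset.univ).trans
      (Finset.sum_congr rfl fun k _ => map_smul _ _ _)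
  have hli := Fintype.linearIndependent_iff.1 (F.linearIndependent (hU.subset_dom hx)) c hv
  exact funext hli

/-- The frame algebra of a null frame on an open set. -/
def frameAlgebra (hU : F.IsFrameDomain U) : FrameAlgebra (smoothFun U) where
  d a := fieldDerivation hU.isOpen ((F.smoothField a).mono hU.subset_dom)
  bl a b c := toSmooth ((F.contMDiffOn_bracketLow a b c).mono hU.subset_dom)
  comm a b f := by
    apply Subtype.ext
    funext x
    have hx := hU.subset_dom x.2
    have h1 := dirDeriv_mlieBracket hU.isOpen f.2 ((F.smoothField a).mono hU.subset_dom)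
      ((F.smoothField b).mono hU.subset_dom) x.2
    rw [dirDeriv_field_sum (F.mlieBracket_eq_sum hx a b)] at h1
    have h2 (a b : Fin 3) : dirDeriv (F.e a) (dirDeriv (F.e b) (extendZero U f)) x =
        (fieldDerivation hU.isOpen ((F.smoothField a).mono hU.subset_dom)
          (fieldDerivation hU.isOpen ((F.smoothField b).mono hU.subset_dom) f) : U → ℝ) x := by
      rw [fieldDerivation_apply]
      exact dirDeriv_congr (eventually_extendZero hU.isOpen (fun y => rfl) x.2).symm
    rw [h2, h2] at h1
    refine Eq.trans h1.symm ?_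
    simp only [Fin.sum_univ_three, bracket]
    rfl
  indep c hc := by
    funext k
    apply Subtype.ext
    funext x
    have := eq_zero_of_dirDeriv_eq_zero hU (fun k => (c k : U → ℝ) x) x.2 (fun f hf => by
      have h1 := congrArg (fun h : smoothFun U => (h : U → ℝ) x) (hc (toSmooth hf))
      have h2 (k : Fin 3) : dirDeriv (F.e k) f x = dirDeriv (F.e k)
          (extendZero U (toSmooth hf : U → ℝ)) x :=
        dirDeriv_congr (eventually_extendZero hU.isOpen (fun y => rfl) x.2).symm
      simp only [h2]
      simp only [Fin.sum_univ_three] at h1 ⊢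
      exact h1)
    exact congrFun this k

end NullFrame

end Bridge

/-! ### Symmetries and Bianchi identities in components. -/

namespace FrameAlgebra

variable {𝒜 : Type*} [CommRing 𝒜] [Algebra ℝ 𝒜] (E : FrameAlgebra 𝒜)

theorem riem_apply (a b c d : Fin 3) : E.riem ![a, b, c, d] =
    metric (E.curvOp (Pi.single c 1) (Pi.single d 1) (Pi.single b 1)) (Pi.single a 1) :=
  E.isFrameChange_refl.riem_eq ![a, b, c, d]

theorem riem_swap_left (a b c d : Fin 3) : E.riem ![a, b, c, d] = -E.riem ![b, a, c, d] := by
  rw [riem_apply, riem_apply, metric_curvOp]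

theorem riem_swap_right (a b c d : Fin 3) : E.riem ![a, b, c, d] = -E.riem ![a, b, d, c] := by
  rw [riem_apply, riem_apply, curvOp_swap, ← neg_one_smul 𝒜, metric_smul_left, neg_one_mul]

theorem riem_cyclic (a b c d : Fin 3) :
    E.riem ![a, b, c, d] + E.riem ![a, c, d, b] + E.riem ![a, d, b, c] = 0 := by
  rw [riem_apply, riem_apply, riem_apply, ← metric_add_left, ← metric_add_left]
  have := E.curvOp_cyclic (Pi.single c 1) (Pi.single d 1) (Pi.single b 1)
  rw [this]
  simp [metric_eq]

/-- Metric compatibility absorbs the correction in slot 0, so the component of ∇Riem is a pairing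
with `curvDerOp`, to which the operator form of the Bianchi identity applies. -/
theorem covDer_riem_apply (a b c d e : Fin 3) : E.covDer E.riem ![a, b, c, d, e] =
    metric (E.curvDerOp (Pi.single e 1) (Pi.single c 1) (Pi.single d 1) (Pi.single b 1))
      (Pi.single a 1) := by
  rw [E.isFrameChange_refl.covDer_eq E.isFrameChange_refl.riem_eq_riemMul]
  have hl : (![a, b, c, d, e] : Fin 5 → Fin 3) (Fin.last 4) = e := rfl
  rw [hl, covMul_apply]
  have h0 : (fun j : Fin 4 => (Pi.single ((![a, b, c, d, e] : Fin 5 → Fin 3) j.castSucc) 1 :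
      Fin 3 → 𝒜)) = ![Pi.single a 1, Pi.single b 1, Pi.single c 1, Pi.single d 1] := by
    funext j; fin_cases j <;> rfl
  rw [h0]
  have hm (X : Fin 4 → Fin 3 → 𝒜) : E.riemMul X = metric (E.curvOp (X 2) (X 3) (X 1)) (X 0) := rfl
  obtain ⟨h01, h02, h03, h12, h13, h23⟩ := fin_four_ne
  simp only [hm, Fin.sum_univ_four, Function.update_self, Function.update_of_ne h01,
    Function.update_of_ne h02, Function.update_of_ne h03, Function.update_of_ne h12,
    Function.update_of_ne h13, Function.update_of_ne h23, Function.update_of_ne h01.symm,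
    Function.update_of_ne h02.symm, Function.update_of_ne h03.symm, Function.update_of_ne h12.symm,
    Function.update_of_ne h13.symm, Function.update_of_ne h23.symm]
  have e0 (X Y Z W : Fin 3 → 𝒜) : (![X, Y, Z, W] : Fin 4 → Fin 3 → 𝒜) 0 = X := rfl
  have e1 (X Y Z W : Fin 3 → 𝒜) : (![X, Y, Z, W] : Fin 4 → Fin 3 → 𝒜) 1 = Y := rfl
  have e2 (X Y Z W : Fin 3 → 𝒜) : (![X, Y, Z, W] : Fin 4 → Fin 3 → 𝒜) 2 = Z := rfl
  have e3 (X Y Z W : Fin 3 → 𝒜) : (![X, Y, Z, W] : Fin 4 → Fin 3 → 𝒜) 3 = W := rfl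
  have c0 : (![a, b, c, d, e] : Fin 5 → Fin 3) (Fin.castSucc 0) = a := rfl
  have c1 : (![a, b, c, d, e] : Fin 5 → Fin 3) (Fin.castSucc 1) = b := rfl
  have c2 : (![a, b, c, d, e] : Fin 5 → Fin 3) (Fin.castSucc 2) = c := rfl
  have c3 : (![a, b, c, d, e] : Fin 5 → Fin 3) (Fin.castSucc 3) = d := rfl
  simp only [c0, c1, c2, c3, e0, e1, e2, e3, dir_metric, curvDerOp, metric_sub_left]
  ring

theorem covDer_riem_cyclic (a b c d e : Fin 3) : E.covDer E.riem ![a, b, c, d, e] +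
    E.covDer E.riem ![a, b, d, e, c] + E.covDer E.riem ![a, b, e, c, d] = 0 := by
  rw [covDer_riem_apply, covDer_riem_apply, covDer_riem_apply, ← metric_add_left,
    ← metric_add_left, E.curvDerOp_cyclic]
  simp [metric_eq]

end FrameAlgebra

/-! ### Pointwise identities for a null frame, by evaluation. -/

namespace NullFrame

variable {M : Type*} [TopologicalSpace M] [ChartedSpace (EuclideanSpace ℝ (Fin 3)) M]
  [IsManifold (𝓡 3) ∞ M] {g : LorentzMetric M} {F : NullFrame g} {U : Set M}

/-- Evaluation of smooth functions at a point. -/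
def evalAt (x : U) : smoothFun U →ₐ[ℝ] ℝ := (Pi.evalAlgHom ℝ (fun _ : U => ℝ) x).comp (smoothFun U).val

theorem evalAt_d (hU : F.IsFrameDomain U) {a : Fin 3} {h : smoothFun U} {f : M → ℝ}
    (hf : ∀ y : U, evalAt y h = f y) (x : U) :
    evalAt x ((frameAlgebra hU).d a h) = F.deriv a f x :=
  dirDeriv_congr (eventually_extendZero hU.isOpen hf x.2)

theorem evalAt_bl (hU : F.IsFrameDomain U) (a b c : Fin 3) (x : U) :
    evalAt x ((frameAlgebra hU).bl a b c) = F.bracketLow a b c x := rfl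

theorem evalAt_B (hU : F.IsFrameDomain U) (a b c : Fin 3) (x : U) :
    evalAt x ((frameAlgebra hU).B a b c) = F.bracket a b c x := by
  simp [FrameAlgebra.B, bracket, evalAt_bl]

theorem evalAt_connLow (hU : F.IsFrameDomain U) (a b c : Fin 3) (x : U) :
    evalAt x ((frameAlgebra hU).connLow a b c) = F.connLow a b c x := by
  simp only [FrameAlgebra.connLow, connLow, map_mul, map_sub, evalAt_bl, AlgHom.commutes,
    Algebra.algebraMap_self, RingHom.id_apply]
  ring

theorem evalAt_conn (hU : F.IsFrameDomain U) (a b c : Fin 3) (x : U) :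
    evalAt x ((frameAlgebra hU).conn a b c) = F.conn a b c x := by
  simp [FrameAlgebra.conn, conn, evalAt_connLow]

theorem evalAt_riemUp (hU : F.IsFrameDomain U) (a b c d : Fin 3) (x : U) :
    evalAt x ((frameAlgebra hU).riemUp a b c d) = F.riemUp a b c d x := by
  simp [FrameAlgebra.riemUp, riemUp, evalAt_conn, evalAt_B,
    evalAt_d hU (evalAt_conn hU a d b), evalAt_d hU (evalAt_conn hU a c b)]

theorem evalAt_riem (hU : F.IsFrameDomain U) (i : Fin 4 → Fin 3) (x : U) :
    evalAt x ((frameAlgebra hU).riem i) = F.riem x i := by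
  simp [FrameAlgebra.riem, riem, evalAt_riemUp]

theorem evalAt_covDer (hU : F.IsFrameDomain U) {k : ℕ} {T : (Fin k → Fin 3) → smoothFun U}
    {T' : M → Tensor k} (hT : ∀ i, ∀ y : U, evalAt y (T i) = T' y i) (i : Fin (k + 1) → Fin 3)
    (x : U) : evalAt x ((frameAlgebra hU).covDer T i) = F.covDer T' x i := by
  simp [FrameAlgebra.covDer, covDer, evalAt_conn, hT, evalAt_d hU (f := fun y => T' y (Fin.init i)) (hT (Fin.init i))]

theorem evalAt_covDer_riem (hU : F.IsFrameDomain U) (i : Fin 5 → Fin 3) (x : U) :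
    evalAt x ((frameAlgebra hU).covDer (frameAlgebra hU).riem i) = F.riemDer 1 x i :=
  evalAt_covDer hU (evalAt_riem hU) i x

theorem exists_mem_isFrameDomain (F : NullFrame g) {x : M} (hx : x ∈ F.dom) :
    ∃ U, F.IsFrameDomain U ∧ x ∈ U := by
  obtain ⟨U, -, hxU, hU⟩ := F.exists_isFrameDomain (F.isOpen_dom.mem_nhds hx) subset_rfl
  exact ⟨U, hU, hxU⟩

/-! ### Symmetries -/

section Symmetries

variable (F) {x : M} (hx : x ∈ F.dom) (a b c d e : Fin 3)
include hx

theorem connLow_antisymm : F.connLow a b c x = -F.connLow a c b x := by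
  obtain ⟨U, hU, hxU⟩ := F.exists_mem_isFrameDomain hx
  simpa [evalAt_connLow] using
    congrArg (evalAt ⟨x, hxU⟩) ((frameAlgebra hU).connLow_antisymm a b c)

theorem riem_swap_left : F.riem x ![a, b, c, d] = -F.riem x ![b, a, c, d] := by
  obtain ⟨U, hU, hxU⟩ := F.exists_mem_isFrameDomain hx
  simpa [evalAt_riem] using
    congrArg (evalAt ⟨x, hxU⟩) ((frameAlgebra hU).riem_swap_left a b c d)

theorem riem_swap_right : F.riem x ![a, b, c, d] = -F.riem x ![a, b, d, c] := by
  obtain ⟨U, hU, hxU⟩ := F.exists_mem_isFrameDomain hx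
  simpa [evalAt_riem] using
    congrArg (evalAt ⟨x, hxU⟩) ((frameAlgebra hU).riem_swap_right a b c d)

theorem riem_cyclic : F.riem x ![a, b, c, d] + F.riem x ![a, c, d, b]
    + F.riem x ![a, d, b, c] = 0 := by
  obtain ⟨U, hU, hxU⟩ := F.exists_mem_isFrameDomain hx
  simpa [evalAt_riem] using
    congrArg (evalAt ⟨x, hxU⟩) ((frameAlgebra hU).riem_cyclic a b c d)

theorem riemDer_one_cyclic : F.riemDer 1 x ![a, b, c, d, e] + F.riemDer 1 x ![a, b, d, e, c]
    + F.riemDer 1 x ![a, b, e, c, d] = 0 := by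
  obtain ⟨U, hU, hxU⟩ := F.exists_mem_isFrameDomain hx
  have := congrArg (evalAt ⟨x, hxU⟩) ((frameAlgebra hU).covDer_riem_cyclic a b c d e)
  simpa [evalAt_covDer_riem] using this

/-- The octahedron argument: four instances of the first Bianchi identity, combined with the two
antisymmetries. -/
theorem riem_pair_symm : F.riem x ![a, b, c, d] = F.riem x ![c, d, a, b] := by
  have h1 := F.riem_cyclic hx a b c d
  have h2 := F.riem_cyclic hx b c d a
  have h3 := F.riem_cyclic hx c d a b
  have h4 := F.riem_cyclic hx d a b c
  have s1 := F.riem_swap_left hx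
  have s2 := F.riem_swap_right hx
  linarith [s1 b c d a, s2 c b d a, s1 b d a c, s2 d b a c, s1 b a c d, s1 c d a b, s2 c a b d,
    s1 c a b d, s1 c b d a, s2 b c d a, s1 d a b c, s2 d b c a, s1 d b c a, s1 d c a b, s2 a c d b,
    s1 a c d b, s2 a d b c, s1 a d b c, s2 b d a c, s2 d c a b, s2 a b c d, s2 d a b c,
    s2 c d a b, s2 b a c d]

end Symmetries

theorem contMDiffAt_riem (F : NullFrame g) {x : M} (hx : x ∈ F.dom) (i : Fin 4 → Fin 3) :
    ContMDiffAt (𝓡 3) 𝓘(ℝ, ℝ) ∞ (fun y => F.riem y i) x := by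
  obtain ⟨U, hU, hxU⟩ := F.exists_mem_isFrameDomain hx
  have h := (((frameAlgebra hU).riem i).2.contMDiffAt (hU.isOpen.mem_nhds hxU))
  exact h.congr_of_eventuallyEq
    (eventually_extendZero hU.isOpen (fun y => evalAt_riem hU i y) hxU).symm

theorem contMDiffOn_connLow (F : NullFrame g) (a b c : Fin 3) :
    ContMDiffOn (𝓡 3) 𝓘(ℝ, ℝ) ∞ (F.connLow a b c) F.dom := by
  intro x hx
  obtain ⟨U, hU, hxU⟩ := F.exists_mem_isFrameDomain hx
  have h := (((frameAlgebra hU).connLow a b c).2.contMDiffAt (hU.isOpen.mem_nhds hxU))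
  exact (h.congr_of_eventuallyEq
    (eventually_extendZero hU.isOpen (fun y => evalAt_connLow hU a b c y) hxU).symm).contMDiffWithinAt

/-! ### Change of frame -/

/-- The matrix `A` with `e'_a = ∑ b, A b a • e_b`. -/
def transition (F F' : NullFrame g) (x : M) : Matrix (Fin 3) (Fin 3) ℝ :=
  Matrix.of fun k a => ∑ h, etaInv k h * g.inner x (F'.e a x) (F.e h x)

theorem eq_sum_transition (F F' : NullFrame g) {x : M} (hx : x ∈ F.dom) (a : Fin 3) :
    F'.e a x = ∑ k, F.transition F' x k a • F.e k x := F.eq_sum hx _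

theorem transition_eq_of_eq_sum (F F' : NullFrame g) {x : M} (hx : x ∈ F.dom)
    {A : Matrix (Fin 3) (Fin 3) ℝ} (hA : ∀ a, F'.e a x = ∑ k, A k a • F.e k x) :
    F.transition F' x = A := by
  ext k a
  have h1 := (hA a).symm.trans (F.eq_sum_transition F' hx a)
  have h2 := Fintype.linearIndependent_iff.1 (F.linearIndependent hx)
    (fun k => A k a - F.transition F' x k a) (by
      simp only [sub_smul, Finset.sum_sub_distrib, h1, sub_self])
  exact (sub_eq_zero.1 (h2 k)).symm

theorem sum_eta_transition (F F' : NullFrame g) {x : M} (hx : x ∈ F.dom) (hx' : x ∈ F'.dom)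
    (a b : Fin 3) : ∑ j, ∑ k, eta j k * (F.transition F' x j a * F.transition F' x k b) =
      eta a b := by
  rw [← F'.inner_eq x hx' a b, F.eq_sum_transition F' hx a, F.eq_sum_transition F' hx b]
  simp [F.inner_eq x hx, Fin.sum_univ_three]
  ring

theorem transition_mem (F F' : NullFrame g) {x : M} (hx : x ∈ F.dom) (hx' : x ∈ F'.dom) :
    (F.transition F' x)ᵀ * eta * F.transition F' x = eta := by
  ext a b
  rw [← F.sum_eta_transition F' hx hx' a b]
  simp only [Matrix.mul_apply, Matrix.transpose_apply, Fin.sum_univ_three]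
  ring

theorem contMDiffOn_transition (F F' : NullFrame g) (k a : Fin 3) :
    ContMDiffOn (𝓡 3) 𝓘(ℝ, ℝ) ∞ (fun x => F.transition F' x k a) (F.dom ∩ F'.dom) := by
  simp only [transition, Matrix.of_apply]
  have h (h : Fin 3) : ContMDiffOn (𝓡 3) 𝓘(ℝ, ℝ) ∞
      (fun x => etaInv k h * g.inner x (F'.e a x) (F.e h x)) (F.dom ∩ F'.dom) :=
    ContMDiffOn.mul contMDiffOn_const (contMDiffOn_inner
      ((F'.smoothField a).mono Set.inter_subset_right)
      ((F.smoothField h).mono Set.inter_subset_left))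
  simp only [Fin.sum_univ_three]
  exact ContMDiffOn.add (ContMDiffOn.add (h 0) (h 1)) (h 2)

theorem isFrameChange {F F' : NullFrame g} (hU : F.IsFrameDomain U) (hU' : F'.IsFrameDomain U) :
    (frameAlgebra hU).IsFrameChange (frameAlgebra hU') (fun a k =>
      toSmooth ((F.contMDiffOn_transition F' k a).mono
        (Set.subset_inter hU.subset_dom hU'.subset_dom))) where
  d_eq a f := by
    apply Subtype.ext
    funext x
    rw [FrameAlgebra.dir_apply]
    refine (dirDeriv_field_sum (F.eq_sum_transition F' (hU.subset_dom x.2) a)).trans ?_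
    simp only [Fin.sum_univ_three]
    rfl
  metric_eq a b := by
    apply Subtype.ext
    funext x
    refine Eq.trans ?_ (F.sum_eta_transition F' (hU.subset_dom x.2) (hU'.subset_dom x.2) a b)
    simp only [FrameAlgebra.metric, Fin.sum_univ_three]
    rfl

theorem exists_common_isFrameDomain (F F' : NullFrame g) {x : M} (hx : x ∈ F.dom)
    (hx' : x ∈ F'.dom) : ∃ U, F.IsFrameDomain U ∧ F'.IsFrameDomain U ∧ x ∈ U := by
  obtain ⟨U, hsub, hxU, hU⟩ := F.exists_isFrameDomain (s := F.dom ∩ F'.dom)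
    (Filter.inter_mem (F.isOpen_dom.mem_nhds hx) (F'.isOpen_dom.mem_nhds hx'))
    Set.inter_subset_left
  exact ⟨U, hU, ⟨hU.isOpen, fun y hy => (hsub hy).2, hU.subset_chart⟩, hxU⟩

theorem riem_transform (F F' : NullFrame g) {x : M} (hx : x ∈ F.dom) (hx' : x ∈ F'.dom)
    (i : Fin 4 → Fin 3) :
    F'.riem x i = ∑ b : Fin 4 → Fin 3, (∏ j, F.transition F' x (b j) (i j)) * F.riem x b := by
  obtain ⟨U, hU, hU', hxU⟩ := F.exists_common_isFrameDomain F' hx hx'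
  have h := congrArg (evalAt ⟨x, hxU⟩) ((isFrameChange hU hU').riem_transform i)
  rw [evalAt_riem, map_sum] at h
  simp only [map_mul, evalAt_riem, map_prod] at h
  exact h

theorem riemDer_one_transform (F F' : NullFrame g) {x : M} (hx : x ∈ F.dom) (hx' : x ∈ F'.dom)
    (i : Fin 5 → Fin 3) : F'.riemDer 1 x i =
      ∑ b : Fin 5 → Fin 3, (∏ j, F.transition F' x (b j) (i j)) * F.riemDer 1 x b := by
  obtain ⟨U, hU, hU', hxU⟩ := F.exists_common_isFrameDomain F' hx hx'
  have h := congrArg (evalAt ⟨x, hxU⟩) ((isFrameChange hU hU').covDer_riem_transform i)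
  rw [evalAt_covDer_riem, map_sum] at h
  simp only [map_mul, evalAt_covDer_riem, map_prod] at h
  exact h

end NullFrame

/-! ### The action on tensors -/

/-- Substitution of the columns of `A` for the basis vectors. -/
def tensorSub {k : ℕ} (A : Matrix (Fin 3) (Fin 3) ℝ) (T : Tensor k) : Tensor k := fun a =>
  ∑ b : Fin k → Fin 3, (∏ i, A (b i) (a i)) * T b

theorem tensorAct_eq_tensorSub {k : ℕ} (X : GL (Fin 3) ℝ) (T : Tensor k) :
    tensorAct X T = tensorSub ((X⁻¹ : GL (Fin 3) ℝ) : Matrix (Fin 3) (Fin 3) ℝ) T := rfl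

theorem tensorSub_tensorSub {k : ℕ} (A B : Matrix (Fin 3) (Fin 3) ℝ) (T : Tensor k) :
    tensorSub B (tensorSub A T) = tensorSub (A * B) T := by
  funext a
  have h (c : Fin k → Fin 3) : ∏ i, (A * B) (c i) (a i) =
      ∑ b : Fin k → Fin 3, (∏ i, A (c i) (b i)) * ∏ i, B (b i) (a i) := by
    simp only [Matrix.mul_apply]
    rw [Finset.prod_univ_sum, Fintype.piFinset_univ]
    simp only [Finset.prod_mul_distrib]
  simp only [tensorSub, h, Finset.sum_mul, Finset.mul_sum]
  rw [Finset.sum_comm]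
  refine Finset.sum_congr rfl fun c _ => Finset.sum_congr rfl fun b _ => ?_
  ring

theorem tensorSub_one {k : ℕ} (T : Tensor k) : tensorSub 1 T = T := by
  funext a
  rw [tensorSub, Finset.sum_eq_single a]
  · simp
  · intro b _ hb
    obtain ⟨i, hi⟩ := Function.ne_iff.1 hb
    have hz : (1 : Matrix (Fin 3) (Fin 3) ℝ) (b i) (a i) = 0 := Matrix.one_apply_ne hi
    rw [Finset.prod_eq_zero (Finset.mem_univ i) hz, zero_mul]
  · simp

theorem tensorAct_mul {k : ℕ} (X Y : GL (Fin 3) ℝ) (T : Tensor k) :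
    tensorAct (X * Y) T = tensorAct X (tensorAct Y T) := by
  simp only [tensorAct_eq_tensorSub, tensorSub_tensorSub, mul_inv_rev, Units.val_mul]

theorem tensorInfAct_add {k : ℕ} (A B : Matrix (Fin 3) (Fin 3) ℝ) (T : Tensor k) :
    tensorInfAct (A + B) T = tensorInfAct A T + tensorInfAct B T := by
  funext a
  simp only [tensorInfAct, Matrix.add_apply, add_mul, Finset.sum_add_distrib, neg_add,
    Pi.add_apply]

theorem tensorInfAct_smul {k : ℕ} (c : ℝ) (A : Matrix (Fin 3) (Fin 3) ℝ) (T : Tensor k) :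
    tensorInfAct (c • A) T = c • tensorInfAct A T := by
  funext a
  simp only [tensorInfAct, Matrix.smul_apply, smul_eq_mul, mul_assoc, ← Finset.mul_sum,
    Pi.smul_apply, mul_neg]

/-- The infinitesimal action as a linear map in the Lie algebra element. -/
def infActLin {p : ℕ} (T : CurvSpace p) : Matrix (Fin 3) (Fin 3) ℝ →ₗ[ℝ] CurvSpace p where
  toFun A := infAct A T
  map_add' A B := funext fun _ => tensorInfAct_add A B _
  map_smul' c A := funext fun _ => tensorInfAct_smul c A _

/-- With the identity matrix in every slot but `i`, only multi-indices that agree with `a` off `i`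
survive. -/
theorem sum_prod_erase {k : ℕ} (A : Matrix (Fin 3) (Fin 3) ℝ) (T : Tensor k) (a : Fin k → Fin 3)
    (i : Fin k) :
    ∑ b : Fin k → Fin 3, ((∏ j ∈ Finset.univ.erase i, (1 : Matrix (Fin 3) (Fin 3) ℝ) (b j) (a j))
      * A (b i) (a i)) * T b = ∑ c, A c (a i) * T (Function.update a i c) := by
  symm
  refine Fintype.sum_of_injective (fun c => Function.update a i c)
    (Function.update_injective a i) _ _ (fun b hb => ?_) (fun c => ?_)
  · have : ∃ j ∈ Finset.univ.erase i, b j ≠ a j := by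
      by_contra! hcon
      refine hb ⟨b i, ?_⟩
      funext j
      by_cases hj : j = i
      · subst hj; simp
      · exact (Function.update_of_ne hj _ _).trans (hcon j (by simp [hj])).symm
    obtain ⟨j, hj, hne⟩ := this
    have hz : (1 : Matrix (Fin 3) (Fin 3) ℝ) (b j) (a j) = 0 := Matrix.one_apply_ne hne
    rw [Finset.prod_eq_zero hj hz, zero_mul, zero_mul]
  · rw [Finset.prod_eq_one, one_mul, Function.update_self]
    intro j hj
    rw [Function.update_of_ne (Finset.ne_of_mem_erase hj), Matrix.one_apply_eq]

theorem hasDerivAt_exp_apply (A : Matrix (Fin 3) (Fin 3) ℝ) (i j : Fin 3) :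
    HasDerivAt (fun t : ℝ => (NormedSpace.exp (t • A)) i j) (A i j) 0 := by
  let _ : SeminormedRing (Matrix (Fin 3) (Fin 3) ℝ) := Matrix.linftyOpSemiNormedRing
  let _ : NormedRing (Matrix (Fin 3) (Fin 3) ℝ) := Matrix.linftyOpNormedRing
  let _ : NormedAlgebra ℝ (Matrix (Fin 3) (Fin 3) ℝ) := Matrix.linftyOpNormedAlgebra
  have h := hasDerivAt_exp_smul_const (𝕂 := ℝ) A (0 : ℝ)
  rw [zero_smul, NormedSpace.exp_zero, one_mul] at h
  let L : Matrix (Fin 3) (Fin 3) ℝ →L[ℝ] ℝ :=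
    { toFun := fun B => B i j
      map_add' := fun _ _ => rfl
      map_smul' := fun _ _ => rfl
      cont := (continuous_apply j).comp (continuous_apply i) }
  exact L.hasFDerivAt.comp_hasDerivAt (0 : ℝ) h

/-- The sign is negative because `tensorSub` substitutes the matrix itself, whereas the action uses
the inverse. -/
theorem hasDerivAt_tensorSub_exp {k : ℕ} (A : Matrix (Fin 3) (Fin 3) ℝ) (T : Tensor k)
    (a : Fin k → Fin 3) :
    HasDerivAt (fun t : ℝ => tensorSub (NormedSpace.exp (t • A)) T a) (-tensorInfAct A T a) 0 := by
  have h1 (b : Fin k → Fin 3) : HasDerivAt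
      (fun t : ℝ => (∏ i, (NormedSpace.exp (t • A)) (b i) (a i)) * T b)
      ((∑ i, (∏ j ∈ Finset.univ.erase i, (1 : Matrix (Fin 3) (Fin 3) ℝ) (b j) (a j))
        * A (b i) (a i)) * T b) 0 := by
    have h := (HasDerivAt.fun_finsetProd (u := Finset.univ) (x := (0 : ℝ))
      (f := fun i (t : ℝ) => (NormedSpace.exp (t • A)) (b i) (a i))
      (f' := fun i => A (b i) (a i)) (fun i _ => hasDerivAt_exp_apply A (b i) (a i))).mul_const (T b)
    simpa [NormedSpace.exp_zero] using h
  have h2 := HasDerivAt.fun_sum (u := Finset.univ) (fun b _ => h1 b)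
  refine h2.congr_deriv ?_
  simp only [tensorInfAct, neg_neg, Finset.sum_mul]
  rw [Finset.sum_comm]
  exact Finset.sum_congr rfl fun i _ => sum_prod_erase A T a i

theorem exp_add_smul (A : Matrix (Fin 3) (Fin 3) ℝ) (s t : ℝ) :
    NormedSpace.exp ((s + t) • A) = NormedSpace.exp (s • A) * NormedSpace.exp (t • A) := by
  rw [add_smul]
  exact Matrix.exp_add_of_commute _ _ ((Commute.refl A).smul_left s |>.smul_right t)

/-- The one-parameter group generated by `A`. -/
def expGL (A : Matrix (Fin 3) (Fin 3) ℝ) (t : ℝ) : GL (Fin 3) ℝ where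
  val := NormedSpace.exp (t • A)
  inv := NormedSpace.exp ((-t) • A)
  val_inv := by rw [← exp_add_smul, add_neg_cancel, zero_smul, NormedSpace.exp_zero]
  inv_val := by rw [← exp_add_smul, neg_add_cancel, zero_smul, NormedSpace.exp_zero]

theorem expGL_inv_val (A : Matrix (Fin 3) (Fin 3) ℝ) (t : ℝ) :
    ((expGL A t)⁻¹ : GL (Fin 3) ℝ).val = NormedSpace.exp ((-t) • A) := rfl

theorem eq_expGL {A : Matrix (Fin 3) (Fin 3) ℝ} {t : ℝ} {X : GL (Fin 3) ℝ}
    (hX : (X : Matrix (Fin 3) (Fin 3) ℝ) = NormedSpace.exp (t • A)) : X = expGL A t :=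
  Units.ext hX

theorem tensorInfAct_eq_zero_of_fixed {k : ℕ} {A : Matrix (Fin 3) (Fin 3) ℝ} {T : Tensor k}
    (h : ∀ t, tensorAct (expGL A t) T = T) : tensorInfAct A T = 0 := by
  funext a
  have h1 := hasDerivAt_tensorSub_exp A T a
  have h2 : (fun t : ℝ => tensorSub (NormedSpace.exp (t • A)) T a) = fun _ => T a := by
    funext t
    have := congrFun (h (-t)) a
    rwa [tensorAct_eq_tensorSub, expGL_inv_val, neg_neg] at this
  rw [h2] at h1
  have := h1.unique (hasDerivAt_const _ _)
  simpa using this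

/-- By the group law the derivative at time s is the image under exp(sA) of the derivative at time
0, which vanishes; so the orbit is a point. -/
theorem tensorAct_expGL_of_infAct_eq_zero {k : ℕ} {A : Matrix (Fin 3) (Fin 3) ℝ} {T : Tensor k}
    (h : tensorInfAct A T = 0) (t : ℝ) : tensorAct (expGL A t) T = T := by
  have h0 (b : Fin k → Fin 3) :
      HasDerivAt (fun s : ℝ => tensorSub (NormedSpace.exp (s • A)) T b) 0 0 := by
    simpa [h] using hasDerivAt_tensorSub_exp A T b
  have h1 (a : Fin k → Fin 3) (s : ℝ) :
      HasDerivAt (fun s : ℝ => tensorSub (NormedSpace.exp (s • A)) T a) 0 s := by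
    have h2 : HasDerivAt (fun r : ℝ => tensorSub (NormedSpace.exp (s • A))
        (tensorSub (NormedSpace.exp (r • A)) T) a) 0 0 := by
      have := HasDerivAt.fun_sum (u := Finset.univ) (x := (0 : ℝ)) (fun b _ =>
        (h0 b).const_mul (∏ i, (NormedSpace.exp (s • A)) (b i) (a i)))
      simpa [tensorSub] using this
    have h3 : (fun r : ℝ => tensorSub (NormedSpace.exp (s • A))
        (tensorSub (NormedSpace.exp (r • A)) T) a) =
        fun r => tensorSub (NormedSpace.exp ((r + s) • A)) T a := by
      funext r
      rw [tensorSub_tensorSub, ← exp_add_smul]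
    rw [h3] at h2
    have h4 := HasDerivAt.comp_sub_const s s (f := fun r : ℝ =>
      tensorSub (NormedSpace.exp ((r + s) • A)) T a) (by rwa [sub_self])
    simpa using h4
  funext a
  have h5 := is_const_of_deriv_eq_zero (fun s => (h1 a s).differentiableAt)
    (fun s => (h1 a s).deriv) (-t) 0
  rw [tensorAct_eq_tensorSub, expGL_inv_val, h5, zero_smul, NormedSpace.exp_zero, tensorSub_one]

/-! ### Subgroups of `O(η)` and their Lie algebras -/

theorem expGL_conj (A : Matrix (Fin 3) (Fin 3) ℝ) (Z : GL (Fin 3) ℝ) (t : ℝ) :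
    expGL ((Z : Matrix (Fin 3) (Fin 3) ℝ) * A * ((Z⁻¹ : GL (Fin 3) ℝ) : Matrix _ _ ℝ)) t =
      Z * expGL A t * Z⁻¹ := by
  apply Units.ext
  have h := Matrix.exp_units_conj Z (t • A)
  simp only [Units.val_mul]
  change NormedSpace.exp _ = (Z : Matrix (Fin 3) (Fin 3) ℝ) * NormedSpace.exp (t • A) * _
  rw [← h]
  congr 1
  simp

theorem skew_of_expGL_mem {A : Matrix (Fin 3) (Fin 3) ℝ} (h : ∀ t, expGL A t ∈ orthGroup) :
    Aᵀ * eta + eta * A = 0 := by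
  have h1 (i j : Fin 3) : HasDerivAt (fun t : ℝ =>
      ∑ k, ∑ l, (NormedSpace.exp (t • A)) k i * eta k l * (NormedSpace.exp (t • A)) l j)
      (∑ k, ∑ l, (A k i * eta k l * (1 : Matrix (Fin 3) (Fin 3) ℝ) l j
        + (1 : Matrix (Fin 3) (Fin 3) ℝ) k i * eta k l * A l j)) 0 := by
    refine HasDerivAt.fun_sum fun k _ => HasDerivAt.fun_sum fun l _ => ?_
    have := ((hasDerivAt_exp_apply A k i).mul_const (eta k l)).mul (hasDerivAt_exp_apply A l j)
    simpa [NormedSpace.exp_zero] using! this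
  ext i j
  have h2 : (fun t : ℝ =>
      ∑ k, ∑ l, (NormedSpace.exp (t • A)) k i * eta k l * (NormedSpace.exp (t • A)) l j) =
      fun _ => eta i j := by
    funext t
    have h3 : (NormedSpace.exp (t • A))ᵀ * eta * NormedSpace.exp (t • A) = eta := h t
    rw [← congrFun (congrFun h3 i) j]
    simp only [Matrix.mul_apply, Matrix.transpose_apply, Finset.sum_mul]
    rw [Finset.sum_comm]
  have h4 := h1 i j
  rw [h2] at h4
  have h5 := h4.unique (hasDerivAt_const _ _)
  simp only [Finset.sum_add_distrib, Matrix.one_apply, mul_ite, mul_one, mul_zero, ite_mul, one_mul,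
    zero_mul, Finset.sum_ite_eq', Finset.mem_univ, if_true] at h5
  simp only [Matrix.add_apply, Matrix.mul_apply, Matrix.transpose_apply, Matrix.zero_apply]
  rw [← h5]
  congr 1
  rw [Finset.sum_comm]
  refine Finset.sum_congr rfl fun l _ => ?_
  simp

/-- Skewness says Aᵀ = η(-A)η⁻¹, and the exponential commutes with transposition and conjugation. -/
theorem expGL_mem_of_skew {A : Matrix (Fin 3) (Fin 3) ℝ} (h : Aᵀ * eta + eta * A = 0) (t : ℝ) :
    expGL A t ∈ orthGroup := by
  change (NormedSpace.exp (t • A))ᵀ * eta * NormedSpace.exp (t • A) = eta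
  let H : (Matrix (Fin 3) (Fin 3) ℝ)ˣ := ⟨eta, etaInv, eta_mul_etaInv, mul_eq_one_comm.1 eta_mul_etaInv⟩
  have h1 : (t • A)ᵀ = (H : Matrix (Fin 3) (Fin 3) ℝ) * ((-t) • A) * ((H⁻¹ : _ˣ) : Matrix _ _ ℝ) := by
    change (t • A)ᵀ = eta * ((-t) • A) * etaInv
    have h2 : Aᵀ * eta = -(eta * A) := eq_neg_of_add_eq_zero_left h
    have h3 : Aᵀ = -(eta * A) * etaInv := by
      rw [← h2, Matrix.mul_assoc, eta_mul_etaInv, Matrix.mul_one]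
    rw [Matrix.transpose_smul, h3]
    simp
  rw [← Matrix.exp_transpose, h1, Matrix.exp_units_conj]
  change eta * NormedSpace.exp ((-t) • A) * etaInv * eta * NormedSpace.exp (t • A) = eta
  rw [Matrix.mul_assoc _ etaInv, mul_eq_one_comm.1 eta_mul_etaInv, Matrix.mul_one,
    Matrix.mul_assoc, ← exp_add_smul, neg_add_cancel, zero_smul, NormedSpace.exp_zero,
    Matrix.mul_one]

theorem mem_lieAlg_of_expGL_mem {G : Subgroup (GL (Fin 3) ℝ)} {A : Matrix (Fin 3) (Fin 3) ℝ}
    (h : ∀ t, expGL A t ∈ G) : A ∈ lieAlg G :=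
  Submodule.subset_span fun t => ⟨expGL A t, h t, rfl⟩

theorem lieAlg_le {G : Subgroup (GL (Fin 3) ℝ)} {L : Submodule ℝ (Matrix (Fin 3) (Fin 3) ℝ)}
    (h : ∀ A, (∀ t, expGL A t ∈ G) → A ∈ L) : lieAlg G ≤ L := by
  refine Submodule.span_le.2 fun A hA => h A fun t => ?_
  obtain ⟨X, hX, hXA⟩ := hA t
  rwa [← eq_expGL hXA]

theorem exists_generator_of_groupDim_pos {G : Subgroup (GL (Fin 3) ℝ)} (h : 0 < groupDim G) :
    ∃ A ≠ 0, ∀ t, expGL A t ∈ G := by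
  by_contra! hcon
  have : lieAlg G = ⊥ := le_bot_iff.1 (lieAlg_le fun A hA => by
    by_contra hne
    obtain ⟨t, ht⟩ := hcon A hne
    exact ht (hA t))
  rw [groupDim, this, finrank_bot] at h
  exact lt_irrefl _ h

theorem skew_of_mem_lieAlg {A : Matrix (Fin 3) (Fin 3) ℝ} (hA : A ∈ lieAlg orthGroup) :
    Aᵀ * eta + eta * A = 0 := by
  let L : Submodule ℝ (Matrix (Fin 3) (Fin 3) ℝ) :=
    { carrier := {A | Aᵀ * eta + eta * A = 0}
      add_mem' := fun {A B} hA hB => by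
        change (A + B)ᵀ * eta + eta * (A + B) = 0
        rw [Matrix.transpose_add, Matrix.add_mul, Matrix.mul_add, add_add_add_comm]
        change Aᵀ * eta + eta * A = 0 at hA
        change Bᵀ * eta + eta * B = 0 at hB
        rw [hA, hB, add_zero]
      zero_mem' := by simp
      smul_mem' := fun c A hA => by
        change (c • A)ᵀ * eta + eta * (c • A) = 0
        change Aᵀ * eta + eta * A = 0 at hA
        rw [Matrix.transpose_smul, Matrix.smul_mul, Matrix.mul_smul, ← smul_add, hA, smul_zero] }
  exact (lieAlg_le (L := L) fun A hA => skew_of_expGL_mem hA) hA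

/-! ### Curvature tensors in dimension three -/

/-- The Kulkarni–Nomizu product. -/
def kn (P Q : Matrix (Fin 3) (Fin 3) ℝ) (a b c d : Fin 3) : ℝ :=
  P a c * Q b d + P b d * Q a c - P a d * Q b c - P b c * Q a d

/-- The curvature tensor with Schouten tensor `P`. -/
def ofSchouten (P : Matrix (Fin 3) (Fin 3) ℝ) : Tensor 4 := fun i =>
  kn eta P (i 0) (i 1) (i 2) (i 3)

theorem ofSchouten_apply (P : Matrix (Fin 3) (Fin 3) ℝ) (a b c d : Fin 3) :
    ofSchouten P ![a, b, c, d] = kn eta P a b c d := rfl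

/-- Six curvature components give a triangular linear system for the six entries of a symmetric
matrix. -/
theorem ofSchouten_injective {P Q : Matrix (Fin 3) (Fin 3) ℝ} (hP : P.IsSymm) (hQ : Q.IsSymm)
    (h : ofSchouten P = ofSchouten Q) : P = Q := by
  have h1 (a b c d : Fin 3) : kn eta P a b c d = kn eta Q a b c d := congrFun h ![a, b, c, d]
  have s1 := hP.apply
  have s2 := hQ.apply
  have e00 := h1 0 1 0 1
  have e22 := h1 1 2 1 2
  have e02 := h1 0 2 0 2
  have e01 := h1 0 2 0 1
  have e12 := h1 1 2 0 2
  have e11 := h1 0 1 1 2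
  simp [kn, eta] at e00 e22 e02 e01 e12 e11
  have p20 := s1 0 2
  have p10 := s1 0 1
  have p21 := s1 1 2
  have q20 := s2 0 2
  have q10 := s2 0 1
  have q21 := s2 1 2
  ext i j
  fin_cases i <;> fin_cases j <;> simp <;> linarith

theorem antisymm_ext {f g : Fin 3 → Fin 3 → ℝ} (hf : ∀ a b, f a b = -f b a)
    (hg : ∀ a b, g a b = -g b a) (h01 : f 0 1 = g 0 1) (h02 : f 0 2 = g 0 2)
    (h12 : f 1 2 = g 1 2) (a b : Fin 3) : f a b = g a b := by
  have f1 := hf 0 0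
  have f2 := hf 1 1
  have f3 := hf 2 2
  have f4 := hf 1 0
  have f5 := hf 2 0
  have f6 := hf 2 1
  have g1 := hg 0 0
  have g2 := hg 1 1
  have g3 := hg 2 2
  have g4 := hg 1 0
  have g5 := hg 2 0
  have g6 := hg 2 1
  fin_cases a <;> fin_cases b <;> simp <;> linarith

theorem sum_fin_succ {n : ℕ} (f : (Fin (n + 1) → Fin 3) → ℝ) :
    ∑ b, f b = ∑ a, ∑ b : Fin n → Fin 3, f (Fin.cons a b) := by
  rw [← (Fin.consEquiv (fun _ : Fin (n + 1) => Fin 3)).sum_comp, Fintype.sum_prod_type]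
  rfl

theorem sum_fin_four (f : (Fin 4 → Fin 3) → ℝ) :
    ∑ b, f b = ∑ p, ∑ q, ∑ r, ∑ s, f ![p, q, r, s] := by
  simp only [sum_fin_succ]
  refine Finset.sum_congr rfl fun p _ => Finset.sum_congr rfl fun q _ =>
    Finset.sum_congr rfl fun r _ => Finset.sum_congr rfl fun s _ => ?_
  rw [Fintype.sum_unique]
  congr 1

theorem tensorSub_four (A : Matrix (Fin 3) (Fin 3) ℝ) (T : Tensor 4) (i : Fin 4 → Fin 3) :
    tensorSub A T i = ∑ p, ∑ q, ∑ r, ∑ s,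
      A p (i 0) * A q (i 1) * A r (i 2) * A s (i 3) * T ![p, q, r, s] := by
  rw [tensorSub, sum_fin_four]
  simp only [Fin.prod_univ_four]
  rfl

theorem tensorSub_ofSchouten {A : Matrix (Fin 3) (Fin 3) ℝ} (hA : Aᵀ * eta * A = eta)
    (P : Matrix (Fin 3) (Fin 3) ℝ) :
    tensorSub A (ofSchouten P) = ofSchouten (Aᵀ * P * A) := by
  have hη (a b : Fin 3) : eta a b = ∑ k, (∑ l, A l a * eta l k) * A k b := by
    conv_lhs => rw [← hA]
    simp only [Matrix.mul_apply, Matrix.transpose_apply]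
  have hP (a b : Fin 3) : (Aᵀ * P * A) a b = ∑ k, (∑ l, A l a * P l k) * A k b := by
    simp only [Matrix.mul_apply, Matrix.transpose_apply]
  have key (X Y : Matrix (Fin 3) (Fin 3) ℝ) (a b c d : Fin 3) :
      ∑ p, ∑ q, ∑ r, ∑ s, A p a * A q b * A r c * A s d * (X p r * Y q s) =
      (∑ k, (∑ l, A l a * X l k) * A k c) * (∑ k, (∑ l, A l b * Y l k) * A k d) := by
    simp only [Fin.sum_univ_three]
    ring
  have key' (X Y : Matrix (Fin 3) (Fin 3) ℝ) (a b c d : Fin 3) :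
      ∑ p, ∑ q, ∑ r, ∑ s, A p a * A q b * A r c * A s d * (X p s * Y q r) =
      (∑ k, (∑ l, A l a * X l k) * A k d) * (∑ k, (∑ l, A l b * Y l k) * A k c) := by
    simp only [Fin.sum_univ_three]
    ring
  funext i
  rw [tensorSub_four]
  simp only [ofSchouten_apply]
  simp only [ofSchouten, kn]
  calc _ = (∑ p, ∑ q, ∑ r, ∑ s, A p (i 0) * A q (i 1) * A r (i 2) * A s (i 3)
              * (eta p r * P q s))
          + (∑ p, ∑ q, ∑ r, ∑ s, A p (i 0) * A q (i 1) * A r (i 2) * A s (i 3)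
              * (P p r * eta q s))
          - (∑ p, ∑ q, ∑ r, ∑ s, A p (i 0) * A q (i 1) * A r (i 2) * A s (i 3)
              * (eta p s * P q r))
          - (∑ p, ∑ q, ∑ r, ∑ s, A p (i 0) * A q (i 1) * A r (i 2) * A s (i 3)
              * (P p s * eta q r)) := by
        simp only [← Finset.sum_add_distrib, ← Finset.sum_sub_distrib]
        refine Finset.sum_congr rfl fun p _ => Finset.sum_congr rfl fun q _ =>
          Finset.sum_congr rfl fun r _ => Finset.sum_congr rfl fun s _ => ?_
        ring
    _ = _ := by
        rw [key, key, key', key', ← hη, ← hη, ← hη, ← hη, ← hP, ← hP, ← hP, ← hP]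
        ring

theorem tensorInfAct_four (A : Matrix (Fin 3) (Fin 3) ℝ) (T : Tensor 4) (a b c d : Fin 3) :
    tensorInfAct A T ![a, b, c, d] = -∑ k, (A k a * T ![k, b, c, d] + A k b * T ![a, k, c, d]
      + A k c * T ![a, b, k, d] + A k d * T ![a, b, c, k]) := by
  rw [tensorInfAct, Finset.sum_comm]
  congr 1
  refine Finset.sum_congr rfl fun k _ => ?_
  have h0 : Function.update ![a, b, c, d] 0 k = ![k, b, c, d] := by ext i; fin_cases i <;> rfl
  have h1 : Function.update ![a, b, c, d] 1 k = ![a, k, c, d] := by ext i; fin_cases i <;> rfl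
  have h2 : Function.update ![a, b, c, d] 2 k = ![a, b, k, d] := by ext i; fin_cases i <;> rfl
  have h3 : Function.update ![a, b, c, d] 3 k = ![a, b, c, k] := by ext i; fin_cases i <;> rfl
  rw [Fin.sum_univ_four, h0, h1, h2, h3]
  rfl

theorem eq_vec_four (i : Fin 4 → Fin 3) : i = ![i 0, i 1, i 2, i 3] := by
  ext j; fin_cases j <;> rfl

theorem tensorInfAct_ofSchouten {A : Matrix (Fin 3) (Fin 3) ℝ} (hA : Aᵀ * eta + eta * A = 0)
    (P : Matrix (Fin 3) (Fin 3) ℝ) :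
    tensorInfAct A (ofSchouten P) = -ofSchouten (Aᵀ * P + P * A) := by
  have hη (a b : Fin 3) : (∑ k, A k a * eta k b) + ∑ k, eta a k * A k b = 0 := by
    have := congrFun (congrFun hA a) b
    simp only [Matrix.add_apply, Matrix.mul_apply, Matrix.transpose_apply] at this
    exact this
  have hP (a b : Fin 3) : (Aᵀ * P + P * A) a b = (∑ k, A k a * P k b) + ∑ k, P a k * A k b := by
    simp only [Matrix.add_apply, Matrix.mul_apply, Matrix.transpose_apply]
  funext i
  rw [eq_vec_four i, tensorInfAct_four]
  generalize i 0 = a, i 1 = b, i 2 = c, i 3 = d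
  simp only [Pi.neg_apply, ofSchouten_apply]
  simp only [kn, hP]
  have e1 := hη a c
  have e2 := hη b d
  have e3 := hη a d
  have e4 := hη b c
  simp only [Fin.sum_univ_three] at *
  linear_combination (-P b d) * e1 - P a c * e2 + P b c * e3 + P a d * e4

/-- The Schouten tensor of type DZ in canonical form. -/
def canonicalSchouten (ψ r : ℝ) : Matrix (Fin 3) (Fin 3) ℝ :=
  !![3 * ψ, 0, ψ - r / 12; 0, ψ + r / 24, 0; ψ - r / 12, 0, 3 * ψ]

/-- The generator of the isotropy group of the canonical form. -/
def isoGen : Matrix (Fin 3) (Fin 3) ℝ := !![0, 1, 0; -2, 0, 2; 0, -1, 0]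

theorem isoGen_skew : isoGenᵀ * eta + eta * isoGen = 0 := by
  ext i j
  fin_cases i <;> fin_cases j <;> simp [isoGen, eta, Matrix.mul_apply, Fin.sum_univ_three]

/-- The general element of the Lie algebra of `O(η)`. -/
def skewMatrix (w₁ w₂ w₃ : ℝ) : Matrix (Fin 3) (Fin 3) ℝ :=
  !![w₂, w₃, 0; -2 * w₁, 0, 2 * w₃; 0, -w₁, -w₂]

theorem skewMatrix_skew (w₁ w₂ w₃ : ℝ) :
    (skewMatrix w₁ w₂ w₃)ᵀ * eta + eta * skewMatrix w₁ w₂ w₃ = 0 := by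
  ext i j
  fin_cases i <;> fin_cases j <;>
    simp [skewMatrix, eta, Matrix.mul_apply, Fin.sum_univ_three] <;> ring

theorem isoGen_eq : isoGen = skewMatrix 1 0 1 := by
  ext i j
  fin_cases i <;> fin_cases j <;> simp [isoGen, skewMatrix]

theorem eq_skewMatrix {A : Matrix (Fin 3) (Fin 3) ℝ} (hA : Aᵀ * eta + eta * A = 0) :
    A = skewMatrix (-A 2 1) (A 0 0) (A 0 1) := by
  have h (i j : Fin 3) : (Aᵀ * eta + eta * A) i j = 0 := by rw [hA]; rfl
  simp only [Matrix.add_apply, Matrix.mul_apply, Matrix.transpose_apply,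
    Fin.sum_univ_three] at h
  have h00 := h 0 0
  have h01 := h 0 1
  have h02 := h 0 2
  have h11 := h 1 1
  have h12 := h 1 2
  have h22 := h 2 2
  simp [eta] at h00 h01 h02 h11 h12 h22
  ext i j
  fin_cases i <;> fin_cases j <;> simp [skewMatrix] <;> linarith

/-- The canonical form is 3ψ u♭⊗u♭ plus a multiple of η, with u = e₀ + e₂. The η part is invariant,
so the result depends only on the image of u, namely (w₂, 2(w₃ - w₁), -w₂). -/
theorem skewMatrix_canonical (w₁ w₂ w₃ ψ r : ℝ) :
    (skewMatrix w₁ w₂ w₃)ᵀ * canonicalSchouten ψ r + canonicalSchouten ψ r * skewMatrix w₁ w₂ w₃ =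
      !![6 * ψ * w₂, 3 * ψ * (w₃ - w₁), 0; 3 * ψ * (w₃ - w₁), 0, 3 * ψ * (w₃ - w₁);
        0, 3 * ψ * (w₃ - w₁), -6 * ψ * w₂] := by
  ext i j
  fin_cases i <;> fin_cases j <;>
    simp [skewMatrix, canonicalSchouten, Matrix.mul_apply, Fin.sum_univ_three] <;> ring

theorem tensorInfAct_isoGen_canonical (ψ r : ℝ) :
    tensorInfAct isoGen (ofSchouten (canonicalSchouten ψ r)) = 0 := by
  have z : (skewMatrix 1 0 1)ᵀ * canonicalSchouten ψ r +
      canonicalSchouten ψ r * skewMatrix 1 0 1 = 0 := by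
    rw [skewMatrix_canonical]
    ext i j
    fin_cases i <;> fin_cases j <;> simp
  rw [tensorInfAct_ofSchouten isoGen_skew, isoGen_eq, z]
  funext i
  simp [ofSchouten, kn]

/-- The stabilizer of the canonical form is spanned by one generator. -/
theorem eq_smul_isoGen {A : Matrix (Fin 3) (Fin 3) ℝ} (hA : Aᵀ * eta + eta * A = 0) {ψ r : ℝ}
    (hψ : ψ ≠ 0) (h : tensorInfAct A (ofSchouten (canonicalSchouten ψ r)) = 0) :
    A = A 0 1 • isoGen := by
  rw [tensorInfAct_ofSchouten hA, eq_skewMatrix hA, skewMatrix_canonical] at h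
  have e00 := congrFun h ![0, 1, 0, 1]
  have e01 := congrFun h ![0, 2, 0, 1]
  simp [ofSchouten, kn, eta] at e00 e01
  have h1 : A 0 0 = 0 := by simpa [hψ] using e00
  have h2 : A 0 1 = -A 2 1 := by
    have : A 0 1 + A 2 1 = 0 := by simpa [hψ] using e01
    linarith
  rw [eq_skewMatrix hA]
  ext i j
  fin_cases i <;> fin_cases j <;> simp [skewMatrix, isoGen, h1, ← h2] <;> linarith

/-- The parameters of the canonical form are invariants. -/
theorem canonicalSchouten_inj {A : Matrix (Fin 3) (Fin 3) ℝ} (hA : Aᵀ * eta * A = eta)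
    {ψ r ψ' r' : ℝ}
    (h : canonicalSchouten ψ' r' = Aᵀ * canonicalSchouten ψ r * A) : ψ' = ψ ∧ r' = r := by
  have he : etaInv * eta = 1 := mul_eq_one_comm.1 eta_mul_etaInv
  have hBA : etaInv * Aᵀ * eta * A = 1 := by
    rw [← he]
    conv_rhs => rw [← hA]
    simp only [Matrix.mul_assoc]
  have hAB : A * (etaInv * Aᵀ * eta) = 1 := mul_eq_one_comm.1 hBA
  set B := etaInv * Aᵀ * eta with hB
  have hE : etaInv * canonicalSchouten ψ' r' = B * (etaInv * canonicalSchouten ψ r) * A := by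
    rw [h, hB]
    calc etaInv * (Aᵀ * canonicalSchouten ψ r * A)
        = etaInv * Aᵀ * 1 * canonicalSchouten ψ r * A := by
          simp only [Matrix.mul_assoc, Matrix.one_mul]
      _ = _ := by rw [← eta_mul_etaInv]; simp only [Matrix.mul_assoc]
  have N (ψ r : ℝ) : etaInv * canonicalSchouten ψ r = (r / 12) • (1 : Matrix (Fin 3) (Fin 3) ℝ)
      + !![-ψ, 0, -3 * ψ; 0, 2 * ψ, 0; -3 * ψ, 0, -ψ] := by
    ext i j
    fin_cases i <;> fin_cases j <;>
      simp [etaInv, canonicalSchouten, Matrix.mul_apply, Fin.sum_univ_three] <;> ring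
  have htr : r' = r := by
    have := congrArg Matrix.trace hE
    rw [Matrix.trace_mul_comm (B * _) A, ← Matrix.mul_assoc, hAB, Matrix.one_mul, N, N] at this
    simp [Matrix.trace, Fin.sum_univ_three] at this
    linarith
  subst htr
  have hN : (!![-ψ', 0, -3 * ψ'; 0, 2 * ψ', 0; -3 * ψ', 0, -ψ'] : Matrix (Fin 3) (Fin 3) ℝ) =
      B * !![-ψ, 0, -3 * ψ; 0, 2 * ψ, 0; -3 * ψ, 0, -ψ] * A := by
    rw [N, N, Matrix.mul_add, Matrix.add_mul, Matrix.mul_smul, Matrix.smul_mul, Matrix.mul_one,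
      hBA] at hE
    exact add_left_cancel hE
  have cube (X : Matrix (Fin 3) (Fin 3) ℝ) :
      ((B * X * A) * (B * X * A) * (B * X * A)).trace = (X * X * X).trace := by
    have : (B * X * A) * (B * X * A) * (B * X * A) = B * (X * (A * B) * X * (A * B) * X) * A := by
      simp only [Matrix.mul_assoc]
    rw [this, hAB, Matrix.trace_mul_comm, ← Matrix.mul_assoc, hAB]
    simp only [Matrix.mul_one, Matrix.one_mul]
  -- The trace-free part has eigenvalues 2ψ, 2ψ, -4ψ. The trace of its square would lose the sign of
  -- ψ; that of its cube, -48ψ³, does not.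
  have h3 : ψ' ^ 3 = ψ ^ 3 := by
    have := cube !![-ψ, 0, -3 * ψ; 0, 2 * ψ, 0; -3 * ψ, 0, -ψ]
    rw [← hN] at this
    simp [Matrix.trace, Fin.sum_univ_three] at this
    linarith
  exact ⟨(Odd.strictMono_pow (by decide : Odd 3)).injective h3, rfl⟩

/-! ### The Schouten tensor of a null frame. -/

section Manifold

variable {M : Type*} [TopologicalSpace M] [ChartedSpace (EuclideanSpace ℝ (Fin 3)) M]
  [IsManifold (𝓡 3) ∞ M]

namespace NullFrame

variable {g : LorentzMetric M} (F : NullFrame g)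

theorem ricci_eq (a b : Fin 3) (x : M) : F.ricci a b x =
    -F.riem x ![2, a, 0, b] + 2 * F.riem x ![1, a, 1, b] - F.riem x ![0, a, 2, b] := by
  simp [ricci, riem, Fin.sum_univ_three, eta]

theorem scal_eq (x : M) : F.scal x = -F.ricci 0 2 x + 2 * F.ricci 1 1 x - F.ricci 2 0 x := by
  simp [scal, Fin.sum_univ_three, etaInv]
  ring

/-- The Schouten tensor. -/
def schouten (x : M) : Matrix (Fin 3) (Fin 3) ℝ :=
  Matrix.of fun a b => F.ricci a b x - F.scal x / 4 * eta a b

theorem schouten_apply (a b : Fin 3) (x : M) :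
    F.schouten x a b = F.ricci a b x - F.scal x / 4 * eta a b := rfl

variable {F} {x : M}

theorem ricci_symm (hx : x ∈ F.dom) (a b : Fin 3) : F.ricci a b x = F.ricci b a x := by
  rw [ricci_eq, ricci_eq, F.riem_pair_symm hx 2 a 0 b, F.riem_pair_symm hx 1 a 1 b,
    F.riem_pair_symm hx 0 a 2 b]
  ring

theorem schouten_isSymm (hx : x ∈ F.dom) : (F.schouten x).IsSymm := by
  refine Matrix.IsSymm.ext fun a b => ?_
  rw [schouten_apply, schouten_apply, ricci_symm hx b a]
  fin_cases a <;> fin_cases b <;> simp [eta]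

/-- There is no Weyl tensor in dimension three: by the symmetries only components on the pairs 01,
02, 12 matter, and the Ricci tensor determines all six of them. -/
theorem riem_eq_ofSchouten (hx : x ∈ F.dom) : F.riem x = ofSchouten (F.schouten x) := by
  have sl := F.riem_swap_left hx
  have sr := F.riem_swap_right hx
  have ps := F.riem_pair_symm hx
  have z1 (a c d) : F.riem x ![a, a, c, d] = 0 := by linarith [sl a a c d]
  have z2 (a b c) : F.riem x ![a, b, c, c] = 0 := by linarith [sr a b c c]
  have r00 : F.ricci 0 0 x = 2 * F.riem x ![0, 1, 0, 1] := by
    rw [ricci_eq]; linarith [z1 0 2 0, z2 2 0 0, sl 1 0 1 0, sr 0 1 1 0]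
  have r22 : F.ricci 2 2 x = 2 * F.riem x ![1, 2, 1, 2] := by
    rw [ricci_eq]; linarith [z1 2 0 2, z2 0 2 2]
  have r01 : F.ricci 0 1 x = F.riem x ![0, 2, 0, 1] := by
    rw [ricci_eq]; linarith [z1 0 2 1, z2 1 0 1, sl 2 0 0 1]
  have r12 : F.ricci 1 2 x = F.riem x ![1, 2, 0, 2] := by
    rw [ricci_eq]; linarith [z1 1 1 2, z2 0 1 2, sl 2 1 0 2]
  have r11 : F.ricci 1 1 x = 2 * F.riem x ![0, 1, 1, 2] := by
    rw [ricci_eq]; linarith [z1 1 1 1, sl 2 1 0 1, ps 1 2 0 1, sr 0 1 2 1]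
  have r02 : F.ricci 0 2 x = F.riem x ![0, 2, 0, 2] - 2 * F.riem x ![0, 1, 1, 2] := by
    rw [ricci_eq]; linarith [z1 0 2 2, sl 2 0 0 2, sl 1 0 1 2]
  have r20 := ricci_symm hx 2 0
  have r10 := ricci_symm hx 1 0
  have r21 := ricci_symm hx 2 1
  have sc := F.scal_eq x
  have g (a b c d) : kn eta (F.schouten x) a b c d = -kn eta (F.schouten x) b a c d := by
    simp only [kn]; ring
  have g' (a b c d) : kn eta (F.schouten x) a b c d = -kn eta (F.schouten x) a b d c := by
    simp only [kn]; ring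
  funext i
  rw [eq_vec_four i, ofSchouten_apply]
  generalize i 0 = a, i 1 = b, i 2 = c, i 3 = d
  have p1 := ps 0 2 0 1
  have p2 := ps 1 2 0 1
  have p3 := ps 0 2 1 2
  have main (a b : Fin 3) (h : (a = 0 ∧ b = 1) ∨ (a = 0 ∧ b = 2) ∨ (a = 1 ∧ b = 2)) (c d) :
      F.riem x ![a, b, c, d] = kn eta (F.schouten x) a b c d := by
    refine antisymm_ext (f := fun c d => F.riem x ![a, b, c, d])
      (g := fun c d => kn eta (F.schouten x) a b c d) (sr a b) (g' a b) ?_ ?_ ?_ c d <;>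
    rcases h with ⟨rfl, rfl⟩ | ⟨rfl, rfl⟩ | ⟨rfl, rfl⟩ <;>
    simp [kn, eta, schouten_apply] <;> linarith
  exact antisymm_ext (f := fun a b => F.riem x ![a, b, c, d])
    (g := fun a b => kn eta (F.schouten x) a b c d) (fun a b => sl a b c d) (fun a b => g a b c d)
    (main 0 1 (by simp) c d) (main 0 2 (by simp) c d) (main 1 2 (by simp) c d) a b

/-- Read off from the transformation of the Riemann tensor, by injectivity and O(η)-naturality of
the Kulkarni–Nomizu product with η. -/
theorem schouten_transform {F' : NullFrame g} (hx : x ∈ F.dom) (hx' : x ∈ F'.dom) :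
    F'.schouten x = (F.transition F' x)ᵀ * F.schouten x * F.transition F' x := by
  refine ofSchouten_injective (schouten_isSymm hx') ?_ ?_
  · rw [Matrix.IsSymm, Matrix.transpose_mul, Matrix.transpose_mul, Matrix.transpose_transpose,
      (schouten_isSymm hx).eq, Matrix.mul_assoc]
  · rw [← riem_eq_ofSchouten hx', ← tensorSub_ofSchouten (F.transition_mem F' hx hx'),
      ← riem_eq_ofSchouten hx]
    funext i
    exact F.riem_transform F' hx hx' i

/-- The canonical form of the Schouten tensor of type DZ. -/
theorem schouten_of_canonical (hF : F.IsCanonicalDZ) (hx : x ∈ F.dom) :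
    F.schouten x = canonicalSchouten (F.Psi2 x) (F.scal x) := by
  obtain ⟨h1, h3, h0, h4, -⟩ := hF x hx
  have h2 : F.Psi2 x = F.Psi2 x := rfl
  simp only [Psi0, Psi1, Psi3, Psi4] at h0 h1 h3 h4
  conv_lhs at h2 => rw [Psi2]
  rw [ricciTF] at h0 h1 h3 h4 h2
  have sc := F.scal_eq x
  have r20 := ricci_symm hx 2 0
  have r10 := ricci_symm hx 1 0
  have r21 := ricci_symm hx 2 1
  ext i j
  fin_cases i <;> fin_cases j <;> simp [eta, schouten_apply, canonicalSchouten] at * <;> linarith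

end NullFrame

end Manifold

/-! ### Frames with constant canonical curvature -/

theorem tensorInfAct_five (A : Matrix (Fin 3) (Fin 3) ℝ) (T : Tensor 5) (a b c d e : Fin 3) :
    tensorInfAct A T ![a, b, c, d, e] = -∑ k, (A k a * T ![k, b, c, d, e]
      + A k b * T ![a, k, c, d, e] + A k c * T ![a, b, k, d, e] + A k d * T ![a, b, c, k, e]
      + A k e * T ![a, b, c, d, k]) := by
  rw [tensorInfAct, Finset.sum_comm]
  congr 1
  refine Finset.sum_congr rfl fun k _ => ?_
  have h0 : Function.update ![a, b, c, d, e] 0 k = ![k, b, c, d, e] := by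
    ext i; fin_cases i <;> rfl
  have h1 : Function.update ![a, b, c, d, e] 1 k = ![a, k, c, d, e] := by
    ext i; fin_cases i <;> rfl
  have h2 : Function.update ![a, b, c, d, e] 2 k = ![a, b, k, d, e] := by
    ext i; fin_cases i <;> rfl
  have h3 : Function.update ![a, b, c, d, e] 3 k = ![a, b, c, k, e] := by
    ext i; fin_cases i <;> rfl
  have h4 : Function.update ![a, b, c, d, e] 4 k = ![a, b, c, d, k] := by
    ext i; fin_cases i <;> rfl
  rw [Fin.sum_univ_five, h0, h1, h2, h3, h4]
  rfl

section Manifold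

variable {M : Type*} [TopologicalSpace M] [ChartedSpace (EuclideanSpace ℝ (Fin 3)) M]
  [IsManifold (𝓡 3) ∞ M]

namespace NullFrame

variable {g : LorentzMetric M} {F : NullFrame g} {x : M}

variable (F) in
/-- The matrix of `v ↦ ∇_{e_a} v` on fields with constant components. -/
def connMatrix (x : M) (a : Fin 3) : Matrix (Fin 3) (Fin 3) ℝ :=
  skewMatrix (F.connLow a 1 0 x) (F.connLow a 2 0 x) (F.connLow a 2 1 x)

theorem conn_eq_connMatrix (hx : x ∈ F.dom) (a b c : Fin 3) :
    F.conn c a b x = F.connMatrix x a c b := by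
  have h := F.connLow_antisymm hx
  have h00 := h a 0 0
  have h11 := h a 1 1
  have h22 := h a 2 2
  have h01 := h a 0 1
  have h02 := h a 0 2
  have h12 := h a 1 2
  fin_cases b <;> fin_cases c <;>
    simp [conn, connMatrix, skewMatrix, Fin.sum_univ_three, etaInv] <;> linarith

/-- For constant components only the connection terms are left, and they form the infinitesimal
action of the connection matrix. -/
theorem covDer_of_eventually_const {k : ℕ} {T : M → Tensor k} (hx : x ∈ F.dom)
    (hT : ∀ᶠ y in 𝓝 x, T y = T x) (i : Fin (k + 1) → Fin 3) :
    F.covDer T x i = tensorInfAct (F.connMatrix x (i (Fin.last k))) (T x) (Fin.init i) := by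
  rw [covDer, deriv_eq, dirDeriv_of_eventually_const (hT.mono fun y hy => congrFun hy _)]
  simp only [conn_eq_connMatrix hx, tensorInfAct, zero_sub]
  rfl

theorem bracketLow_swap (a b c : Fin 3) : F.bracketLow a b c x = -F.bracketLow b a c x := by
  rw [bracketLow, bracketLow, VectorField.mlieBracket_swap, Pi.neg_apply, map_neg]
  rfl

theorem bracket_eq_conn (a b c : Fin 3) :
    F.bracket a b c x = F.conn c a b x - F.conn c b a x := by
  have h (d) : F.bracketLow a b d x = F.connLow a b d x - F.connLow b a d x := by
    simp only [connLow]
    linarith [F.bracketLow_swap (x := x) a b d]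
  simp only [bracket, conn, h, mul_sub, Finset.sum_sub_distrib]

/-- The first covariant derivative of constant canonical curvature. -/
theorem riemDer_one_canonical (hF : F.IsCanonicalDZ) (hx : x ∈ F.dom)
    (hc : ∀ᶠ y in 𝓝 x, F.riem y = F.riem x) (a b c d e : Fin 3) :
    F.riemDer 1 x ![a, b, c, d, e] =
      -kn eta !![6 * F.Psi2 x * F.connLow e 2 0 x,
          3 * F.Psi2 x * (F.connLow e 2 1 x - F.connLow e 1 0 x), 0;
        3 * F.Psi2 x * (F.connLow e 2 1 x - F.connLow e 1 0 x), 0,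
          3 * F.Psi2 x * (F.connLow e 2 1 x - F.connLow e 1 0 x);
        0, 3 * F.Psi2 x * (F.connLow e 2 1 x - F.connLow e 1 0 x),
          -6 * F.Psi2 x * F.connLow e 2 0 x] a b c d := by
  refine (covDer_of_eventually_const hx hc _).trans ?_
  rw [riem_eq_ofSchouten hx, schouten_of_canonical hF hx, connMatrix,
    tensorInfAct_ofSchouten (skewMatrix_skew _ _ _), skewMatrix_canonical]
  rfl

/-- The relations between the spin coefficients that follow from isotropy. -/
theorem connLow_of_isotropy (hF : F.IsCanonicalDZ) (hx : x ∈ F.dom)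
    (hc : ∀ᶠ y in 𝓝 x, F.riem y = F.riem x) (hJ : tensorInfAct isoGen (F.riemDer 1 x) = 0) :
    F.connLow 0 2 0 x = 0 ∧ F.connLow 2 2 0 x = 0 ∧ F.connLow 1 2 1 x = F.connLow 1 1 0 x ∧
      F.connLow 0 2 1 x = F.connLow 0 1 0 x - F.connLow 1 2 0 x ∧
      F.connLow 2 2 1 x = F.connLow 2 1 0 x + F.connLow 1 2 0 x := by
  obtain ⟨-, -, -, -, hψ⟩ := hF x hx
  -- For u = e₀ + e₂ these three Bianchi components say ∇_u u = 0 and div u = 0.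
  have b1 := F.riemDer_one_cyclic hx 0 1 0 1 2
  have b2 := F.riemDer_one_cyclic hx 0 2 0 1 2
  have b3 := F.riemDer_one_cyclic hx 1 2 0 1 2
  -- Two components of the invariance suffice: modulo the Bianchi relations they kill the two shear
  -- components of u.
  have j1 := congrFun hJ ![0, 1, 0, 1, 0]
  have j2 := congrFun hJ ![0, 2, 0, 1, 2]
  rw [tensorInfAct_five] at j1 j2
  simp only [riemDer_one_canonical hF hx hc, Fin.sum_univ_three] at b1 b2 b3 j1 j2
  simp [kn, eta, isoGen] at b1 b2 b3 j1 j2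
  refine ⟨?_, ?_, ?_, ?_, ?_⟩ <;> refine mul_left_cancel₀ hψ ?_ <;> linarith

theorem deriv_add {a : Fin 3} {f h : M → ℝ} (hf : MDifferentiableAt (𝓡 3) 𝓘(ℝ, ℝ) f x)
    (hh : MDifferentiableAt (𝓡 3) 𝓘(ℝ, ℝ) h x) :
    F.deriv a (f + h) x = F.deriv a f x + F.deriv a h x := dirDeriv_add hf hh

theorem mdifferentiableAt_conn (hx : x ∈ F.dom) (a b c : Fin 3) :
    MDifferentiableAt (𝓡 3) 𝓘(ℝ, ℝ) (F.conn a b c) x := by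
  have h (d) := mdifferentiableAt_of_smoothOn F.isOpen_dom (F.contMDiffOn_connLow b c d) hx
  have h' : F.conn a b c = etaInv a 0 • F.connLow b c 0 + etaInv a 1 • F.connLow b c 1
      + etaInv a 2 • F.connLow b c 2 := by
    funext y
    simp [conn, Fin.sum_univ_three]
  rw [h']
  exact (((h 0).const_smul _).add ((h 1).const_smul _)).add ((h 2).const_smul _)

/-- The relations of `connLow_of_isotropy` force the value of `α²`. -/
theorem alpha_sq_of_relations (hF : F.IsCanonicalDZ) (hx : x ∈ F.dom)
    (h : ∀ y ∈ F.dom, F.connLow 0 2 0 y = 0 ∧ F.connLow 2 2 0 y = 0 ∧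
      F.connLow 1 2 1 y = F.connLow 1 1 0 y ∧
      F.connLow 0 2 1 y = F.connLow 0 1 0 y - F.connLow 1 2 0 y ∧
      F.connLow 2 2 1 y = F.connLow 2 1 0 y + F.connLow 1 2 0 y) :
    F.connLow 1 2 0 x ^ 2 = F.Psi2 x - F.scal x / 12 := by
  have hd := mdifferentiableAt_conn hx
  -- The four terms sum to the derivative of the a-th component of ∇_u u, u = e₀ + e₂, which
  -- vanishes identically.
  have four (a : Fin 3) : F.deriv a (F.conn a 0 0) x + F.deriv a (F.conn a 0 2) x
      + F.deriv a (F.conn a 2 0) x + F.deriv a (F.conn a 2 2) x = 0 := by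
    rw [← deriv_add (hd _ _ _) (hd _ _ _), ← deriv_add ((hd _ _ _).add (hd _ _ _)) (hd _ _ _),
      ← deriv_add (((hd _ _ _).add (hd _ _ _)).add (hd _ _ _)) (hd _ _ _), deriv_eq]
    refine dirDeriv_of_eventually_const (c := 0) ?_
    filter_upwards [F.isOpen_dom.mem_nhds hx] with y hy
    obtain ⟨h1, h2, -, h4, h5⟩ := h y hy
    simp only [Pi.add_apply, conn_eq_connMatrix hy, connMatrix, h1, h2, h4, h5]
    fin_cases a <;> simp [skewMatrix] <;> ring
  -- Likewise for the divergence of u.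
  have six (a : Fin 3) : F.deriv a (F.conn 0 0 0) x + F.deriv a (F.conn 0 0 2) x
      + F.deriv a (F.conn 1 1 0) x + F.deriv a (F.conn 1 1 2) x
      + F.deriv a (F.conn 2 2 0) x + F.deriv a (F.conn 2 2 2) x = 0 := by
    rw [← deriv_add (hd _ _ _) (hd _ _ _), ← deriv_add ((hd _ _ _).add (hd _ _ _)) (hd _ _ _),
      ← deriv_add (((hd _ _ _).add (hd _ _ _)).add (hd _ _ _)) (hd _ _ _),
      ← deriv_add ((((hd _ _ _).add (hd _ _ _)).add (hd _ _ _)).add (hd _ _ _)) (hd _ _ _),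
      ← deriv_add (((((hd _ _ _).add (hd _ _ _)).add (hd _ _ _)).add (hd _ _ _)).add (hd _ _ _))
        (hd _ _ _), deriv_eq]
    refine dirDeriv_of_eventually_const (c := 0) ?_
    filter_upwards [F.isOpen_dom.mem_nhds hx] with y hy
    obtain ⟨h1, h2, h3, -, -⟩ := h y hy
    simp only [Pi.add_apply, conn_eq_connMatrix hy, connMatrix, h1, h2, h3]
    simp [skewMatrix]
  -- This is Ric(u,u) = div(∇_u u) - u(div u) - tr((∇u)²). The relations say that ∇u is 2α times
  -- `isoGen`, whose square has trace -8.
  have hric : F.ricci 0 0 x + F.ricci 0 2 x + F.ricci 2 0 x + F.ricci 2 2 x =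
      8 * F.connLow 1 2 0 x ^ 2 := by
    obtain ⟨h1, h2, h3, h4, h5⟩ := h x hx
    have d0 := four 0
    have d1 := four 1
    have d2 := four 2
    have s0 := six 0
    have s2 := six 2
    simp only [ricci, riemUp, Fin.sum_univ_three, bracket_eq_conn]
    simp only [conn_eq_connMatrix hx, connMatrix, h1, h2, h3, h4, h5]
    simp [skewMatrix]
    linear_combination d0 + d1 + d2 - s0 - s2
  have hP := schouten_of_canonical hF hx
  have e00 := congrFun (congrFun hP 0) 0
  have e02 := congrFun (congrFun hP 0) 2
  have e22 := congrFun (congrFun hP 2) 2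
  simp [schouten_apply, canonicalSchouten, eta] at e00 e02 e22
  linarith [ricci_symm hx 2 0]

theorem continuousAt_connLow (hx : x ∈ F.dom) (a b c : Fin 3) :
    ContinuousAt (F.connLow a b c) x :=
  ((F.contMDiffOn_connLow a b c).contMDiffAt (F.isOpen_dom.mem_nhds hx)).continuousAt

/-- Continuity at `x` excludes the other square root nearby, unless both roots are 0. -/
theorem eventually_const_of_sq {f : M → ℝ} {c : ℝ} (hf : ContinuousAt f x)
    (h : ∀ᶠ y in 𝓝 x, f y ^ 2 = c) : ∀ᶠ y in 𝓝 x, f y = f x := by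
  have hx := h.self_of_nhds
  by_cases h0 : f x = 0
  · filter_upwards [h] with y hy
    rw [h0]
    rw [← hx, h0] at hy
    simpa using hy
  · have : ∀ᶠ y in 𝓝 x, f y ≠ -f x := hf.eventually_ne (fun h => h0 (by linarith))
    filter_upwards [h, this] with y hy hy'
    rw [← hx] at hy
    exact (sq_eq_sq_iff_eq_or_eq_neg.1 hy).resolve_right hy'

/-- The components of ∇Riem involve Ψ₂ and ∇u only, and the relations express ∇u by α; the
remaining, frame-dependent connection coefficients drop out. -/
theorem eventually_curv_one (hF : F.IsCanonicalDZ)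
    (hc : ∀ y ∈ F.dom, ∀ᶠ z in 𝓝 y, F.riem z = F.riem y)
    (h : ∀ y ∈ F.dom, F.connLow 0 2 0 y = 0 ∧ F.connLow 2 2 0 y = 0 ∧
      F.connLow 1 2 1 y = F.connLow 1 1 0 y ∧
      F.connLow 0 2 1 y = F.connLow 0 1 0 y - F.connLow 1 2 0 y ∧
      F.connLow 2 2 1 y = F.connLow 2 1 0 y + F.connLow 1 2 0 y)
    (hx : x ∈ F.dom) (hα : ∀ᶠ y in 𝓝 x, F.connLow 1 2 0 y = F.connLow 1 2 0 x) :
    ∀ᶠ y in 𝓝 x, F.curv 1 y = F.curv 1 x := by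
  filter_upwards [hc x hx, hα, F.isOpen_dom.mem_nhds hx] with y hy hay hyd
  have hψ : F.Psi2 y = F.Psi2 x := by
    have hr (a b : Fin 3) : F.ricci a b y = F.ricci a b x := by
      rw [ricci_eq, ricci_eq, hy]
    simp only [Psi2, ricciTF, scal_eq, hr]
  funext j
  fin_cases j
  · exact hy
  · funext i
    have hi : i = ![i 0, i 1, i 2, i 3, i 4] := by
      ext j; fin_cases j <;> rfl
    change F.riemDer 1 y i = F.riemDer 1 x i
    rw [hi, riemDer_one_canonical hF hyd (hc y hyd), riemDer_one_canonical hF hx (hc x hx)]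
    obtain ⟨h1, h2, h3, h4, h5⟩ := h x hx
    obtain ⟨k1, k2, k3, k4, k5⟩ := h y hyd
    generalize (i 4 : Fin 3) = e
    have e2 : F.connLow e 2 0 y = F.connLow e 2 0 x := by
      fin_cases e
      · exact k1.trans h1.symm
      · exact hay
      · exact k2.trans h2.symm
    have e3 : F.connLow e 2 1 y - F.connLow e 1 0 y = F.connLow e 2 1 x - F.connLow e 1 0 x := by
      fin_cases e <;> simp <;> linarith
    rw [e2, e3, hψ]

end NullFrame

end Manifold

/-! ### Isotropy of normalizing cross-sections -/

theorem tensorInfAct_conj_eq_zero {k : ℕ} {A : Matrix (Fin 3) (Fin 3) ℝ} {T : Tensor k}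
    (h : tensorInfAct A T = 0) (Z : GL (Fin 3) ℝ) :
    tensorInfAct ((Z : Matrix (Fin 3) (Fin 3) ℝ) * A * ((Z⁻¹ : GL (Fin 3) ℝ) : Matrix _ _ ℝ))
      (tensorAct Z T) = 0 := by
  refine tensorInfAct_eq_zero_of_fixed fun t => ?_
  rw [expGL_conj, ← tensorAct_mul, inv_mul_cancel_right, tensorAct_mul,
    tensorAct_expGL_of_infAct_eq_zero h]

section Manifold

variable {M : Type*} [TopologicalSpace M] [ChartedSpace (EuclideanSpace ℝ (Fin 3)) M]
  [IsManifold (𝓡 3) ∞ M] {g : LorentzMetric M} {x : M}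

namespace NullFrame

/-- The group element is the inverse of the transition matrix, since the action on covariant tensors
uses X⁻¹. -/
theorem exists_orthGroup_act (F F' : NullFrame g) (hx : x ∈ F.dom) (hx' : x ∈ F'.dom) :
    ∃ Z ∈ orthGroup, F'.riem x = tensorAct Z (F.riem x) ∧
      F'.riemDer 1 x = tensorAct Z (F.riemDer 1 x) := by
  have hA := F.transition_mem F' hx hx'
  set A := F.transition F' x with hAdef
  have hBA : etaInv * Aᵀ * eta * A = 1 := by
    rw [← mul_eq_one_comm.1 eta_mul_etaInv]
    conv_rhs => rw [← hA]
    simp only [Matrix.mul_assoc]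
  let Y : GL (Fin 3) ℝ := ⟨A, etaInv * Aᵀ * eta, mul_eq_one_comm.1 hBA, hBA⟩
  have hY : Y ∈ orthGroup := hA
  refine ⟨Y⁻¹, inv_mem hY, ?_, ?_⟩
  · rw [tensorAct_eq_tensorSub, inv_inv]
    exact funext (F.riem_transform F' hx hx')
  · rw [tensorAct_eq_tensorSub, inv_inv]
    exact funext (F.riemDer_one_transform F' hx hx')

theorem isoGen_riem {F : NullFrame g} (hF : F.IsCanonicalDZ) (hx : x ∈ F.dom) :
    tensorInfAct isoGen (F.riem x) = 0 := by
  rw [riem_eq_ofSchouten hx, schouten_of_canonical hF hx]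
  exact tensorInfAct_isoGen_canonical _ _

theorem eq_smul_isoGen_of_riem {F : NullFrame g} (hF : F.IsCanonicalDZ) (hx : x ∈ F.dom)
    {A : Matrix (Fin 3) (Fin 3) ℝ} (hA : Aᵀ * eta + eta * A = 0)
    (h : tensorInfAct A (F.riem x) = 0) : A = A 0 1 • isoGen := by
  rw [riem_eq_ofSchouten hx, schouten_of_canonical hF hx] at h
  exact eq_smul_isoGen hA (hF x hx).2.2.2.2 h

end NullFrame

namespace IsNormalizingCrossSection

variable {p : ℕ} {S : Set (CurvSpace p)} {G : Subgroup (GL (Fin 3) ℝ)}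

theorem tensorInfAct_eq_zero (hS : IsNormalizingCrossSection g p S G) {F : NullFrame g}
    (hF : F.IsAdapted S) (hx : x ∈ F.dom) {A : Matrix (Fin 3) (Fin 3) ℝ}
    (hA : ∀ t, expGL A t ∈ G) (j : Fin (p + 1)) : tensorInfAct A (F.riemDer j x) = 0 :=
  tensorInfAct_eq_zero_of_fixed fun t => congrFun (hS.fixes _ (hA t) _ (hF x hx)) j

/-- Relative to a canonical frame, the isotropy is generated by multiples of `isoGen`. -/
theorem conj_eq_smul_isoGen (hS : IsNormalizingCrossSection g p S G) {F F' : NullFrame g}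
    (hF : F.IsCanonicalDZ) (hF' : F'.IsAdapted S) (hx : x ∈ F.dom) (hx' : x ∈ F'.dom)
    {Z : GL (Fin 3) ℝ} (hZ : Z ∈ orthGroup) (hR : F.riem x = tensorAct Z (F'.riem x))
    {A : Matrix (Fin 3) (Fin 3) ℝ} (hA : ∀ t, expGL A t ∈ G) :
    ∃ c : ℝ, (Z : Matrix (Fin 3) (Fin 3) ℝ) * A * ((Z⁻¹ : GL (Fin 3) ℝ) : Matrix _ _ ℝ) =
      c • isoGen := by
  refine ⟨_, NullFrame.eq_smul_isoGen_of_riem hF hx (skew_of_expGL_mem fun t => ?_) ?_⟩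
  · rw [expGL_conj]
    exact mul_mem (mul_mem hZ (hS.le_orthGroup (hA t))) (inv_mem hZ)
  · rw [hR]
    exact tensorInfAct_conj_eq_zero (hS.tensorInfAct_eq_zero hF' hx' hA 0) Z

/-- Generators of the group fix the curvature in an adapted frame; carried over to the canonical
frame they lie on the line of `isoGen`. -/
theorem groupDim_le_one (hS : IsNormalizingCrossSection g p S G) {F : NullFrame g}
    (hF : F.IsCanonicalDZ) (hx : x ∈ F.dom) : groupDim G ≤ 1 := by
  obtain ⟨F', hx', hF'⟩ := hS.cover x
  obtain ⟨Z, hZ, hR, -⟩ := F'.exists_orthGroup_act F hx' hx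
  have hle : lieAlg G ≤ Submodule.span ℝ
      {((Z⁻¹ : GL (Fin 3) ℝ) : Matrix (Fin 3) (Fin 3) ℝ) * isoGen *
        (Z : Matrix (Fin 3) (Fin 3) ℝ)} := by
    refine lieAlg_le fun A hA => ?_
    obtain ⟨c, hc⟩ := hS.conj_eq_smul_isoGen hF hF' hx hx' hZ hR hA
    refine Submodule.mem_span_singleton.2 ⟨c, ?_⟩
    rw [← Matrix.smul_mul, ← Matrix.mul_smul, ← hc]
    simp only [← Matrix.mul_assoc, Units.inv_mul, Matrix.one_mul]
    rw [Matrix.mul_assoc, Units.inv_mul, Matrix.mul_one]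
  refine (Submodule.finrank_mono hle).trans ?_
  simpa using finrank_span_le_card (R := ℝ)
    ({((Z⁻¹ : GL (Fin 3) ℝ) : Matrix (Fin 3) (Fin 3) ℝ) * isoGen *
        (Z : Matrix (Fin 3) (Fin 3) ℝ)} : Set (Matrix (Fin 3) (Fin 3) ℝ))

/-- A nonzero generator of the group becomes a nonzero multiple of `isoGen` in the canonical frame.
As 1 ≤ p, it fixes ∇Riem as well. -/
theorem isoGen_riemDer_one (hS : IsNormalizingCrossSection g p S G) (hp : 1 ≤ p)
    (hG : 0 < groupDim G) {F : NullFrame g} (hF : F.IsCanonicalDZ) (hx : x ∈ F.dom) :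
    tensorInfAct isoGen (F.riemDer 1 x) = 0 := by
  obtain ⟨F', hx', hF'⟩ := hS.cover x
  obtain ⟨Z, hZ, hR, hR1⟩ := F'.exists_orthGroup_act F hx' hx
  obtain ⟨A, hA0, hA⟩ := exists_generator_of_groupDim_pos hG
  obtain ⟨c, hc⟩ := hS.conj_eq_smul_isoGen hF hF' hx hx' hZ hR hA
  have h1 := tensorInfAct_conj_eq_zero
    (hS.tensorInfAct_eq_zero hF' hx' hA ⟨1, by omega⟩) Z
  change tensorInfAct _ (tensorAct Z (F'.riemDer 1 x)) = 0 at h1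
  rw [hc, ← hR1, tensorInfAct_smul] at h1
  refine (smul_eq_zero.1 h1).resolve_left fun h0 => hA0 ?_
  rw [h0, zero_smul] at hc
  have : A = ((Z⁻¹ : GL (Fin 3) ℝ) : Matrix (Fin 3) (Fin 3) ℝ) *
      ((Z : Matrix (Fin 3) (Fin 3) ℝ) * A * ((Z⁻¹ : GL (Fin 3) ℝ) : Matrix _ _ ℝ)) *
      (Z : Matrix (Fin 3) (Fin 3) ℝ) := by
    simp only [← Matrix.mul_assoc, Units.inv_mul, Matrix.one_mul]
    rw [Matrix.mul_assoc, Units.inv_mul, Matrix.mul_one]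
  rw [this, hc, Matrix.mul_zero, Matrix.zero_mul]

/-- The conjugated rotations fix the value of R^{(p)} in the cross-section, so they map a point of
it into it, and maximality puts them in the group. -/
theorem groupDim_pos (hS : IsNormalizingCrossSection g p S G) (hp : p ≤ 1) {F : NullFrame g}
    (hF : F.IsCanonicalDZ) (hx : x ∈ F.dom)
    (h1 : 1 ≤ p → tensorInfAct isoGen (F.riemDer 1 x) = 0) : 0 < groupDim G := by
  obtain ⟨F', hx', hF'⟩ := hS.cover x
  obtain ⟨Z, hZ, hR, hR1⟩ := F.exists_orthGroup_act F' hx hx'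
  set A := (Z : Matrix (Fin 3) (Fin 3) ℝ) * isoGen * ((Z⁻¹ : GL (Fin 3) ℝ) : Matrix _ _ ℝ)
    with hAdef
  have hfix (j : ℕ) (hj : j ≤ p) : tensorInfAct A (F'.riemDer j x) = 0 := by
    have hj1 : j = 0 ∨ j = 1 := by omega
    rcases hj1 with rfl | rfl
    · change tensorInfAct A (F'.riem x) = 0
      rw [hR]
      exact tensorInfAct_conj_eq_zero (NullFrame.isoGen_riem hF hx) Z
    · rw [hR1]
      exact tensorInfAct_conj_eq_zero (h1 hj) Z
  have hmem : A ∈ lieAlg G := by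
    refine mem_lieAlg_of_expGL_mem fun t => hS.maximal _ ?_ ⟨F'.curv p x, ⟨_, hF' x hx', ?_⟩,
      hF' x hx'⟩
    · rw [hAdef, expGL_conj]
      exact mul_mem (mul_mem hZ (expGL_mem_of_skew isoGen_skew t)) (inv_mem hZ)
    · exact funext fun j =>
        tensorAct_expGL_of_infAct_eq_zero (hfix j (Nat.lt_succ_iff.1 j.2)) t
  have hne : A ≠ 0 := by
    intro h0
    have : isoGen = ((Z⁻¹ : GL (Fin 3) ℝ) : Matrix (Fin 3) (Fin 3) ℝ) * A *
        (Z : Matrix (Fin 3) (Fin 3) ℝ) := by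
      rw [hAdef]
      simp only [← Matrix.mul_assoc, Units.inv_mul, Matrix.one_mul]
      rw [Matrix.mul_assoc, Units.inv_mul, Matrix.mul_one]
    rw [h0, Matrix.mul_zero, Matrix.zero_mul] at this
    have := congrFun (congrFun this 0) 1
    simp [isoGen] at this
  exact Module.finrank_pos_iff_exists_ne_zero.2 ⟨⟨A, hmem⟩, fun h => hne (congrArg Subtype.val h)⟩

end IsNormalizingCrossSection

/-! ### Local constancy -/

/-- Pass to a ball in the chart, which is connected. -/
theorem eventually_const_of_mfderiv_eq_zero {E : Type*} [NormedAddCommGroup E] [NormedSpace ℝ E]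
    {f : M → E} {U : Set M} (hU : IsOpen U)
    (hd : ∀ y ∈ U, MDifferentiableAt (𝓡 3) 𝓘(ℝ, E) f y)
    (h0 : ∀ y ∈ U, mfderiv (𝓡 3) 𝓘(ℝ, E) f y = 0) (hx : x ∈ U) :
    ∀ᶠ y in 𝓝 x, f y = f x := by
  set φ := extChartAt (𝓡 3) x with hφ
  have hV : IsOpen (φ.target ∩ φ.symm ⁻¹' U) :=
    (continuousOn_extChartAt_symm x).isOpen_inter_preimage (isOpen_extChartAt_target x) hU
  have hxV : φ x ∈ φ.target ∩ φ.symm ⁻¹' U :=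
    ⟨mem_extChartAt_target x, by simpa [hφ, extChartAt_to_inv] using hx⟩
  obtain ⟨ε, hε, hball⟩ := Metric.isOpen_iff.1 hV _ hxV
  have hsymm (u) (hu : u ∈ φ.target) : MDifferentiableAt 𝓘(ℝ, EuclideanSpace ℝ (Fin 3)) (𝓡 3)
      φ.symm u := by
    have := mdifferentiableWithinAt_extChartAt_symm (I := 𝓡 3) hu
    rwa [ModelWithCorners.range_eq_univ, mdifferentiableWithinAt_univ] at this
  have hcomp (u) (hu : u ∈ Metric.ball (φ x) ε) :
      HasFDerivAt (f ∘ φ.symm) (0 : EuclideanSpace ℝ (Fin 3) →L[ℝ] E) u := by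
    have h1 := (hd _ (hball hu).2).hasMFDerivAt.comp u (hsymm u (hball hu).1).hasMFDerivAt
    rw [h0 _ (hball hu).2, ContinuousLinearMap.zero_comp] at h1
    exact h1.hasFDerivAt
  have hmem : φ.source ∩ φ ⁻¹' Metric.ball (φ x) ε ∈ 𝓝 x :=
    Filter.inter_mem (extChartAt_source_mem_nhds x)
      ((continuousAt_extChartAt x).preimage_mem_nhds (Metric.ball_mem_nhds _ hε))
  filter_upwards [hmem] with y hy
  have := Metric.isOpen_ball.is_const_of_fderiv_eq_zero
    (convex_ball (φ x) ε).isPreconnected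
    (fun u hu => (hcomp u hu).differentiableAt.differentiableWithinAt)
    (fun u hu => (hcomp u hu).fderiv) hy.2 (Metric.mem_ball_self hε)
  rwa [Function.comp_apply, Function.comp_apply, φ.left_inv hy.1, hφ, extChartAt_to_inv] at this

end Manifold

/-! ### Curvature homogeneous metrics of type DZ -/

section Manifold

variable {M : Type*} [TopologicalSpace M] [ChartedSpace (EuclideanSpace ℝ (Fin 3)) M]
  [IsManifold (𝓡 3) ∞ M] {g : LorentzMetric M} {x : M}

namespace NullFrame

theorem schouten_congr {F : NullFrame g} {y : M} (h : F.riem y = F.riem x) :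
    F.schouten y = F.schouten x := by
  ext a b
  simp only [schouten_apply, scal_eq, ricci_eq, h]

theorem eventually_riem {F : NullFrame g}
    (h0 : ∀ y ∈ F.dom, Module.finrank ℝ (F.horizontalRange 0 y) = 0) (hx : x ∈ F.dom) :
    ∀ᶠ y in 𝓝 x, F.riem y = F.riem x := by
  have hd (y) (hy : y ∈ F.dom) :
      MDifferentiableAt (𝓡 3) 𝓘(ℝ, CurvSpace 0) (F.curv 0) y := by
    refine ContMDiffAt.mdifferentiableAt (n := ∞) ?_ (by simp)
    refine contMDiffAt_pi_space.2 fun j => contMDiffAt_pi_space.2 fun i => ?_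
    obtain rfl : j = 0 := Fin.fin_one_eq_zero j
    exact F.contMDiffAt_riem hy i
  have hm (y) (hy : y ∈ F.dom) : mfderiv (𝓡 3) 𝓘(ℝ, CurvSpace 0) (F.curv 0) y = 0 := by
    have := Submodule.finrank_eq_zero.1 (h0 y hy)
    exact ContinuousLinearMap.coe_injective (LinearMap.range_eq_bot.1 this)
  filter_upwards [eventually_const_of_mfderiv_eq_zero F.isOpen_dom hd hm hx] with y hy
  exact congrFun hy 0

/-- Local constancy of the curvature passes from any frame to canonical frames. -/
theorem eventually_riem_canonical {F F' : NullFrame g} (hF : F.IsCanonicalDZ) (hx : x ∈ F.dom)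
    (hx' : x ∈ F'.dom) (hc : ∀ᶠ y in 𝓝 x, F'.riem y = F'.riem x) :
    ∀ᶠ y in 𝓝 x, F.riem y = F.riem x := by
  filter_upwards [hc, F.isOpen_dom.mem_nhds hx, F'.isOpen_dom.mem_nhds hx'] with y hy hyF hyF'
  have h1 := schouten_transform hyF' hyF
  rw [schouten_congr hy, schouten_transform hx hx', schouten_of_canonical hF hx,
    schouten_of_canonical hF hyF] at h1
  have o1 := F'.transition_mem F hyF' hyF
  have o2 := F.transition_mem F' hx hx'
  set A := F'.transition F y
  set B := F.transition F' x
  -- `A` belongs to the point `y` and `B` to `x`. They compose because the curvature has the same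
  -- components in `F'` at both points.
  have o3 : (B * A)ᵀ * eta * (B * A) = eta := by
    calc (B * A)ᵀ * eta * (B * A) = Aᵀ * (Bᵀ * eta * B) * A := by
          simp only [Matrix.transpose_mul, Matrix.mul_assoc]
      _ = eta := by rw [o2, o1]
  obtain ⟨e1, e2⟩ := canonicalSchouten_inj o3 (ψ := F.Psi2 x) (r := F.scal x)
    (by rw [h1]; simp only [Matrix.transpose_mul, Matrix.mul_assoc])
  rw [riem_eq_ofSchouten hyF, riem_eq_ofSchouten hx, schouten_of_canonical hF hx,
    schouten_of_canonical hF hyF, e1, e2]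

/-- The rank of the lift of locally constant curvature is the dimension of an orbit. -/
theorem liftedRank_of_eventually_const {F : NullFrame g} {p : ℕ}
    (hc : ∀ᶠ y in 𝓝 x, F.curv p y = F.curv p x) :
    F.liftedRank p x =
      Module.finrank ℝ (LinearMap.range ((infActLin (F.curv p x)).domRestrict (lieAlg orthGroup))) := by
  have h1 : mfderiv (𝓡 3) 𝓘(ℝ, CurvSpace p) (F.curv p) x = 0 := by
    have h : F.curv p =ᶠ[𝓝 x] fun _ => F.curv p x := hc
    rw [h.mfderiv_eq, mfderiv_const]
  have h2 : F.horizontalRange p x = ⊥ := by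
    rw [horizontalRange, h1]
    exact LinearMap.range_zero
  have h3 : {T | ∃ A ∈ lieAlg orthGroup, T = infAct A (F.curv p x)} =
      (LinearMap.range ((infActLin (F.curv p x)).domRestrict (lieAlg orthGroup)) : Set _) := by
    ext T
    constructor
    · rintro ⟨A, hA, rfl⟩
      exact ⟨⟨A, hA⟩, rfl⟩
    · rintro ⟨A, rfl⟩
      exact ⟨A, A.2, rfl⟩
  rw [liftedRank, h2, bot_sup_eq, h3, Submodule.span_eq]

/-- Both ranks are orbit dimensions. The stabilizer of Riem consists of multiples of `isoGen`, which
also fix ∇Riem, so the stabilizers agree. -/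
theorem liftedRank_zero_eq_one {F : NullFrame g} (hF : F.IsCanonicalDZ) (hx : x ∈ F.dom)
    (hc : ∀ᶠ y in 𝓝 x, F.curv 1 y = F.curv 1 x)
    (hJ : tensorInfAct isoGen (F.riemDer 1 x) = 0) : F.liftedRank 0 x = F.liftedRank 1 x := by
  have hc0 : ∀ᶠ y in 𝓝 x, F.curv 0 y = F.curv 0 x := by
    filter_upwards [hc] with y hy
    funext j
    obtain rfl : j = 0 := Fin.fin_one_eq_zero j
    exact congrFun hy 0
  rw [liftedRank_of_eventually_const hc, liftedRank_of_eventually_const hc0]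
  have h0 := LinearMap.finrank_range_add_finrank_ker
    ((infActLin (F.curv 0 x)).domRestrict (lieAlg orthGroup))
  have h1 := LinearMap.finrank_range_add_finrank_ker
    ((infActLin (F.curv 1 x)).domRestrict (lieAlg orthGroup))
  have hker : LinearMap.ker ((infActLin (F.curv 0 x)).domRestrict (lieAlg orthGroup)) =
      LinearMap.ker ((infActLin (F.curv 1 x)).domRestrict (lieAlg orthGroup)) := by
    ext A
    rw [LinearMap.mem_ker, LinearMap.mem_ker]
    constructor
    · intro h
      have hA : tensorInfAct A.1 (F.riem x) = 0 := congrFun h 0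
      have hs := eq_smul_isoGen_of_riem hF hx (skew_of_mem_lieAlg A.2) hA
      funext j
      fin_cases j
      · exact hA
      · change tensorInfAct A.1 (F.riemDer 1 x) = 0
        rw [hs, tensorInfAct_smul, hJ, smul_zero]
    · intro h
      funext j
      obtain rfl : j = 0 := Fin.fin_one_eq_zero j
      exact congrFun h 0
  rw [hker] at h0
  omega

/-- The frame obtained from `F` by a constant element of `O(η)`, on a smaller domain. -/
def changeConst (F : NullFrame g) (B : Matrix (Fin 3) (Fin 3) ℝ) (hB : Bᵀ * eta * B = eta)
    {U : Set M} (hU : IsOpen U) (hUF : U ⊆ F.dom) : NullFrame g where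
  dom := U
  isOpen_dom := hU
  e a x := ∑ k, B k a • F.e k x
  contMDiffOn a := by
    have h (k : Fin 3) : SmoothField (fun x => B k a • F.e k x) U :=
      (((F.contMDiffOn k).mono hUF).const_smul_section)
    exact ContMDiffOn.sum_section fun k _ => h k
  inner_eq x hx a b := by
    have h := congrFun (congrFun hB a) b
    rw [← h]
    simp only [map_add, map_smul, add_apply, smul_apply,
      F.inner_eq x (hUF hx), Matrix.mul_apply, Matrix.transpose_apply, smul_eq_mul,
      Fin.sum_univ_three]
    ring

/-- The coefficients of a quartic with two complex conjugate double roots `a ± √d i`. -/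
theorem IsDZAt.exists_coeff {F : NullFrame g} (h : F.IsDZAt x) : ∃ a d : ℝ, 0 < d ∧
    F.Psi4 x ≠ 0 ∧ F.Psi3 x = -a * F.Psi4 x ∧ 3 * F.Psi2 x = (3 * a ^ 2 + d) * F.Psi4 x ∧
    F.Psi1 x = -a * (a ^ 2 + d) * F.Psi4 x ∧ F.Psi0 x = (a ^ 2 + d) ^ 2 * F.Psi4 x := by
  obtain ⟨h4, w, hw, hz⟩ := h
  refine ⟨w.re, w.im ^ 2, by positivity, h4, ?_⟩
  have key (t : ℝ) : F.Psi0 x + 4 * F.Psi1 x * t + 6 * F.Psi2 x * t ^ 2 + 4 * F.Psi3 x * t ^ 3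
      + F.Psi4 x * t ^ 4 = F.Psi4 x * ((t - w.re) ^ 2 + w.im ^ 2) ^ 2 := by
    have h1 := hz t
    have h2 : ((t : ℂ) - w) * (t - (starRingEnd ℂ) w) = (((t - w.re) ^ 2 + w.im ^ 2 : ℝ) : ℂ) := by
      apply Complex.ext
      · rw [Complex.ofReal_re]
        simp
        ring
      · rw [Complex.ofReal_im]
        simp
        ring
    have h3 : (F.Psi4 x : ℂ) * (t - w) ^ 2 * (t - (starRingEnd ℂ) w) ^ 2 =
        ((F.Psi4 x * ((t - w.re) ^ 2 + w.im ^ 2) ^ 2 : ℝ) : ℂ) := by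
      rw [mul_assoc, ← mul_pow, h2]
      push_cast
      ring
    rw [h3] at h1
    exact_mod_cast h1
  -- Five values determine a quartic.
  have k0 := key 0
  have k1 := key 1
  have k2 := key (-1)
  have k3 := key 2
  have k4 := key (-2)
  refine ⟨?_, ?_, ?_, ?_⟩ <;> linarith

/-- Constant curvature of type DZ admits a canonical frame. -/
theorem exists_isCanonicalDZ {F : NullFrame g} (hx : x ∈ F.dom) (hDZ : F.IsDZAt x)
    (hc : ∀ᶠ y in 𝓝 x, F.riem y = F.riem x) : ∃ F' : NullFrame g, x ∈ F'.dom ∧ F'.IsCanonicalDZ := by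
  obtain ⟨a, d, hd, h4, h3, h2, h1, h0⟩ := hDZ.exists_coeff
  obtain ⟨U, hU, hUo, hxU⟩ := mem_nhds_iff.1 (Filter.inter_mem (F.isOpen_dom.mem_nhds hx) hc)
  -- The quartic is the trace-free Ricci tensor on the null vectors e₀ + 2z e₁ + z² e₂. The new
  -- frame substitutes z = a + z'/c: a null rotation centres the roots, and the boost with c = 1/√d
  -- moves them to ±i.
  obtain ⟨c, hc0, hcd⟩ : ∃ c : ℝ, c ≠ 0 ∧ c ^ 2 * d = 1 := by
    refine ⟨(√d)⁻¹, inv_ne_zero (Real.sqrt_ne_zero'.2 hd), ?_⟩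
    rw [inv_pow, Real.sq_sqrt hd.le, inv_mul_cancel₀ hd.ne']
  have hB : (!![c, 0, 0; 2 * a * c, 1, 0; a ^ 2 * c, a, c⁻¹] : Matrix (Fin 3) (Fin 3) ℝ)ᵀ * eta *
      !![c, 0, 0; 2 * a * c, 1, 0; a ^ 2 * c, a, c⁻¹] = eta := by
    ext i j
    fin_cases i <;> fin_cases j <;>
      simp [eta, Matrix.mul_apply, Fin.sum_univ_three, hc0] <;> ring
  refine ⟨F.changeConst _ hB hUo fun y hy => (hU hy).1, hxU, fun y hy => ?_⟩
  set F' := F.changeConst _ hB hUo fun y hy => (hU hy).1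
  have hyF := (hU hy).1
  have hP : F'.schouten y = _ := schouten_transform hyF hy
  rw [F.transition_eq_of_eq_sum F' hyF fun _ => rfl, schouten_congr (hU hy).2] at hP
  have hs := schouten_isSymm hx
  have s10 := hs.apply 0 1
  have s20 := hs.apply 0 2
  have s21 := hs.apply 1 2
  have psi2 (E : NullFrame g) (z) (hz : z ∈ E.dom) :
      3 * E.Psi2 z = E.schouten z 0 2 + 2 * E.schouten z 1 1 := by
    simp only [Psi2, ricciTF, schouten_apply, scal_eq, ricci_symm hz 2 0]
    simp [eta]
    ring
  have psi (E : NullFrame g) (z) : E.Psi0 z = E.schouten z 0 0 ∧ E.Psi1 z = E.schouten z 0 1 ∧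
      E.Psi3 z = E.schouten z 1 2 ∧ E.Psi4 z = E.schouten z 2 2 := by
    simp [Psi0, Psi1, Psi3, Psi4, ricciTF, schouten_apply, eta]
  obtain ⟨p0, p1, p3, p4⟩ := psi F x
  have p2 := psi2 F x hx
  obtain ⟨q0, q1, q3, q4⟩ := psi F' y
  have q2 := psi2 F' y hy
  have hci : c⁻¹ * c⁻¹ = d := by
    field_simp
    linarith
  have hcc : c * c⁻¹ = 1 := mul_inv_cancel₀ hc0
  rw [hP] at q0 q1 q2 q3 q4
  simp [Matrix.mul_apply, Fin.sum_univ_three, s10, s20, s21] at q0 q1 q2 q3 q4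
  generalize F.schouten x = P at *
  have e12 : P 1 2 = -a * P 2 2 := by rw [← p3, h3, p4]
  have e01 : P 0 1 = -a * (a ^ 2 + d) * P 2 2 := by rw [← p1, h1, p4]
  have e00 : P 0 0 = (a ^ 2 + d) ^ 2 * P 2 2 := by rw [← p0, h0, p4]
  have e02 : P 0 2 = (3 * a ^ 2 + d) * P 2 2 - 2 * P 1 1 := by rw [← p4, ← h2, p2]; ring
  rw [e12, e01, e02] at q1
  rw [e12, e02] at q2
  rw [e12] at q3
  rw [e00, e12, e01, e02] at q0
  have r0 : F'.Psi0 y = d * P 2 2 := by linear_combination q0 + P 2 2 * d * hcd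
  have r1 : F'.Psi1 y = 0 := by linear_combination q1
  have r2 : 3 * F'.Psi2 y = d * P 2 2 := by
    linear_combination q2 + ((2 * a ^ 2 + d) * P 2 2 - 2 * P 1 1) * hcc
  have r3 : F'.Psi3 y = 0 := by linear_combination q3
  have r4 : F'.Psi4 y = d * P 2 2 := by linear_combination q4 + P 2 2 * hci
  refine ⟨r1, r3, r0.trans r2.symm, r4.trans r2.symm, fun h => ?_⟩
  rw [h, mul_zero] at r2
  exact mul_ne_zero hd.ne' (p4 ▸ h4) r2.symm

end NullFrame

theorem CurvatureHomogeneous.eventually_riem (hCH : CurvatureHomogeneous g 0) (x : M) :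
    ∃ F : NullFrame g, x ∈ F.dom ∧ ∀ᶠ y in 𝓝 x, F.riem y = F.riem x := by
  obtain ⟨-, S, G, hS, h0⟩ := hCH
  obtain ⟨F, hx, hF⟩ := hS.cover x
  exact ⟨F, hx, NullFrame.eventually_riem (h0 F hF) hx⟩

theorem CurvatureHomogeneous.eventually_riem_canonical (hCH : CurvatureHomogeneous g 0)
    {F : NullFrame g} (hF : F.IsCanonicalDZ) (x : M) (hx : x ∈ F.dom) :
    ∀ᶠ y in 𝓝 x, F.riem y = F.riem x := by
  obtain ⟨F', hx', hc⟩ := hCH.eventually_riem x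
  exact NullFrame.eventually_riem_canonical hF hx hx' hc

/-- The spin coefficients of a canonical frame, if the first covariant derivative of the curvature
is isotropic. -/
theorem NullFrame.spin_coefficients_of_isotropy (hCH : CurvatureHomogeneous g 0)
    {F : NullFrame g} (hF : F.IsCanonicalDZ)
    (hJ : ∀ y ∈ F.dom, tensorInfAct isoGen (F.riemDer 1 y) = 0) (hx : x ∈ F.dom) :
    (F.spEpsilon x = 0 ∧ F.spGamma x = 0 ∧ F.spSigma x - F.spLambda x = 0 ∧
      F.spKappa x - F.spPi x = 2 * F.spAlpha x ∧
      F.spTau x - F.spNu x = -(2 * F.spAlpha x)) ∧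
    4 * F.spAlpha x ^ 2 = F.Psi2 x - F.scal x / 12 ∧
    (∀ᶠ y in 𝓝 x, F.spAlpha y = F.spAlpha x) ∧
    (∀ᶠ y in 𝓝 x, F.curv 1 y = F.curv 1 x) := by
  have hc := hCH.eventually_riem_canonical hF
  have hrel (y) (hy : y ∈ F.dom) := connLow_of_isotropy hF hy (hc y hy) (hJ y hy)
  have hsq (y) (hy : y ∈ F.dom) := alpha_sq_of_relations hF hy hrel
  have hα : ∀ᶠ y in 𝓝 x, F.connLow 1 2 0 y = F.connLow 1 2 0 x := by
    refine eventually_const_of_sq (c := F.Psi2 x - F.scal x / 12)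
      (continuousAt_connLow hx 1 2 0) ?_
    filter_upwards [hc x hx, F.isOpen_dom.mem_nhds hx] with y hy hyd
    rw [hsq y hyd]
    simp only [Psi2, ricciTF, scal_eq, ricci_eq, hy]
  obtain ⟨h1, h2, h3, h4, h5⟩ := hrel x hx
  refine ⟨⟨?_, ?_, ?_, ?_, ?_⟩, ?_, ?_, eventually_curv_one hF hc hrel hx hα⟩
  · rw [spEpsilon, h1, zero_div]
  · rw [spGamma, h2, zero_div]
  · rw [spSigma, spLambda, h3, sub_self]
  · rw [spKappa, spPi, spAlpha, h4]; ring
  · rw [spTau, spNu, spAlpha, h5]; ring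
  · rw [← hsq x hx, spAlpha]; ring
  · filter_upwards [hα] with y hy
    rw [spAlpha, spAlpha, hy]

/-- From s_k > s_q one gets s_k > 0, hence invariance of ∇Riem, hence q ≤ 1; but then s_q ≥ 1, while
s_k ≤ 1. -/
theorem not_pseudoStable [Nonempty M] (hDZ : TypeDZ g) (hCH : CurvatureHomogeneous g 0) (k : ℕ) :
    ¬ PseudoStable g k := by
  rintro ⟨-, hk, s, q, hs, ⟨r, hr, hq⟩, -, hlt⟩
  obtain ⟨F₀, hx₀, hc₀⟩ := hCH.eventually_riem (Classical.arbitrary M)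
  obtain ⟨F, hx, hF⟩ := NullFrame.exists_isCanonicalDZ hx₀ (hDZ F₀ _ hx₀) hc₀
  obtain ⟨S, G, hS, hG⟩ := hs k
  have hJ (y) (hy : y ∈ F.dom) : tensorInfAct isoGen (F.riemDer 1 y) = 0 :=
    hS.isoGen_riemDer_one hk (by omega) hF hy
  have hc := (NullFrame.spin_coefficients_of_isotropy hCH hF hJ hx).2.2.2
  have h01 : r 0 = r 1 := by
    rw [← hr 0 F _ hx, ← hr 1 F _ hx]
    exact NullFrame.liftedRank_zero_eq_one hF hx hc (hJ _ hx)
  -- The equality r₀ = r₁ puts 1 in the set of which `q` is the least element.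
  have hq1 : q ≤ 1 := hq.2 (by simpa using h01)
  obtain ⟨S', G', hS', hG'⟩ := hs q
  have h1 := hS'.groupDim_pos hq1 hF hx fun _ => hJ _ hx
  have h2 := hS.groupDim_le_one hF hx
  omega

end Manifold

end Lorentz3

end

theorem mainTheorem9 {M : Type*} [TopologicalSpace M]
    [ChartedSpace (EuclideanSpace ℝ (Fin 3)) M] [IsManifold (𝓡 3) ∞ M] [Nonempty M]
    (g : Lorentz3.LorentzMetric M)
    (hreg : Lorentz3.FullyRegular g)
    (hDZ : Lorentz3.TypeDZ g)
    (hCH : Lorentz3.CurvatureHomogeneous g 0) :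
    (¬ ∃ k : ℕ, Lorentz3.PseudoStable g k) ∧
    ((∃ s : ℕ, Lorentz3.HasFrameFreedom g 0 s ∧ Lorentz3.HasFrameFreedom g 1 s) →
      ∀ F : Lorentz3.NullFrame g, F.IsCanonicalDZ → ∀ x ∈ F.dom,
        (F.spEpsilon x = 0 ∧ F.spGamma x = 0 ∧ F.spSigma x - F.spLambda x = 0 ∧
          F.spKappa x - F.spPi x = 2 * F.spAlpha x ∧
          F.spTau x - F.spNu x = -(2 * F.spAlpha x)) ∧
        4 * F.spAlpha x ^ 2 = F.Psi2 x - F.scal x / 12 ∧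
        (∀ᶠ y in 𝓝 x, F.spAlpha y = F.spAlpha x) ∧
        (∀ᶠ y in 𝓝 x, F.curv 1 y = F.curv 1 x)) := by
  refine ⟨fun ⟨k, hk⟩ => Lorentz3.not_pseudoStable hDZ hCH k hk, ?_⟩
  rintro ⟨s, ⟨S₀, G₀, hS₀, hG₀⟩, S₁, G₁, hS₁, hG₁⟩ F hF x hx
  -- At order 0 the condition on ∇Riem is vacuous, so s₀ > 0 always; the equality s₁ = s₀ transfers
  -- this to order 1.
  have hs : 0 < s := by
    rw [← hG₀]
    exact hS₀.groupDim_pos zero_le_one hF hx fun h => absurd h (by norm_num)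
  exact Lorentz3.NullFrame.spin_coefficients_of_isotropy hCH hF
    (fun y hy => hS₁.isoGen_riemDer_one le_rfl (hG₁ ▸ hs) hF hy) hx
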